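/- Let $d\ge 1$ and let $p=(p_x)_{x\in\mathbb Z^d}$ be a probability distribution on $\mathbb Z^d$. The lonely branching random walks with jump kernel $p$ and branching rate $\gamma$ are the Markov process $\eta(t)=(\eta_x(t))_{x\in\mathbb Z^d}\in\mathbb N_0^{\mathbb Z^d}$, $t\ge 0$, where $\eta_x(t)$ is the number of particles at site $x$ at time $t$, with the following dynamics. Each particle at a site $x$ jumps to $y$ at rate $p_{y-x}$, for every $y\in\mathbb Z^d$, and a particle that is alone at its site branches at rate $\gamma$: it then splits into two particles or disappears, with probability $1/2$ each. That is, from a configuration $\eta$ the transitions are $$\eta\to\eta-\delta_x+\delta_y \ \text{ at rate } \eta_x\,p_{y-x},\qquad \eta\to\eta+\delta_x\ \text{ and }\ \eta\to\eta-\delta_x,\ \text{ each at rate } \tfrac{\gamma}{2}\mathbf 1_{\{\eta_x=1\}}.$$ For finitely many particles this is a non-explosive continuous-time Markov chain. For an infinite initial configuration the transition law at time $t$ is the limit, as $n\to\infty$ and in the sense of convergence of the probabilities of all events that prescribe the particle numbers at finitely many sites, of the laws at time $t$ of the systems started from the restrictions of the configuration to $[-n,n]^d$. The initial configuration $\eta(0)$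 may be random. **Theorem.** Suppose that the random walk on $\mathbb Z^d$ with jump kernel $p$ is irreducible and that the random walk with the symmetrised jump kernel $\widehat p_x=(p_x+p_{-x})/2$ is recurrent. Suppose further that $\gamma>0$ and $\sup_{x\in\mathbb Z^d}\mathbb E[\eta_x(0)]<\infty$. Then the lonely branching random walks die out locally in probability: $$\lim_{t\to\infty}\mathbb P(\eta_x(t)=0)=1\qquad\text{for all }x\in\mathbb Z^d .$$ -/

import Mathlib

open MeasureTheory Filter Topology
open scoped ENNReal NNReal

noncomputable section

namespace LonelyBRW

/-- The lattice `ℤ^d`. -/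
abbrev Site (d : ℕ) := Fin d → ℤ

/-- Particle configurations `η ∈ ℕ₀^(ℤ^d)`: `η x` is the number of particles at the site `x`. -/
abbrev Config (d : ℕ) := Site d → ℕ

/-- Configurations with finitely many particles. -/
abbrev FinConfig (d : ℕ) := Site d →₀ ℕ

variable {d : ℕ}

/-! ### Random walks on the lattice -/

/-- `nStep q n x` is the probability that the (discrete-time) walk with jump kernel `q`, started
at `0`, is at `x` after `n` steps. -/
def nStep (q : Site d → ℝ≥0∞) : ℕ → Site d → ℝ≥0∞
  | 0, x => if x = 0 then 1 else 0
  | n + 1, x => ∑' y, q y * nStep q n (x - y)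

/-- Irreducibility: every site is reached with positive probability (from `0`, hence, by
translation invariance, from every site). -/
def IsIrreducible (q : Site d → ℝ≥0∞) : Prop :=
  ∀ x, ∃ n, 0 < nStep q n x

/-- The symmetrised kernel `x ↦ (q x + q (-x)) / 2`. -/
def symmetrised (q : Site d → ℝ≥0∞) (x : Site d) : ℝ≥0∞ := (q x + q (-x)) / 2

/-- `hitWithin q n x` is the probability that the walk with jump kernel `q`, started at `x`, visits
`0` at one of the times `0, 1, …, n`. -/
def hitWithin (q : Site d → ℝ≥0∞) : ℕ → Site d → ℝ≥0∞
  | 0, x => if x = 0 then 1 else 0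
  | n + 1, x => if x = 0 then 1 else ∑' y, q y * hitWithin q n (x + y)

/-- Recurrence: the walk started at `0` returns to `0` (at some time `≥ 1`) with probability `1`.
The first step leads to `y` with probability `q y`. -/
def IsRecurrent (q : Site d → ℝ≥0∞) : Prop :=
  ∑' y, q y * (⨆ n, hitWithin q n y) = 1

/-! ### Systems with finitely many particles

With finitely many particles the system is a continuous-time Markov chain on the countable set
`FinConfig d` with the following transitions:
`ξ ⟶ ξ - δ_x + δ_y` at rate `ξ x * p (y - x)`, for all sites `x`, `y`;
`ξ ⟶ ξ + δ_x` and `ξ ⟶ ξ - δ_x`, each at rate `γ / 2`, for all `x` with `ξ x = 1`. -/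

/-- The total rate of all transitions from `ξ`: each particle jumps at rate `1` (jumps of length
zero count), each lonely particle branches at rate `γ`. -/
def totalRate (γ : ℝ≥0) (ξ : FinConfig d) : ℝ≥0 :=
  ∑ x ∈ ξ.support, ((ξ x : ℝ≥0) + if ξ x = 1 then γ else 0)

/-- The sum of `g ξ'` over all transitions `ξ ⟶ ξ'`, weighted by their rates. -/
def rateSum (p : PMF (Site d)) (γ : ℝ≥0) (g : FinConfig d → ℝ≥0∞) (ξ : FinConfig d) : ℝ≥0∞ :=
  ∑ x ∈ ξ.support,
    ((∑' y, (ξ x : ℝ≥0∞) * p (y - x) * g (ξ - Finsupp.single x 1 + Finsupp.single y 1)) +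
      if ξ x = 1 then
        (γ : ℝ≥0∞) / 2 * (g (ξ + Finsupp.single x 1) + g (ξ - Finsupp.single x 1))
      else 0)

/-- `transProbLT p γ A n t ξ` is the probability that the chain started at `ξ` makes fewer than
`n` transitions up to time `t` and is in `A` at time `t`: either there is no transition up to time
`t`, or the first one happens at a time `s ≤ t`. -/
def transProbLT (p : PMF (Site d)) (γ : ℝ≥0) (A : Set (FinConfig d)) :
    ℕ → ℝ → FinConfig d → ℝ≥0∞
  | 0, _, _ => 0
  | n + 1, t, ξ =>
      ENNReal.ofReal (Real.exp (-(totalRate γ ξ * t))) * A.indicator 1 ξ +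
        ∫⁻ s in Set.Icc 0 t, ENNReal.ofReal (Real.exp (-(totalRate γ ξ * s))) *
          rateSum p γ (fun ξ' => transProbLT p γ A n (t - s) ξ') ξ

/-- The transition probability `P_ξ(ξ(t) ∈ A)` of the system with finitely many particles. -/
def transProb (p : PMF (Site d)) (γ : ℝ≥0) (t : ℝ≥0) (ξ : FinConfig d)
    (A : Set (FinConfig d)) : ℝ≥0∞ :=
  ⨆ n, transProbLT p γ A n t ξ

/-! ### General systems -/

/-- The restriction of the configuration `η` to the box `[-n, n]^d`. -/
def truncate (n : ℕ) (η : Config d) : FinConfig d :=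
  Finsupp.onFinset (Finset.Icc (fun _ => -(n : ℤ)) (fun _ => (n : ℤ)))
    (fun x => if x ∈ Finset.Icc (fun _ : Fin d => -(n : ℤ)) (fun _ => (n : ℤ)) then η x else 0)
    (fun x hx => by
      by_contra h
      exact hx (if_neg h))

/-- The σ-algebra generated by `η r`, `r ≤ s`. -/
abbrev past {Ω : Type*} (η : ℝ≥0 → Ω → Config d) (s : ℝ≥0) : MeasurableSpace Ω :=
  ⨆ r : ℝ≥0, ⨆ _ : r ≤ s, MeasurableSpace.comap (η r) inferInstance

/-- `η` is a (locally finite) system of lonely branching random walks with jump kernel `p` and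
branching rate `γ`, defined on the probability space `(Ω, μ)`, with arbitrary, possibly random,
initial configuration: it is the Markov process whose transition laws are the limits of those of
the systems with finitely many particles. That is, given the past up to time `s`, the configuration
at time `s + t` has the law of the system at time `t` started from `η s`, and this law is the
limit, as `n → ∞`, of the laws of the systems started from the restriction of `η s` to `[-n, n]^d`,
in the sense that the probability of seeing prescribed particle numbers `k x` at finitely many
sites `x ∈ F` converges. -/
structure IsLonelyBRW {Ω : Type*} [MeasurableSpace Ω] (p : PMF (Site d)) (γ : ℝ≥0)
    (μ : Measure Ω) (η : ℝ≥0 → Ω → Config d) : Prop where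
  measurable : ∀ t, Measurable (η t)
  markov : ∀ (s t : ℝ≥0) (F : Finset (Site d)) (k : Config d), ∀ᵐ ω ∂μ,
    Tendsto
      (fun n : ℕ => (transProb p γ t (truncate n (η s ω)) {ξ | ∀ x ∈ F, ξ x = k x}).toReal)
      atTop
      (𝓝 ((μ[Set.indicator {ω' | ∀ x ∈ F, η (s + t) ω' x = k x} (fun _ => (1 : ℝ)) |
        past η s]) ω))

end LonelyBRW

end

/-!
The probability that a site is occupied is a submodular, hence subadditive, function of the initial
configuration, and so is at most the sum of the occupation probabilities of systems started from one
particle. It therefore suffices to show that `S(t)`, the expected number of occupied sites of the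
system started from one particle, tends to `0`; by subadditivity and the Markov property `S` is
nonincreasing.

The expected number of particles stays `1`. As the walk spreads, an occupied site is, up to an error
that is small compared with this mean, lonely with positive probability. So if `S` did not tend to
`0`, the expected number of lonely particles would stay above some `c > 0`. Let `n` be the number of
particles at `x` at time `t`. The function `1 - 2 ^ (-n)` is concave in `n`, so its expectation is
lowered by each branching of a lonely particle, namely by an amount proportional to the squared
probability that a walk goes from the site of this particle to `x` in the remaining time. Summed
over `x` and over time, the loss is at least a multiple of the expected time that two independent
walks spend together, and it is at most the initial value of order `1`. But the difference of the
two walks is the symmetrised walk, which is recurrent, so this time is infinite.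
-/

noncomputable section

namespace LonelyBRW

variable {d : ℕ}

/-! ### A maximum principle and a Leibniz rule -/

theorem hasDerivAt_pow_div_factorial (L t : ℝ) (n : ℕ) :
    HasDerivAt (fun t => (L * t) ^ (n + 1) / (n + 1).factorial) (L * ((L * t) ^ n / n.factorial))
      t := by
  have h := (((hasDerivAt_id' t).const_mul L).fun_pow (n + 1)).div_const ((n + 1).factorial : ℝ)
  refine h.congr_deriv ?_
  have : (n.factorial : ℝ) ≠ 0 := by positivity
  rw [Nat.factorial_succ, Nat.add_sub_cancel]
  push_cast
  field_simp

section MaximumPrinciple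

variable {I : Type*} {u u' : ℝ → I → ℝ} {T K L : ℝ}

theorem le_pow_div_factorial_of_rightDeriv_le (hK : 0 ≤ K) (hL0 : 0 ≤ L)
    (hu : ∀ t ∈ Set.Icc 0 T, ∀ i, u t i ≤ K)
    (hcont : ∀ i, ContinuousOn (fun t => u t i) (Set.Icc 0 T))
    (hder : ∀ i, ∀ t ∈ Set.Ico 0 T, HasDerivWithinAt (fun t => u t i) (u' t i) (Set.Ici t) t)
    (h0 : ∀ i, u 0 i ≤ 0)
    (hL : ∀ t ∈ Set.Ico 0 T, ∀ m, 0 ≤ m → (∀ j, u t j ≤ m) → ∀ i, 0 < u t i → u' t i ≤ L * m)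
    (n : ℕ) : ∀ t ∈ Set.Icc 0 T, ∀ i, u t i ≤ K * ((L * t) ^ n / n.factorial) := by
  induction n with
  | zero => simpa using hu
  | succ n ih =>
    intro t ht i
    refine le_of_forall_pos_le_add fun δ hδ => ?_
    have ht1 : 0 < 1 + t := by linarith [ht.1]
    -- The extra slope makes the bound on the derivative strict where the two graphs meet.
    set e := δ / (1 + t)
    have he : 0 < e := div_pos hδ ht1
    have hB : ∀ s, HasDerivAt
        (fun s => K * ((L * s) ^ (n + 1) / (n + 1).factorial) + e * (1 + s))
        (K * (L * ((L * s) ^ n / n.factorial)) + e * 1) s := fun s =>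
      ((hasDerivAt_pow_div_factorial L s n).const_mul K).add
        (((hasDerivAt_id' s).const_add 1).const_mul e)
    have hle := image_le_of_deriv_right_lt_deriv_boundary (hcont i) (hder i) ?_ hB ?_ ht
    · rwa [div_mul_cancel₀ _ ht1.ne'] at hle
    · simpa using (h0 i).trans he.le
    · intro s hs heq
      have hs0 : 0 ≤ s := hs.1
      have hslope := hL s hs (K * ((L * s) ^ n / n.factorial)) (by positivity)
        (ih s ⟨hs.1, hs.2.le⟩) i (by rw [heq]; positivity)
      linarith

theorem nonpos_of_rightDeriv_le (hL0 : 0 ≤ L)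
    (hu : ∀ t ∈ Set.Icc 0 T, ∀ i, u t i ≤ K)
    (hcont : ∀ i, ContinuousOn (fun t => u t i) (Set.Icc 0 T))
    (hder : ∀ i, ∀ t ∈ Set.Ico 0 T, HasDerivWithinAt (fun t => u t i) (u' t i) (Set.Ici t) t)
    (h0 : ∀ i, u 0 i ≤ 0)
    (hL : ∀ t ∈ Set.Ico 0 T, ∀ m, 0 ≤ m → (∀ j, u t j ≤ m) → ∀ i, 0 < u t i → u' t i ≤ L * m) :
    ∀ t ∈ Set.Icc 0 T, ∀ i, u t i ≤ 0 := by
  intro t ht i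
  have hlim : Tendsto (fun n : ℕ => max K 0 * ((L * t) ^ n / n.factorial)) atTop (𝓝 0) := by
    simpa using (FloorSemiring.tendsto_pow_div_factorial_atTop (L * t)).const_mul (max K 0)
  exact ge_of_tendsto' hlim fun n => le_pow_div_factorial_of_rightDeriv_le (le_max_right K 0) hL0
    (fun s hs j => (hu s hs j).trans (le_max_left K 0)) hcont hder h0 hL n t ht i

end MaximumPrinciple

theorem hasDerivAt_integral_of_continuous_deriv {f f' : ℝ → ℝ → ℝ} (hf : Continuous ↿f)
    (hf' : Continuous ↿f') (hder : ∀ t r, HasDerivAt (f · r) (f' t r) t) (a t₀ : ℝ) :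
    HasDerivAt (fun t => ∫ r in a..t, f t r) (f t₀ t₀ + ∫ r in a..t₀, f' t₀ r) t₀ := by
  let F : ℝ → ℝ → ℝ := fun t b => ∫ r in a..b, f t r
  let F₁ : ℝ → ℝ → ℝ := fun t b => ∫ r in a..b, f' t r
  have hF₁ : Continuous ↿F₁ := intervalIntegral.continuous_parametric_primitive_of_continuous hf'
  have hparam : ∀ t b, HasDerivAt (fun t => F t b) (F₁ t b) t := by
    intro t b
    obtain ⟨C, hC⟩ := ((isCompact_closedBall t 1).prod
      (isCompact_uIcc (a := a) (b := b))).exists_bound_of_continuousOn hf'.continuousOn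
    have hf_r : ∀ t, Continuous (f t) := fun t => hf.comp (Continuous.prodMk_right t)
    exact (intervalIntegral.hasDerivAt_integral_of_dominated_loc_of_deriv_le
      (bound := fun _ => C) (Metric.closedBall_mem_nhds t one_pos)
      (Eventually.of_forall fun t => (hf_r t).aestronglyMeasurable)
      ((hf_r t).intervalIntegrable a b)
      (hf'.comp (Continuous.prodMk_right t)).aestronglyMeasurable
      (Eventually.of_forall fun r hr s hs => hC (s, r) ⟨hs, Set.uIoc_subset_uIcc hr⟩)
      intervalIntegrable_const (Eventually.of_forall fun r _ s _ => hder s r)).2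
  have hend : ∀ t b, HasDerivAt (F t) (f t b) b := fun t b =>
    (hf.comp (Continuous.prodMk_right t)).integral_hasStrictDerivAt a b |>.hasDerivAt
  have hderF := (hasStrictFDerivAt_uncurry_coprod (u := (t₀, t₀)) (f := F)
    (f₁ := fun t b => ContinuousLinearMap.toSpanSingleton ℝ (F₁ t b))
    (f₂ := fun t b => ContinuousLinearMap.toSpanSingleton ℝ (f t b))
    (Eventually.of_forall fun v => (hparam v.1 v.2).hasFDerivAt)
    (Eventually.of_forall fun v => (hend v.1 v.2).hasFDerivAt)
    ((ContinuousLinearMap.toSpanSingletonCLE.continuous.comp hF₁).continuousAt)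
    ((ContinuousLinearMap.toSpanSingletonCLE.continuous.comp hf).continuousAt)).hasFDerivAt
  have hdiag := hderF.comp_hasDerivAt (f := fun t => (t, t)) t₀
    ((hasDerivAt_id' t₀).prodMk (hasDerivAt_id' t₀))
  refine hdiag.congr_deriv ?_
  simp [F₁, Function.HasUncurry.uncurry, add_comm]

theorem hasDerivWithinAt_convolution {a S σ : ℝ → ℝ} (ha : Continuous a) (hσ : Continuous σ)
    (hS : ∀ s, 0 ≤ s → S s = S 0 + ∫ τ in (0 : ℝ)..s, σ τ) {t₀ : ℝ} (ht₀ : 0 ≤ t₀) :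
    HasDerivWithinAt (fun t => ∫ r in (0 : ℝ)..t, a r * S (t - r))
      (a t₀ * S 0 + ∫ r in (0 : ℝ)..t₀, a r * σ (t₀ - r)) (Set.Ici t₀) t₀ := by
  set R : ℝ → ℝ := fun s => S 0 + ∫ τ in (0 : ℝ)..s, σ τ with hR
  have hRder : ∀ s, HasDerivAt R (σ s) s := fun s =>
    (hσ.integral_hasStrictDerivAt 0 s).hasDerivAt.const_add _
  have hRcont : Continuous R := continuous_iff_continuousAt.2 fun s => (hRder s).continuousAt
  have hleibniz := hasDerivAt_integral_of_continuous_deriv (f := fun t r => a r * R (t - r))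
    (f' := fun t r => a r * σ (t - r)) (by fun_prop) (by fun_prop)
    (fun t r => ((hRder (t - r)).comp_sub_const t r).const_mul (a r)) 0 t₀
  have hR0 : R (t₀ - t₀) = S 0 := by simp [hR]
  rw [hR0] at hleibniz
  have heq : ∀ t ∈ Set.Ici t₀,
      ∫ r in (0 : ℝ)..t, a r * S (t - r) = ∫ r in (0 : ℝ)..t, a r * R (t - r) := by
    intro t ht
    refine intervalIntegral.integral_congr fun r hr => ?_
    rw [Set.uIcc_of_le (ht₀.trans ht)] at hr
    simp only [hS (t - r) (sub_nonneg.2 hr.2), hR]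
  exact hleibniz.hasDerivWithinAt.congr heq (heq t₀ Set.self_mem_Ici)

/-! ### The generator of the finite systems -/

section Size

theorem sub_single_add_single {α : Type*} {ξ : α →₀ ℕ} {x : α} (h : ξ x ≠ 0) :
    ξ - Finsupp.single x 1 + Finsupp.single x 1 = ξ :=
  tsub_add_cancel_of_le (Finsupp.single_le_iff.2 (Nat.one_le_iff_ne_zero.2 h))

theorem degree_sub_single {α : Type*} {ξ : α →₀ ℕ} {x : α} (h : ξ x ≠ 0) :
    Finsupp.degree (ξ - Finsupp.single x 1) + 1 = Finsupp.degree ξ := by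
  conv_rhs => rw [← sub_single_add_single h, map_add, Finsupp.degree_single]

/-- The configuration `ξ` after a jump of a particle from `x` to `x + v`; it is used only where
`ξ x ≠ 0`. -/
def jump (ξ : FinConfig d) (x v : Site d) : FinConfig d :=
  ξ - Finsupp.single x 1 + Finsupp.single (x + v) 1

theorem degree_jump {ξ : FinConfig d} {x : Site d} (h : ξ x ≠ 0) (v : Site d) :
    Finsupp.degree (jump ξ x v) = Finsupp.degree ξ := by
  rw [jump, map_add, Finsupp.degree_single, degree_sub_single h]

/-- The number of particles of a finite configuration, as a real number. -/
def size (ξ : FinConfig d) : ℝ := (Finsupp.degree ξ : ℕ)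

theorem size_nonneg (ξ : FinConfig d) : 0 ≤ size ξ := Nat.cast_nonneg _

theorem one_add_size_pos (ξ : FinConfig d) : 0 < 1 + size ξ := by linarith [size_nonneg ξ]

theorem size_add (ξ ζ : FinConfig d) : size (ξ + ζ) = size ξ + size ζ := by
  rw [size, map_add, Nat.cast_add, size, size]

@[simp] theorem size_single (x : Site d) (n : ℕ) : size (Finsupp.single x n) = n := by
  rw [size, Finsupp.degree_single]

theorem size_sub_single {ξ : FinConfig d} {x : Site d} (h : ξ x ≠ 0) :
    size (ξ - Finsupp.single x 1) = size ξ - 1 := by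
  rw [size, size, ← degree_sub_single h, Nat.cast_add, Nat.cast_one, add_sub_cancel_right]

theorem size_jump {ξ : FinConfig d} {x : Site d} (h : ξ x ≠ 0) (v : Site d) :
    size (jump ξ x v) = size ξ := by
  rw [size, degree_jump h, size]

theorem sum_eq_size (ξ : FinConfig d) : ∑ x ∈ ξ.support, (ξ x : ℝ) = size ξ := by
  rw [size, Finsupp.degree_apply, Nat.cast_sum]

theorem card_support_le_size (ξ : FinConfig d) : (ξ.support.card : ℝ) ≤ size ξ := by
  rw [← sum_eq_size, Finset.card_eq_sum_ones, Nat.cast_sum]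
  exact Finset.sum_le_sum fun x hx => by
    exact_mod_cast Nat.one_le_iff_ne_zero.2 (Finsupp.mem_support_iff.1 hx)

end Size

/-- A function of finite configurations that is bounded in terms of the number of particles. As
jumps keep the number of particles, such functions are integrable against the jump kernel. -/
def Controlled (g : FinConfig d → ℝ) : Prop := ∃ ψ : ℕ → ℝ, ∀ ξ, |g ξ| ≤ ψ (Finsupp.degree ξ)

namespace Controlled

variable {g h : FinConfig d → ℝ}

theorem of_bounded (C : ℝ) (h : ∀ ξ, |g ξ| ≤ C) : Controlled g := ⟨fun _ => C, h⟩

theorem const (c : ℝ) : Controlled (fun _ : FinConfig d => c) :=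
  of_bounded |c| fun _ => le_rfl

theorem size : Controlled (size : FinConfig d → ℝ) :=
  ⟨fun n => n, fun ξ => by rw [abs_of_nonneg (size_nonneg ξ), LonelyBRW.size]⟩

theorem add (hg : Controlled g) (hh : Controlled h) : Controlled (fun ξ => g ξ + h ξ) := by
  obtain ⟨ψ, hψ⟩ := hg
  obtain ⟨φ, hφ⟩ := hh
  exact ⟨fun n => ψ n + φ n, fun ξ => (abs_add_le _ _).trans (add_le_add (hψ ξ) (hφ ξ))⟩

theorem const_mul (hg : Controlled g) (c : ℝ) : Controlled (fun ξ => c * g ξ) := by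
  obtain ⟨ψ, hψ⟩ := hg
  exact ⟨fun n => |c| * ψ n, fun ξ =>
    (abs_mul c (g ξ)).trans_le (mul_le_mul_of_nonneg_left (hψ ξ) (abs_nonneg _))⟩

theorem sub (hg : Controlled g) (hh : Controlled h) : Controlled (fun ξ => g ξ - h ξ) := by
  simpa only [sub_eq_add_neg, neg_one_mul] using hg.add (hh.const_mul (-1))

theorem integrable {p : PMF (Site d)} (hg : Controlled g) {ξ : FinConfig d} {x : Site d}
    (h : ξ x ≠ 0) : Integrable (fun v => g (jump ξ x v)) p.toMeasure := by
  obtain ⟨ψ, hψ⟩ := hg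
  refine Integrable.of_bound (C := ψ (Finsupp.degree ξ))
    (measurable_of_countable _).aestronglyMeasurable (Eventually.of_forall fun v => ?_)
  exact (hψ (jump ξ x v)).trans_eq (by rw [degree_jump h])

end Controlled

/-- The jump part of the generator at the site `w`. -/
def jumpAt (p : PMF (Site d)) (g : FinConfig d → ℝ) (ξ : FinConfig d) (w : Site d) : ℝ :=
  (ξ w : ℝ) * (∫ v, g (jump ξ w v) ∂p.toMeasure - g ξ)

/-- The branching part of the generator at the site `w`, without the factor `γ / 2`. -/
def branchAt (g : FinConfig d → ℝ) (ξ : FinConfig d) (w : Site d) : ℝ :=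
  if ξ w = 1 then g (ξ + Finsupp.single w 1) + g (ξ - Finsupp.single w 1) - 2 * g ξ else 0

/-- The generator of the systems with finitely many particles. -/
def gen (p : PMF (Site d)) (γ : ℝ≥0) (g : FinConfig d → ℝ) (ξ : FinConfig d) : ℝ :=
  ∑ w ∈ ξ.support, (jumpAt p g ξ w + γ / 2 * branchAt g ξ w)

section Gen

variable {p : PMF (Site d)} {γ : ℝ≥0} {g h : FinConfig d → ℝ} {ξ : FinConfig d}

theorem jumpAt_of_apply_eq_zero {w : Site d} (h : ξ w = 0) : jumpAt p g ξ w = 0 := by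
  rw [jumpAt, h, Nat.cast_zero, zero_mul]

theorem branchAt_of_apply_ne_one {w : Site d} (h : ξ w ≠ 1) : branchAt g ξ w = 0 := if_neg h

theorem gen_eq_sum (g : FinConfig d → ℝ) {s : Finset (Site d)} (hs : ξ.support ⊆ s) :
    gen p γ g ξ = ∑ w ∈ s, (jumpAt p g ξ w + γ / 2 * branchAt g ξ w) := by
  refine Finset.sum_subset hs fun w _ hw => ?_
  have hw0 : ξ w = 0 := Finsupp.notMem_support_iff.1 hw
  rw [jumpAt_of_apply_eq_zero hw0, branchAt_of_apply_ne_one (by omega), mul_zero, add_zero]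

theorem gen_add (hg : Controlled g) (hh : Controlled h) (ξ : FinConfig d) :
    gen p γ (fun ξ => g ξ + h ξ) ξ = gen p γ g ξ + gen p γ h ξ := by
  rw [gen, gen, gen, ← Finset.sum_add_distrib]
  refine Finset.sum_congr rfl fun x hx => ?_
  have hx' := Finsupp.mem_support_iff.1 hx
  rw [jumpAt, integral_add (hg.integrable hx') (hh.integrable hx')]
  simp only [jumpAt, branchAt]
  split_ifs <;> ring

theorem gen_const_mul (g : FinConfig d → ℝ) (c : ℝ) (ξ : FinConfig d) :
    gen p γ (fun ξ => c * g ξ) ξ = c * gen p γ g ξ := by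
  rw [gen, gen, Finset.mul_sum]
  refine Finset.sum_congr rfl fun x _ => ?_
  rw [jumpAt, integral_const_mul]
  simp only [jumpAt, branchAt]
  split_ifs <;> ring

theorem gen_sub (hg : Controlled g) (hh : Controlled h) (ξ : FinConfig d) :
    gen p γ (fun ξ => g ξ - h ξ) ξ = gen p γ g ξ - gen p γ h ξ := by
  have := gen_add (p := p) (γ := γ) hg (hh.const_mul (-1)) ξ
  rw [gen_const_mul] at this
  simpa only [sub_eq_add_neg, neg_one_mul] using this

theorem gen_const (c : ℝ) (ξ : FinConfig d) : gen p γ (fun _ => c) ξ = 0 := by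
  refine Finset.sum_eq_zero fun x _ => ?_
  simp only [jumpAt, branchAt, integral_const, probReal_univ, one_smul]
  split_ifs <;> ring

theorem gen_size (ξ : FinConfig d) : gen p γ size ξ = 0 := by
  refine Finset.sum_eq_zero fun x hx => ?_
  have hx' := Finsupp.mem_support_iff.1 hx
  simp only [jumpAt, branchAt, size_jump hx', size_sub_single hx', size_add, size_single,
    integral_const, probReal_univ, one_smul, Nat.cast_one]
  split_ifs <;> ring

theorem gen_sub_mul_one_add_size (hg : Controlled g) (e : ℝ) (ξ : FinConfig d) :
    gen p γ (fun ξ => g ξ - e * (1 + size ξ)) ξ = gen p γ g ξ := by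
  have hsize := (Controlled.const (d := d) 1).add Controlled.size
  rw [gen_sub hg (hsize.const_mul e), gen_const_mul, gen_add (Controlled.const 1) Controlled.size,
    gen_const, gen_size, add_zero, mul_zero, sub_zero]

theorem jumpAt_le_mul {m : ℝ} (hg : Controlled g) (hle : ∀ ζ, g ζ ≤ m) (hpos : 0 ≤ g ξ)
    (w : Site d) : jumpAt p g ξ w ≤ ξ w * m := by
  by_cases hw : ξ w = 0
  · rw [jumpAt_of_apply_eq_zero hw, hw, Nat.cast_zero, zero_mul]
  have hint : ∫ v, g (jump ξ w v) ∂p.toMeasure ≤ m := by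
    simpa using integral_mono (hg.integrable hw) (integrable_const m) fun v => hle (jump ξ w v)
  exact mul_le_mul_of_nonneg_left (by linarith) (Nat.cast_nonneg _)

theorem branchAt_le_two_mul {m : ℝ} (hm : 0 ≤ m) (hle : ∀ ζ, g ζ ≤ m) (hpos : 0 ≤ g ξ)
    (w : Site d) : branchAt g ξ w ≤ 2 * m := by
  rw [branchAt]
  split_ifs
  · linarith [hle (ξ + Finsupp.single w 1), hle (ξ - Finsupp.single w 1)]
  · positivity

theorem gen_le_mul_size {m : ℝ} (hg : Controlled g) (hm : 0 ≤ m) (hle : ∀ ζ, g ζ ≤ m)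
    (hpos : 0 ≤ g ξ) : gen p γ g ξ ≤ (1 + γ) * size ξ * m := by
  calc gen p γ g ξ ≤ ∑ w ∈ ξ.support, ((ξ w : ℝ) * m + γ / 2 * (2 * m)) :=
        Finset.sum_le_sum fun w _ => add_le_add (jumpAt_le_mul hg hle hpos w)
          (mul_le_mul_of_nonneg_left (branchAt_le_two_mul hm hle hpos w) (by positivity))
    _ = size ξ * m + ξ.support.card * (γ * m) := by
        rw [Finset.sum_add_distrib, ← Finset.sum_mul, sum_eq_size, Finset.sum_const, nsmul_eq_mul]
        ring
    _ ≤ size ξ * m + size ξ * (γ * m) := by gcongr; exact card_support_le_size ξ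
    _ = (1 + γ) * size ξ * m := by ring

/- The number of particles is a martingale, so subtracting a small multiple of `1 + size` keeps the
inequality `u' ≤ gen u` and confines the positive values to configurations of bounded size, where
the total rate is bounded. -/
theorem nonpos_of_le_gen {u u' : ℝ → FinConfig d → ℝ} {T C : ℝ}
    (hC : ∀ t ∈ Set.Icc 0 T, ∀ ξ, u t ξ ≤ C)
    (hcontr : ∀ t ∈ Set.Icc 0 T, Controlled (u t))
    (hcont : ∀ ξ, ContinuousOn (fun t => u t ξ) (Set.Icc 0 T))
    (hder : ∀ ξ, ∀ t ∈ Set.Ico 0 T, HasDerivWithinAt (fun t => u t ξ) (u' t ξ) (Set.Ici t) t)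
    (h0 : ∀ ξ, u 0 ξ ≤ 0)
    (hgen : ∀ ξ, ∀ t ∈ Set.Ico 0 T, u' t ξ ≤ gen p γ (u t) ξ) :
    ∀ t ∈ Set.Icc 0 T, ∀ ξ, u t ξ ≤ 0 := by
  intro t ht ξ
  refine le_of_forall_pos_le_add fun δ hδ => ?_
  have hξ := one_add_size_pos ξ
  set e := δ / (1 + size ξ)
  have he : 0 < e := div_pos hδ hξ
  have hpen : ∀ ζ : FinConfig d, 0 ≤ e * (1 + size ζ) := fun ζ =>
    mul_nonneg he.le (one_add_size_pos ζ).le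
  have hsize : ∀ s ∈ Set.Icc 0 T, ∀ ζ, 0 < u s ζ - e * (1 + size ζ) → size ζ ≤ max C 0 / e := by
    intro s hs ζ hpos
    rw [le_div_iff₀ he]
    linarith [hC s hs ζ, le_max_left C 0]
  have hnonpos := nonpos_of_rightDeriv_le (u := fun t ξ => u t ξ - e * (1 + size ξ))
    (L := (1 + γ) * (max C 0 / e)) (K := C) (by positivity)
    (fun s hs ζ => by linarith [hC s hs ζ, hpen ζ])
    (fun ζ => (hcont ζ).sub continuousOn_const)
    (fun ζ s hs => (hder ζ s hs).sub_const _)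
    (fun ζ => by linarith [h0 ζ, hpen ζ])
    (fun s hs m hm hle ζ hpos => by
      have hs' := Set.Ico_subset_Icc_self hs
      have hcontr' := (hcontr s hs').sub
        (((Controlled.const 1).add Controlled.size).const_mul e)
      calc u' s ζ ≤ gen p γ (u s) ζ := hgen ζ s hs
        _ = gen p γ (fun ξ => u s ξ - e * (1 + size ξ)) ζ :=
            (gen_sub_mul_one_add_size (hcontr s hs') e ζ).symm
        _ ≤ (1 + γ) * size ζ * m := gen_le_mul_size hcontr' hm hle hpos.le
        _ ≤ (1 + γ) * (max C 0 / e) * m := by gcongr; exact hsize s hs' ζ hpos) t ht ξ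
  rw [div_mul_cancel₀ _ hξ.ne'] at hnonpos
  linarith

end Gen

/-! ### The backward equation -/

section RateSum

variable {p : PMF (Site d)} {γ : ℝ≥0}

theorem rateSum_eq_lintegral (g : FinConfig d → ℝ≥0∞) (ξ : FinConfig d) :
    rateSum p γ g ξ = ∑ x ∈ ξ.support, ((ξ x : ℝ≥0∞) * ∫⁻ v, g (jump ξ x v) ∂p.toMeasure +
      if ξ x = 1 then
        (γ : ℝ≥0∞) / 2 * (g (ξ + Finsupp.single x 1) + g (ξ - Finsupp.single x 1)) else 0) := by
  refine Finset.sum_congr rfl fun x _ => ?_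
  congr 1
  rw [lintegral_countable', ← ENNReal.tsum_mul_left, ← (Equiv.addLeft x).tsum_eq]
  refine tsum_congr fun v => ?_
  rw [PMF.toMeasure_apply_singleton _ _ (measurableSet_singleton v), Equiv.coe_addLeft,
    add_sub_cancel_left, jump, mul_assoc, mul_comm (p v)]

theorem rateSum_mono {g h : FinConfig d → ℝ≥0∞} (hgh : g ≤ h) (ξ : FinConfig d) :
    rateSum p γ g ξ ≤ rateSum p γ h ξ := by
  simp_rw [rateSum_eq_lintegral]
  refine Finset.sum_le_sum fun x _ => ?_
  gcongr
  · exact hgh _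
  · split_ifs
    · gcongr <;> exact hgh _
    · exact le_rfl

theorem rateSum_one (ξ : FinConfig d) : rateSum p γ (fun _ => 1) ξ = totalRate γ ξ := by
  rw [rateSum_eq_lintegral, totalRate, ENNReal.ofNNReal_finsetSum]
  refine Finset.sum_congr rfl fun x _ => ?_
  rw [lintegral_const, measure_univ]
  split_ifs
  · rw [one_add_one_eq_two, ENNReal.div_mul_cancel two_ne_zero ENNReal.ofNat_ne_top, mul_one,
      mul_one, ENNReal.coe_add, ENNReal.coe_natCast]
  · rw [mul_one, mul_one, add_zero, add_zero, ENNReal.coe_natCast]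

theorem rateSum_iSup {g : ℕ → FinConfig d → ℝ≥0∞} (hg : Monotone g) (ξ : FinConfig d) :
    rateSum p γ (fun ζ => ⨆ n, g n ζ) ξ = ⨆ n, rateSum p γ (g n) ξ := by
  simp_rw [rateSum_eq_lintegral]
  refine Eq.trans ?_ (ENNReal.finsetSum_iSup_of_monotone ?_)
  · refine Finset.sum_congr rfl fun x _ => ?_
    rw [lintegral_iSup (f := fun n v => g n (jump ξ x v)) (fun n => measurable_of_countable _)
      (fun m n h v => hg h _), ENNReal.mul_iSup]
    split_ifs
    · rw [ENNReal.iSup_add_iSup_of_monotone (fun m n h => hg h _) (fun m n h => hg h _),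
        ENNReal.mul_iSup, ENNReal.iSup_add_iSup_of_monotone]
      · intro m n h
        dsimp only
        gcongr
        exact hg h _
      · intro m n h
        dsimp only
        gcongr <;> exact hg h _
    · simp only [add_zero]
  · intro x m n h
    dsimp only
    gcongr
    · exact hg h _
    · split_ifs
      · gcongr <;> exact hg h _
      · exact le_rfl

theorem measurable_rateSum {α : Type*} [MeasurableSpace α] {g : α → FinConfig d → ℝ≥0∞}
    (hg : ∀ ξ, Measurable fun a => g a ξ) (ξ : FinConfig d) :
    Measurable fun a => rateSum p γ (g a) ξ := by
  refine Finset.measurable_sum _ fun x _ => Measurable.add ?_ ?_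
  · exact Measurable.tsum fun y => (hg _).const_mul _
  · split_ifs
    · exact ((hg _).add (hg _)).const_mul _
    · exact measurable_const

variable (p γ) in
/-- The real-valued version of `rateSum`, for functions that are integrable against the jump
kernel. -/
def rateSumReal (g : FinConfig d → ℝ) (ξ : FinConfig d) : ℝ :=
  ∑ x ∈ ξ.support, ((ξ x : ℝ) * ∫ v, g (jump ξ x v) ∂p.toMeasure + if ξ x = 1 then
    (γ : ℝ) / 2 * (g (ξ + Finsupp.single x 1) + g (ξ - Finsupp.single x 1)) else 0)

theorem rateSumReal_eq_gen_add (g : FinConfig d → ℝ) (ξ : FinConfig d) :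
    rateSumReal p γ g ξ = gen p γ g ξ + totalRate γ ξ * g ξ := by
  rw [gen, totalRate, NNReal.coe_sum, Finset.sum_mul, ← Finset.sum_add_distrib, rateSumReal]
  refine Finset.sum_congr rfl fun x _ => ?_
  rw [jumpAt, branchAt]
  split_ifs <;> push_cast <;> ring

theorem branchTerm_nonneg {g : FinConfig d → ℝ} (h0 : ∀ ξ, 0 ≤ g ξ) (ξ : FinConfig d) (x : Site d) :
    0 ≤ if ξ x = 1 then
      (γ : ℝ) / 2 * (g (ξ + Finsupp.single x 1) + g (ξ - Finsupp.single x 1)) else 0 := by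
  split_ifs
  · exact mul_nonneg (by positivity) (add_nonneg (h0 _) (h0 _))
  · exact le_rfl

theorem jumpTerm_nonneg {g : FinConfig d → ℝ} (h0 : ∀ ξ, 0 ≤ g ξ) (ξ : FinConfig d) (x : Site d) :
    0 ≤ (ξ x : ℝ) * ∫ v, g (jump ξ x v) ∂p.toMeasure :=
  mul_nonneg (Nat.cast_nonneg _) (integral_nonneg fun _ => h0 _)

theorem rateSumReal_nonneg {g : FinConfig d → ℝ} (h0 : ∀ ξ, 0 ≤ g ξ) (ξ : FinConfig d) :
    0 ≤ rateSumReal p γ g ξ :=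
  Finset.sum_nonneg fun x _ => add_nonneg (jumpTerm_nonneg h0 ξ x) (branchTerm_nonneg h0 ξ x)

theorem rateSum_ofReal {g : FinConfig d → ℝ} (h0 : ∀ ξ, 0 ≤ g ξ) (hg : Controlled g)
    (ξ : FinConfig d) :
    rateSum p γ (fun ζ => ENNReal.ofReal (g ζ)) ξ = ENNReal.ofReal (rateSumReal p γ g ξ) := by
  rw [rateSum_eq_lintegral, rateSumReal, ENNReal.ofReal_sum_of_nonneg fun x _ =>
    add_nonneg (jumpTerm_nonneg h0 ξ x) (branchTerm_nonneg h0 ξ x)]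
  refine Finset.sum_congr rfl fun x hx => ?_
  rw [ENNReal.ofReal_add (jumpTerm_nonneg h0 ξ x) (branchTerm_nonneg h0 ξ x),
    ENNReal.ofReal_mul (Nat.cast_nonneg _), ENNReal.ofReal_natCast,
    ofReal_integral_eq_lintegral_ofReal (hg.integrable (Finsupp.mem_support_iff.1 hx))
      (Eventually.of_forall fun v => h0 _)]
  congr 1
  split_ifs
  · rw [ENNReal.ofReal_mul (by positivity), ENNReal.ofReal_add (h0 _) (h0 _),
      ENNReal.ofReal_div_of_pos two_pos, ENNReal.ofReal_coe_nnreal, ENNReal.ofReal_ofNat]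
  · rw [ENNReal.ofReal_zero]

theorem rateSumReal_le_totalRate {g : FinConfig d → ℝ} (h0 : ∀ ξ, 0 ≤ g ξ) (h1 : ∀ ξ, g ξ ≤ 1)
    (ξ : FinConfig d) : rateSumReal p γ g ξ ≤ totalRate γ ξ := by
  have hg : Controlled g := .of_bounded 1 fun ξ => (abs_of_nonneg (h0 ξ)).trans_le (h1 ξ)
  rw [← ENNReal.ofReal_le_ofReal_iff (NNReal.coe_nonneg _), ← rateSum_ofReal h0 hg,
    ENNReal.ofReal_coe_nnreal, ← rateSum_one (p := p)]
  exact rateSum_mono (fun ζ => ENNReal.ofReal_le_one.2 (h1 ζ)) ξ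

end RateSum

section TransitionProbability

variable {p : PMF (Site d)} {γ : ℝ≥0}

theorem measurable_transProbLT (A : Set (FinConfig d)) (n : ℕ) (ξ : FinConfig d) :
    Measurable fun t => transProbLT p γ A n t ξ := by
  induction n generalizing ξ with
  | zero => exact measurable_const
  | succ n ih =>
    simp only [transProbLT]
    refine Measurable.add (by fun_prop) ?_
    have hindicator : Measurable fun q : ℝ × ℝ => (Set.Icc 0 q.1).indicator (fun s =>
        ENNReal.ofReal (Real.exp (-(totalRate γ ξ * s))) *
          rateSum p γ (fun ξ' => transProbLT p γ A n (q.1 - s) ξ') ξ) q.2 := by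
      have hintegrand : Measurable fun q : ℝ × ℝ =>
          ENNReal.ofReal (Real.exp (-(totalRate γ ξ * q.2))) *
            rateSum p γ (fun ξ' => transProbLT p γ A n (q.1 - q.2) ξ') ξ :=
        Measurable.mul (by fun_prop) (measurable_rateSum
          (fun ζ => (ih ζ).comp (measurable_fst.sub measurable_snd)) ξ)
      have hregion : MeasurableSet {q : ℝ × ℝ | q.2 ∈ Set.Icc 0 q.1} :=
        (measurableSet_le measurable_const measurable_snd).inter
          (measurableSet_le measurable_snd measurable_fst)
      exact hintegrand.indicator hregion
    simpa only [lintegral_indicator measurableSet_Icc] using hindicator.lintegral_prod_right'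

theorem monotone_transProbLT (A : Set (FinConfig d)) :
    Monotone fun n => transProbLT p γ A n := by
  refine monotone_nat_of_le_succ fun n => ?_
  induction n with
  | zero => exact fun t ξ => zero_le
  | succ n ih =>
    intro t ξ
    rw [transProbLT, transProbLT]
    gcongr with s
    exact rateSum_mono (fun ζ => ih _ _) ξ

theorem lintegral_exp_mul_rate (q : ℝ≥0) {t : ℝ} (ht : 0 ≤ t) :
    ∫⁻ s in Set.Icc 0 t, ENNReal.ofReal (Real.exp (-(q * s))) * q =
      ENNReal.ofReal (1 - Real.exp (-(q * t))) := by
  simp_rw [← ENNReal.ofReal_coe_nnreal (p := q), ← ENNReal.ofReal_mul (Real.exp_nonneg _)]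
  rw [← ofReal_integral_eq_lintegral_ofReal
    (Continuous.integrableOn_Icc (by fun_prop)) (Eventually.of_forall fun s => by positivity),
    integral_Icc_eq_integral_Ioc, ← intervalIntegral.integral_of_le ht]
  have hderiv : ∀ s ∈ Set.uIcc 0 t, HasDerivAt (fun s : ℝ => -Real.exp (-(q * s)))
      (Real.exp (-(q * s)) * q) s := fun s _ => by
    simpa using (((hasDerivAt_id' s).const_mul (q : ℝ)).fun_neg.exp).fun_neg
  rw [intervalIntegral.integral_eq_sub_of_hasDerivAt hderiv
    (Continuous.intervalIntegrable (by fun_prop) _ _), mul_zero, neg_zero, Real.exp_zero,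
    sub_neg_eq_add, neg_add_eq_sub]

theorem transProbLT_le_one (A : Set (FinConfig d)) (n : ℕ) {t : ℝ} (ht : 0 ≤ t)
    (ξ : FinConfig d) : transProbLT p γ A n t ξ ≤ 1 := by
  induction n generalizing t ξ with
  | zero => simp only [transProbLT, zero_le]
  | succ n ih =>
    have htransition : ∫⁻ s in Set.Icc 0 t, ENNReal.ofReal (Real.exp (-(totalRate γ ξ * s))) *
        rateSum p γ (fun ξ' => transProbLT p γ A n (t - s) ξ') ξ ≤
        ENNReal.ofReal (1 - Real.exp (-(totalRate γ ξ * t))) := by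
      rw [← lintegral_exp_mul_rate _ ht]
      refine setLIntegral_mono' measurableSet_Icc fun s hs => ?_
      rw [← rateSum_one (p := p)]
      gcongr
      exact rateSum_mono (fun ζ => ih (sub_nonneg.2 hs.2) ζ) ξ
    have hindicator : A.indicator (1 : FinConfig d → ℝ≥0∞) ξ ≤ 1 :=
      Set.indicator_le_self' (fun _ _ => zero_le) ξ
    have hexp : Real.exp (-(totalRate γ ξ * t)) ≤ 1 :=
      Real.exp_le_one_iff.2 (neg_nonpos.2 (by positivity))
    calc transProbLT p γ A (n + 1) t ξ
        ≤ ENNReal.ofReal (Real.exp (-(totalRate γ ξ * t))) * 1 +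
          ENNReal.ofReal (1 - Real.exp (-(totalRate γ ξ * t))) := by rw [transProbLT]; gcongr
      _ = 1 := by
        rw [mul_one, ← ENNReal.ofReal_add (Real.exp_nonneg _) (sub_nonneg.2 hexp),
          add_sub_cancel, ENNReal.ofReal_one]

variable (p γ) in
/-- The probability that the finite system started at `ξ` is in `A` at time `t`, as a real
number; constant for negative times. -/
def prob (A : Set (FinConfig d)) (t : ℝ) (ξ : FinConfig d) : ℝ :=
  (⨆ n, transProbLT p γ A n (max t 0) ξ).toReal

theorem toReal_transProb (t : ℝ≥0) (ξ : FinConfig d) (A : Set (FinConfig d)) :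
    (transProb p γ t ξ A).toReal = prob p γ A t ξ := by
  rw [prob, transProb, max_eq_left t.coe_nonneg]

theorem iSup_transProbLT_le_one (A : Set (FinConfig d)) {t : ℝ} (ht : 0 ≤ t) (ξ : FinConfig d) :
    ⨆ n, transProbLT p γ A n t ξ ≤ 1 :=
  iSup_le fun n => transProbLT_le_one A n ht ξ

theorem prob_nonneg (A : Set (FinConfig d)) (t : ℝ) (ξ : FinConfig d) : 0 ≤ prob p γ A t ξ :=
  ENNReal.toReal_nonneg

theorem prob_le_one (A : Set (FinConfig d)) (t : ℝ) (ξ : FinConfig d) : prob p γ A t ξ ≤ 1 :=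
  ENNReal.toReal_le_of_le_ofReal zero_le_one
    ((iSup_transProbLT_le_one A (le_max_right _ _) ξ).trans (by simp))

theorem abs_prob_le_one (A : Set (FinConfig d)) (t : ℝ) (ξ : FinConfig d) :
    |prob p γ A t ξ| ≤ 1 := by
  rw [abs_of_nonneg (prob_nonneg A t ξ)]
  exact prob_le_one A t ξ

theorem controlled_prob (A : Set (FinConfig d)) (t : ℝ) : Controlled (prob p γ A t) :=
  Controlled.of_bounded 1 (abs_prob_le_one A t)

theorem ofReal_prob (A : Set (FinConfig d)) (t : ℝ) (ξ : FinConfig d) :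
    ENNReal.ofReal (prob p γ A t ξ) = ⨆ n, transProbLT p γ A n (max t 0) ξ :=
  ENNReal.ofReal_toReal
    ((iSup_transProbLT_le_one A (le_max_right _ _) ξ).trans_lt ENNReal.one_lt_top).ne

theorem measurable_prob (A : Set (FinConfig d)) (ξ : FinConfig d) :
    Measurable fun t => prob p γ A t ξ :=
  ((Measurable.iSup fun n => measurable_transProbLT A n ξ).comp
    (measurable_id.max measurable_const)).ennreal_toReal

theorem iSup_transProbLT_eq (A : Set (FinConfig d)) (t : ℝ) (ξ : FinConfig d) :
    ⨆ n, transProbLT p γ A n t ξ =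
      ENNReal.ofReal (Real.exp (-(totalRate γ ξ * t))) * A.indicator 1 ξ +
        ∫⁻ s in Set.Icc 0 t, ENNReal.ofReal (Real.exp (-(totalRate γ ξ * s))) *
          rateSum p γ (fun ξ' => ⨆ n, transProbLT p γ A n (t - s) ξ') ξ := by
  have hmono : ∀ s ξ, Monotone fun n => transProbLT p γ A n s ξ := fun s ξ m n h =>
    monotone_transProbLT A h s ξ
  rw [← (hmono t ξ).iSup_nat_add 1]
  simp_rw [transProbLT]
  rw [← ENNReal.add_iSup]
  congr 1
  rw [← lintegral_iSup]
  · refine lintegral_congr fun s => ?_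
    rw [← ENNReal.mul_iSup, ← rateSum_iSup fun m n h ζ => hmono _ ζ h]
  · intro n
    exact Measurable.mul (by fun_prop) (measurable_rateSum
      (fun ζ => (measurable_transProbLT A n ζ).comp (measurable_const.sub measurable_id)) ξ)
  · intro m n h s
    dsimp only
    gcongr
    exact rateSum_mono (fun ζ => hmono _ ζ h) ξ

theorem ofReal_rateSumReal_prob (A : Set (FinConfig d)) (t : ℝ) (ξ : FinConfig d) :
    ENNReal.ofReal (rateSumReal p γ (prob p γ A t) ξ) =
      rateSum p γ (fun ξ' => ⨆ n, transProbLT p γ A n (max t 0) ξ') ξ := by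
  simp_rw [← rateSum_ofReal (prob_nonneg A t) (controlled_prob A t), ofReal_prob]

theorem measurable_rateSumReal_prob (A : Set (FinConfig d)) (ξ : FinConfig d) :
    Measurable fun t => rateSumReal p γ (prob p γ A t) ξ := by
  have heq : (fun t => rateSumReal p γ (prob p γ A t) ξ) =
      fun t => (rateSum p γ (fun ξ' => ENNReal.ofReal (prob p γ A t ξ')) ξ).toReal := by
    ext t
    rw [rateSum_ofReal (prob_nonneg A t) (controlled_prob A t),
      ENNReal.toReal_ofReal (rateSumReal_nonneg (prob_nonneg A t) ξ)]
  rw [heq]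
  exact (measurable_rateSum (fun ζ => (measurable_prob A ζ).ennreal_ofReal) ξ).ennreal_toReal

theorem norm_rateSumReal_prob_le (A : Set (FinConfig d)) (t : ℝ) (ξ : FinConfig d) :
    ‖rateSumReal p γ (prob p γ A t) ξ‖ ≤ totalRate γ ξ :=
  (Real.norm_of_nonneg (rateSumReal_nonneg (prob_nonneg A t) ξ)).trans_le
    (rateSumReal_le_totalRate (prob_nonneg A t) (prob_le_one A t) ξ)

theorem prob_eq_add_setIntegral (A : Set (FinConfig d)) {t : ℝ} (ht : 0 ≤ t) (ξ : FinConfig d) :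
    prob p γ A t ξ = Real.exp (-(totalRate γ ξ * t)) * A.indicator 1 ξ +
      ∫ s in Set.Icc 0 t,
        Real.exp (-(totalRate γ ξ * s)) * rateSumReal p γ (prob p γ A (t - s)) ξ := by
  have hind : (0 : ℝ) ≤ A.indicator 1 ξ := Set.indicator_nonneg (fun _ _ => zero_le_one) _
  have hnonneg : ∀ s, 0 ≤
      Real.exp (-(totalRate γ ξ * s)) * rateSumReal p γ (prob p γ A (t - s)) ξ := fun s =>
    mul_nonneg (Real.exp_nonneg _) (rateSumReal_nonneg (prob_nonneg A _) ξ)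
  have hexp : IntegrableOn (fun s => Real.exp (-(totalRate γ ξ * s))) (Set.Icc 0 t) :=
    Continuous.integrableOn_Icc (by fun_prop)
  have hint : IntegrableOn (fun s =>
      Real.exp (-(totalRate γ ξ * s)) * rateSumReal p γ (prob p γ A (t - s)) ξ) (Set.Icc 0 t) :=
    Integrable.mul_bdd hexp
      ((measurable_rateSumReal_prob A ξ).comp (measurable_const.sub measurable_id)
        |>.aestronglyMeasurable)
      (Eventually.of_forall fun s => norm_rateSumReal_prob_le A (t - s) ξ)
  have hnonneg_add := add_nonneg
    (mul_nonneg (Real.exp_nonneg (-(totalRate γ ξ * t))) hind)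
    (integral_nonneg (μ := volume.restrict (Set.Icc 0 t)) hnonneg)
  rw [← ENNReal.ofReal_eq_ofReal_iff (prob_nonneg A t ξ) hnonneg_add, ofReal_prob,
    max_eq_left ht, iSup_transProbLT_eq,
    ENNReal.ofReal_add (mul_nonneg (Real.exp_nonneg _) hind) (integral_nonneg hnonneg),
    ENNReal.ofReal_mul (Real.exp_nonneg _),
    ofReal_integral_eq_lintegral_ofReal hint (Eventually.of_forall hnonneg)]
  congr 1
  · congr 1
    by_cases h : ξ ∈ A <;> simp [h]
  · refine setLIntegral_congr_fun measurableSet_Icc fun s hs => ?_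
    rw [ENNReal.ofReal_mul (Real.exp_nonneg _), ofReal_rateSumReal_prob,
      max_eq_left (sub_nonneg.2 hs.2)]

theorem prob_eq (A : Set (FinConfig d)) {t : ℝ} (ht : 0 ≤ t) (ξ : FinConfig d) :
    prob p γ A t ξ = Real.exp (-(totalRate γ ξ * t)) * (A.indicator 1 ξ +
      ∫ s in (0 : ℝ)..t,
        Real.exp (totalRate γ ξ * s) * rateSumReal p γ (prob p γ A s) ξ) := by
  have hreverse := intervalIntegral.integral_comp_sub_left (a := 0) (b := t) (fun s =>
    Real.exp (-(totalRate γ ξ * (t - s))) * rateSumReal p γ (prob p γ A s) ξ) t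
  simp only [sub_sub_cancel, sub_zero, sub_self] at hreverse
  rw [prob_eq_add_setIntegral A ht, integral_Icc_eq_integral_Ioc,
    ← intervalIntegral.integral_of_le ht, hreverse, mul_add,
    ← intervalIntegral.integral_const_mul]
  congr 1
  refine intervalIntegral.integral_congr fun s _ => ?_
  rw [← mul_assoc, ← Real.exp_add]
  congr 2
  ring

theorem prob_zero (A : Set (FinConfig d)) (ξ : FinConfig d) :
    prob p γ A 0 ξ = A.indicator 1 ξ := by
  rw [prob_eq A le_rfl, intervalIntegral.integral_same, mul_zero, neg_zero, Real.exp_zero, add_zero,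
    one_mul]

theorem continuous_prob (A : Set (FinConfig d)) (ξ : FinConfig d) :
    Continuous fun t => prob p γ A t ξ := by
  have hint : ∀ a b : ℝ, IntervalIntegrable (fun s =>
      Real.exp (totalRate γ ξ * s) * rateSumReal p γ (prob p γ A s) ξ) volume a b := fun a b => by
    have hexp : IntervalIntegrable (fun s => Real.exp (totalRate γ ξ * s)) volume a b :=
      Continuous.intervalIntegrable (by fun_prop) a b
    rw [intervalIntegrable_iff] at hexp ⊢
    exact Integrable.mul_bdd hexp
      (measurable_rateSumReal_prob A ξ).aestronglyMeasurable
      (Eventually.of_forall fun s => norm_rateSumReal_prob_le A s ξ)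
  have heq : (fun t => prob p γ A t ξ) = fun t => Real.exp (-(totalRate γ ξ * max t 0)) *
      (A.indicator 1 ξ + ∫ s in (0 : ℝ)..(max t 0),
        Real.exp (totalRate γ ξ * s) * rateSumReal p γ (prob p γ A s) ξ) := by
    ext t
    rw [← prob_eq A (le_max_right t 0), prob, prob, max_assoc, max_self]
  have hmax : Continuous fun t : ℝ => max t 0 := by fun_prop
  rw [heq]
  exact (by fun_prop : Continuous fun t : ℝ => Real.exp (-(totalRate γ ξ * max t 0))).mul
    (continuous_const.add ((intervalIntegral.continuous_primitive hint 0).comp hmax))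

theorem continuous_gen {α : Type*} [TopologicalSpace α] [FirstCountableTopology α]
    {g : α → FinConfig d → ℝ} (hg : ∀ ξ, Continuous fun a => g a ξ) {ψ : ℕ → ℝ}
    (hψ : ∀ a ξ, |g a ξ| ≤ ψ (Finsupp.degree ξ)) (ξ : FinConfig d) :
    Continuous fun a => gen p γ (g a) ξ := by
  refine continuous_finsetSum _ fun x hx => ?_
  have hx' := Finsupp.mem_support_iff.1 hx
  refine Continuous.add (continuous_const.mul (Continuous.sub ?_ (hg ξ))) ?_
  · refine continuous_of_dominated (bound := fun _ => ψ (Finsupp.degree ξ))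
      (fun a => (measurable_of_countable _).aestronglyMeasurable)
      (fun a => Eventually.of_forall fun v => ?_) (integrable_const _)
      (Eventually.of_forall fun v => hg _)
    exact (hψ a (jump ξ x v)).trans_eq (by rw [degree_jump hx'])
  · simp only [branchAt]
    split_ifs
    · exact continuous_const.mul (((hg _).add (hg _)).sub (continuous_const.mul (hg _)))
    · exact continuous_const

theorem continuous_gen_prob (A : Set (FinConfig d)) (ξ : FinConfig d) :
    Continuous fun t => gen p γ (prob p γ A t) ξ :=
  continuous_gen (ψ := fun _ => 1) (continuous_prob A) (abs_prob_le_one A) ξ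

theorem hasDerivWithinAt_prob (A : Set (FinConfig d)) (ξ : FinConfig d) {t : ℝ} (ht : 0 ≤ t) :
    HasDerivWithinAt (fun t => prob p γ A t ξ) (gen p γ (prob p γ A t) ξ) (Set.Ici t) t := by
  set q := (totalRate γ ξ : ℝ) with hq
  have hcont : Continuous fun s => Real.exp (q * s) * rateSumReal p γ (prob p γ A s) ξ := by
    simp only [rateSumReal_eq_gen_add]
    exact (by fun_prop : Continuous fun s : ℝ => Real.exp (q * s)).mul
      ((continuous_gen_prob A ξ).add (continuous_const.mul (continuous_prob A ξ)))
  have hintegral := (hcont.integral_hasStrictDerivAt 0 t).hasDerivAt.const_add (A.indicator 1 ξ)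
  have hexp : HasDerivAt (fun t => Real.exp (-(q * t))) (Real.exp (-(q * t)) * -q) t := by
    simpa using ((hasDerivAt_id' t).const_mul q).fun_neg.exp
  have hprod := (hexp.mul hintegral).hasDerivWithinAt (s := Set.Ici t)
  refine (hprod.congr (fun s hs => prob_eq A (ht.trans hs) ξ) (prob_eq A ht ξ)).congr_deriv ?_
  have hprob := prob_eq (p := p) (γ := γ) A ht ξ
  rw [← hq] at hprob
  have hexp_mul : Real.exp (-(q * t)) * Real.exp (q * t) = 1 := by
    rw [← Real.exp_add, neg_add_cancel, Real.exp_zero]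
  calc _ = -q * (Real.exp (-(q * t)) * (A.indicator 1 ξ + ∫ s in (0 : ℝ)..t,
          Real.exp (q * s) * rateSumReal p γ (prob p γ A s) ξ)) +
        (Real.exp (-(q * t)) * Real.exp (q * t)) * rateSumReal p γ (prob p γ A t) ξ := by ring
    _ = gen p γ (prob p γ A t) ξ := by
        rw [← hprob, hexp_mul, rateSumReal_eq_gen_add]
        ring

theorem le_prob_of_le_gen {A : Set (FinConfig d)} {u u' : ℝ → FinConfig d → ℝ} {C : ℝ}
    (hC : ∀ t, 0 ≤ t → ∀ ξ, u t ξ ≤ C) (hcontr : ∀ t, 0 ≤ t → Controlled (u t))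
    (hcont : ∀ ξ, Continuous fun t => u t ξ)
    (hder : ∀ ξ, ∀ t, 0 ≤ t → HasDerivWithinAt (fun t => u t ξ) (u' t ξ) (Set.Ici t) t)
    (h0 : ∀ ξ, u 0 ξ ≤ A.indicator 1 ξ)
    (hgen : ∀ ξ, ∀ t, 0 ≤ t → u' t ξ ≤ gen p γ (u t) ξ) {t : ℝ} (ht : 0 ≤ t)
    (ξ : FinConfig d) : u t ξ ≤ prob p γ A t ξ := by
  refine sub_nonpos.1 (nonpos_of_le_gen (p := p) (γ := γ) (C := C)
    (u := fun t ξ => u t ξ - prob p γ A t ξ)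
    (u' := fun t ξ => u' t ξ - gen p γ (prob p γ A t) ξ)
    (fun s hs ζ => by linarith [hC s hs.1 ζ, prob_nonneg (p := p) (γ := γ) A s ζ])
    (fun s hs => (hcontr s hs.1).sub (controlled_prob A s))
    (fun ζ => ((hcont ζ).sub (continuous_prob A ζ)).continuousOn)
    (fun ζ s hs => (hder ζ s hs.1).sub (hasDerivWithinAt_prob A ζ hs.1))
    (fun ζ => sub_nonpos.2 ((h0 ζ).trans_eq (prob_zero A ζ).symm)) ?_ t ⟨ht, le_rfl⟩ ξ)
  intro ζ s hs
  rw [gen_sub (hcontr s hs.1) (controlled_prob A s)]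
  exact sub_le_sub_right (hgen ζ s hs.1) _

/- Both sides solve the backward equation with the same initial value; as `prob` is built from the
minimal transition function, this is the statement that the finite systems do not explode. -/
theorem one_sub_prob_le_prob_compl (A : Set (FinConfig d)) {t : ℝ} (ht : 0 ≤ t)
    (ξ : FinConfig d) : 1 - prob p γ A t ξ ≤ prob p γ Aᶜ t ξ := by
  refine le_prob_of_le_gen (u := fun t ξ => 1 - prob p γ A t ξ)
    (u' := fun t ξ => -gen p γ (prob p γ A t) ξ) (C := 1)
    (fun t _ ξ => sub_le_self _ (prob_nonneg A t ξ))
    (fun t _ => (Controlled.const 1).sub (controlled_prob A t))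
    (fun ξ => continuous_const.sub (continuous_prob A ξ))
    (fun ξ t ht => (hasDerivWithinAt_prob A ξ ht).const_sub 1) (fun ξ => ?_) (fun ξ t _ => ?_) ht ξ
  · rw [prob_zero]
    by_cases h : ξ ∈ A <;> simp [h]
  · rw [gen_sub (Controlled.const 1) (controlled_prob A t), gen_const, zero_sub]

end TransitionProbability

/-! ### Submodularity of the transition probabilities -/

/-- The mixed difference `g (h + a) + g (h + b) - g (h + a + b) - g h`; a function is submodular if
it is nonnegative for all `h`, `a`, `b`. -/
def mixedDiff (g : FinConfig d → ℝ) (h a b : FinConfig d) : ℝ :=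
  g (h + a) + g (h + b) - g (h + a + b) - g h

/-- The weight of a triple of configurations by which violations of submodularity are measured in
the maximum principle: along the dynamics it grows at most exponentially. -/
def tripleWeight (h a b : FinConfig d) : ℝ :=
  (1 + (size h + size a + size b)) * (1 + size a * size b)

/-- Submodularity up to the error `m + e * tripleWeight`. -/
def AlmostSubmodular (g : FinConfig d → ℝ) (m e : ℝ) : Prop :=
  ∀ h a b, -mixedDiff g h a b ≤ m + e * tripleWeight h a b

/-- The second difference of `g` in the number of particles at `w`. -/
def secondDiff (g : FinConfig d → ℝ) (w : Site d) (ξ : FinConfig d) : ℝ :=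
  g (ξ + Finsupp.single w 1 + Finsupp.single w 1) + g ξ - 2 * g (ξ + Finsupp.single w 1)

section MixedDiff

variable {g : FinConfig d → ℝ} {m e : ℝ} {h a b : FinConfig d} {w : Site d}

theorem mixedDiff_comm (g : FinConfig d → ℝ) (h a b : FinConfig d) :
    mixedDiff g h a b = mixedDiff g h b a := by
  rw [mixedDiff, mixedDiff, add_right_comm h a b]
  ring

theorem mixedDiff_single_single (g : FinConfig d → ℝ) (ξ : FinConfig d) (w : Site d) :
    mixedDiff g ξ (Finsupp.single w 1) (Finsupp.single w 1) = -secondDiff g w ξ := by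
  rw [mixedDiff, secondDiff]
  ring

theorem tripleWeight_comm (h a b : FinConfig d) : tripleWeight h a b = tripleWeight h b a := by
  rw [tripleWeight, tripleWeight]
  ring

theorem one_add_size_le_tripleWeight (h a b : FinConfig d) :
    1 + (size h + size a + size b) ≤ tripleWeight h a b := by
  have hh := size_nonneg h
  have hab := mul_nonneg (size_nonneg a) (size_nonneg b)
  exact le_mul_of_one_le_right (by linarith [size_nonneg a, size_nonneg b]) (by linarith)

theorem tripleWeight_pos (h a b : FinConfig d) : 0 < tripleWeight h a b := by
  linarith [one_add_size_le_tripleWeight h a b, size_nonneg h, size_nonneg a, size_nonneg b]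

theorem branchAt_of_eq_add_single {ξ ζ : FinConfig d} (h : ξ = ζ + Finsupp.single w 1) :
    branchAt g ξ w = if ζ w = 0 then secondDiff g w ζ else 0 := by
  subst h
  simp only [branchAt, secondDiff, add_tsub_cancel_right, Finsupp.add_apply,
    Finsupp.single_eq_same, Nat.add_eq_right]

theorem exists_eq_add_single {ξ : FinConfig d} (h : ξ w ≠ 0) :
    ∃ ζ, ξ = ζ + Finsupp.single w 1 := ⟨_, (sub_single_add_single h).symm⟩

theorem AlmostSubmodular.secondDiff_le (hg : AlmostSubmodular g m e) (ξ : FinConfig d)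
    (w : Site d) : secondDiff g w ξ ≤ m + e * (2 * (3 + size ξ)) := by
  have hle := hg ξ (Finsupp.single w 1) (Finsupp.single w 1)
  rw [mixedDiff_single_single, neg_neg, tripleWeight, size_single, Nat.cast_one] at hle
  linarith

/-- In the branching terms a second difference of `g` is written as
`D₁ + D₂ - 2 * mixedDiff g h a b` with mixed differences `D₁`, `D₂` of other triples. -/
theorem AlmostSubmodular.neg_add_sub_le (hg : AlmostSubmodular g m e)
    (hneg : e * tripleWeight h a b ≤ -mixedDiff g h a b) (h₁ a₁ b₁ h₂ a₂ b₂ : FinConfig d) :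
    -(mixedDiff g h₁ a₁ b₁ + mixedDiff g h₂ a₂ b₂ - 2 * mixedDiff g h a b) ≤
      2 * m + e * (tripleWeight h₁ a₁ b₁ + tripleWeight h₂ a₂ b₂ - 2 * tripleWeight h a b) := by
  linarith [hg h₁ a₁ b₁, hg h₂ a₂ b₂]

end MixedDiff

section Branching

variable {g : FinConfig d → ℝ} {m e : ℝ} {h a b : FinConfig d} {w : Site d}

theorem neg_mixedDiff_branchAt_le_of_left (hg : AlmostSubmodular g m e) (hm : 0 ≤ m)
    (he : 0 ≤ e) (hneg : e * tripleWeight h a b ≤ -mixedDiff g h a b) (hh : h w = 0)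
    (hb : b w = 0) :
    -mixedDiff (branchAt g · w) h a b ≤ 2 * m + e * (2 * size b * a w) := by
  have hpen : 0 ≤ e * (2 * size b * a w) := by have := size_nonneg b; positivity
  have hbranch_h : branchAt g h w = 0 := branchAt_of_apply_ne_one (by omega)
  have hbranch_hb : branchAt g (h + b) w = 0 :=
    branchAt_of_apply_ne_one (by rw [Finsupp.add_apply]; omega)
  by_cases ha : a w = 1
  · obtain ⟨a, rfl⟩ := exists_eq_add_single (by omega : a w ≠ 0)
    set δ := Finsupp.single w 1 with hδ
    have haw : a w = 0 := by simpa [hδ] using ha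
    have hsecond : mixedDiff (branchAt g · w) h (a + δ) b = mixedDiff g h (a + δ + δ) b +
        mixedDiff g h a b - 2 * mixedDiff g h (a + δ) b := by
      rw [mixedDiff, hbranch_h, hbranch_hb, branchAt_of_eq_add_single (ζ := h + a) (by abel),
        branchAt_of_eq_add_single (ζ := h + a + b) (by abel),
        if_pos (by simp only [Finsupp.add_apply, hh, haw]),
        if_pos (by simp only [Finsupp.add_apply, hh, haw, hb])]
      simp only [mixedDiff, secondDiff, ← hδ,
        ← @add_assoc (FinConfig d), @add_right_comm (FinConfig d)]
      ring
    rw [hsecond, ha, Nat.cast_one]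
    refine (hg.neg_add_sub_le hneg ..).trans_eq ?_
    simp only [tripleWeight, size_add, hδ, size_single, Nat.cast_one]
    ring
  · rw [mixedDiff, hbranch_h, hbranch_hb, branchAt_of_apply_ne_one (ξ := h + a),
      branchAt_of_apply_ne_one (ξ := h + a + b)]
    · linarith
    all_goals simpa only [Finsupp.add_apply, hh, hb, zero_add, add_zero] using ha

/-- Two branching events turn `(a + δ, b + δ)` into `(a + 2δ, b)` and `(a, b + 2δ)`. -/
theorem neg_mixedDiff_branchAt_le_of_left_right (hg : AlmostSubmodular g m e) (hm : 0 ≤ m)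
    (he : 0 ≤ e) (hneg : e * tripleWeight h a b ≤ -mixedDiff g h a b) (hh : h w = 0)
    (ha : a w ≠ 0) (hb : b w ≠ 0) :
    -mixedDiff (branchAt g · w) h a b ≤
      3 * m + e * (2 * (1 + (size h + size a + size b))) := by
  obtain ⟨a, rfl⟩ := exists_eq_add_single ha
  obtain ⟨b, rfl⟩ := exists_eq_add_single hb
  set δ := Finsupp.single w 1 with hδ
  have hbranch_ha : branchAt g (h + (a + δ)) w = if (h + a) w = 0 then secondDiff g w (h + a)
      else 0 := branchAt_of_eq_add_single (by abel)
  have hbranch_hb : branchAt g (h + (b + δ)) w = if (h + b) w = 0 then secondDiff g w (h + b)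
      else 0 := branchAt_of_eq_add_single (by abel)
  have hzero : mixedDiff (branchAt g · w) h (a + δ) (b + δ) =
      branchAt g (h + (a + δ)) w + branchAt g (h + (b + δ)) w := by
    rw [mixedDiff, branchAt_of_apply_ne_one (ξ := h) (by omega),
      branchAt_of_apply_ne_one (ξ := h + (a + δ) + (b + δ)), sub_zero, sub_zero]
    simp only [hδ, Finsupp.add_apply, Finsupp.single_eq_same]
    omega
  have hsecond : secondDiff g w (h + a) + secondDiff g w (h + b) =
      mixedDiff g h (a + δ + δ) b + mixedDiff g h a (b + δ + δ) -
        2 * mixedDiff g h (a + δ) (b + δ) := by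
    simp only [mixedDiff, secondDiff, ← hδ,
      ← @add_assoc (FinConfig d), @add_right_comm (FinConfig d)]
    ring
  have htransfer := hg.neg_add_sub_le hneg h (a + δ + δ) b h a (b + δ + δ)
  have hle_ha := hg.secondDiff_le (h + a) w
  have hle_hb := hg.secondDiff_le (h + b) w
  have hsize_h := mul_nonneg he (size_nonneg h)
  have hsize_a := mul_nonneg he (size_nonneg a)
  have hsize_b := mul_nonneg he (size_nonneg b)
  simp only [tripleWeight, size_add, hδ, size_single, Nat.cast_one] at *
  rw [hzero, hbranch_ha, hbranch_hb]
  split_ifs <;> linarith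

theorem neg_mixedDiff_branchAt_le_of_base (hg : AlmostSubmodular g m e) (hm : 0 ≤ m)
    (hneg : e * tripleWeight h a b ≤ -mixedDiff g h a b) (hh : h w ≠ 0) (ha : a w = 0)
    (hb : b w = 0) : -mixedDiff (branchAt g · w) h a b ≤ 2 * m := by
  obtain ⟨h, rfl⟩ := exists_eq_add_single hh
  set δ := Finsupp.single w 1 with hδ
  rw [mixedDiff, branchAt_of_eq_add_single (ζ := h) rfl,
    branchAt_of_eq_add_single (ζ := h + a) (by abel),
    branchAt_of_eq_add_single (ζ := h + b) (by abel),
    branchAt_of_eq_add_single (ζ := h + a + b) (by abel)]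
  simp only [Finsupp.add_apply, ha, hb, add_zero]
  by_cases hw : h w = 0
  · have hsecond : secondDiff g w (h + a) + secondDiff g w (h + b) - secondDiff g w (h + a + b) -
        secondDiff g w h = mixedDiff g (h + δ + δ) a b + mixedDiff g h a b -
          2 * mixedDiff g (h + δ) a b := by
      simp only [mixedDiff, secondDiff, ← hδ, @add_right_comm (FinConfig d)]
      ring
    simp only [if_pos hw, hsecond]
    refine (hg.neg_add_sub_le hneg ..).trans_eq ?_
    simp only [tripleWeight, size_add, hδ, size_single, Nat.cast_one]
    ring
  · simp only [if_neg hw]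
    linarith

theorem neg_mixedDiff_branchAt_le_of_base_right (hg : AlmostSubmodular g m e) (hm : 0 ≤ m)
    (hneg : e * tripleWeight h a b ≤ -mixedDiff g h a b) (hh : h w ≠ 0) (ha : a w = 0)
    (hb : b w ≠ 0) : -mixedDiff (branchAt g · w) h a b ≤ 2 * m := by
  obtain ⟨h, rfl⟩ := exists_eq_add_single hh
  obtain ⟨b, rfl⟩ := exists_eq_add_single hb
  set δ := Finsupp.single w 1 with hδ
  have hbranch : mixedDiff (branchAt g · w) (h + δ) a (b + δ) =
      branchAt g (h + δ + a) w - branchAt g (h + δ) w := by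
    rw [mixedDiff, branchAt_of_apply_ne_one (ξ := h + δ + (b + δ)),
      branchAt_of_apply_ne_one (ξ := h + δ + a + (b + δ)), add_zero, sub_zero]
    all_goals
      simp only [hδ, Finsupp.add_apply, Finsupp.single_eq_same]
      omega
  rw [hbranch, branchAt_of_eq_add_single (ζ := h) rfl,
    branchAt_of_eq_add_single (ζ := h + a) (by abel)]
  simp only [Finsupp.add_apply, ha, add_zero]
  by_cases hw : h w = 0
  · have hsecond : secondDiff g w (h + a) - secondDiff g w h = mixedDiff g (h + δ + δ) a b +
        mixedDiff g h a (b + δ + δ) - 2 * mixedDiff g (h + δ) a (b + δ) := by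
      simp only [mixedDiff, secondDiff, ← hδ,
        ← @add_assoc (FinConfig d), @add_right_comm (FinConfig d)]
      ring
    simp only [if_pos hw, hsecond]
    refine (hg.neg_add_sub_le hneg ..).trans_eq ?_
    simp only [tripleWeight, size_add, hδ, size_single, Nat.cast_one]
    ring
  · simp only [if_neg hw]
    linarith

theorem neg_mixedDiff_branchAt_le_of_all (hg : AlmostSubmodular g m e) (hm : 0 ≤ m)
    (he : 0 ≤ e) (hh : h w ≠ 0) (ha : a w ≠ 0) (hb : b w ≠ 0) :
    -mixedDiff (branchAt g · w) h a b ≤ m + e * (2 * (1 + (size h + size a + size b))) := by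
  obtain ⟨h, rfl⟩ := exists_eq_add_single hh
  obtain ⟨a, rfl⟩ := exists_eq_add_single ha
  set δ := Finsupp.single w 1 with hδ
  rw [mixedDiff, branchAt_of_apply_ne_one (ξ := h + δ + (a + δ)),
    branchAt_of_apply_ne_one (ξ := h + δ + b), branchAt_of_apply_ne_one (ξ := h + δ + (a + δ) + b),
    branchAt_of_eq_add_single (ζ := h) rfl]
  · have hle := hg.secondDiff_le h w
    have hsize_h := mul_nonneg he (size_nonneg h)
    have hsize_a := mul_nonneg he (size_nonneg a)
    have hsize_b := mul_nonneg he (size_nonneg b)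
    simp only [size_add, hδ, size_single, Nat.cast_one]
    split_ifs <;> linarith
  all_goals
    simp only [hδ, Finsupp.add_apply, Finsupp.single_eq_same]
    omega

theorem neg_mixedDiff_branchAt_le (hg : AlmostSubmodular g m e) (hm : 0 ≤ m) (he : 0 ≤ e)
    (hneg : e * tripleWeight h a b ≤ -mixedDiff g h a b) (w : Site d) :
    -mixedDiff (branchAt g · w) h a b ≤
      3 * m + e * (2 * size b * a w + 2 * size a * b w +
        2 * (1 + (size h + size a + size b)) * (a w * b w)) := by
  have hsize_h := size_nonneg h
  have hsize_a := size_nonneg a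
  have hsize_b := size_nonneg b
  have hneg' : e * tripleWeight h b a ≤ -mixedDiff g h b a := by
    rwa [tripleWeight_comm, mixedDiff_comm]
  have hpen_nonneg : 0 ≤ e * (2 * size b * a w + 2 * size a * b w +
      2 * (1 + (size h + size a + size b)) * (a w * b w)) := by positivity
  have hpen (ha : a w ≠ 0) (hb : b w ≠ 0) : e * (2 * (1 + (size h + size a + size b))) ≤
      e * (2 * size b * a w + 2 * size a * b w +
        2 * (1 + (size h + size a + size b)) * (a w * b w)) := by
    have hab : (1 : ℝ) ≤ a w * b w := by
      exact_mod_cast Nat.one_le_iff_ne_zero.2 (mul_ne_zero ha hb)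
    gcongr
    exact (le_mul_of_one_le_right (by positivity) hab).trans
      (le_add_of_nonneg_left (by positivity))
  by_cases hh : h w = 0 <;> by_cases ha : a w = 0 <;> by_cases hb : b w = 0
  · have hle := neg_mixedDiff_branchAt_le_of_left hg hm he hneg hh hb
    simp only [ha, hb, Nat.cast_zero] at hle ⊢
    linarith
  · have hle := neg_mixedDiff_branchAt_le_of_left hg hm he hneg' hh ha
    rw [mixedDiff_comm]
    simp only [ha, Nat.cast_zero] at hle ⊢
    linarith
  · have hle := neg_mixedDiff_branchAt_le_of_left hg hm he hneg hh hb
    simp only [hb, Nat.cast_zero] at hle ⊢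
    linarith
  · linarith [neg_mixedDiff_branchAt_le_of_left_right hg hm he hneg hh ha hb, hpen ha hb]
  · linarith [neg_mixedDiff_branchAt_le_of_base hg hm hneg hh ha hb]
  · linarith [neg_mixedDiff_branchAt_le_of_base_right hg hm hneg hh ha hb]
  · rw [mixedDiff_comm]
    linarith [neg_mixedDiff_branchAt_le_of_base_right hg hm hneg' hh hb ha]
  · linarith [neg_mixedDiff_branchAt_le_of_all hg hm he hh ha hb, hpen ha hb]

end Branching

section Jumps

variable {p : PMF (Site d)} {g : FinConfig d → ℝ} {m e : ℝ} {h a b : FinConfig d} {w : Site d}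

theorem jump_add_left {ξ : FinConfig d} (h : ξ w ≠ 0) (ζ : FinConfig d) (v : Site d) :
    jump (ξ + ζ) w v = jump ξ w v + ζ := by
  obtain ⟨ξ, rfl⟩ := exists_eq_add_single h
  rw [jump, jump, add_tsub_cancel_right, add_right_comm ξ _ ζ, add_tsub_cancel_right,
    add_right_comm]

theorem jump_add_right {ξ : FinConfig d} (h : ξ w ≠ 0) (ζ : FinConfig d) (v : Site d) :
    jump (ζ + ξ) w v = ζ + jump ξ w v := by
  rw [add_comm, jump_add_left h, add_comm]

theorem neg_integral_add_sub_sub_le {f₁ f₂ f₃ f₄ : Site d → ℝ} {c : ℝ}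
    (h₁ : Integrable f₁ p.toMeasure) (h₂ : Integrable f₂ p.toMeasure)
    (h₃ : Integrable f₃ p.toMeasure) (h₄ : Integrable f₄ p.toMeasure)
    (h : ∀ v, -(f₁ v + f₂ v - f₃ v - f₄ v) ≤ c) :
    -(∫ v, f₁ v ∂p.toMeasure + ∫ v, f₂ v ∂p.toMeasure - ∫ v, f₃ v ∂p.toMeasure -
      ∫ v, f₄ v ∂p.toMeasure) ≤ c := by
  have h₁₂ : Integrable (fun v => f₁ v + f₂ v) p.toMeasure := h₁.add h₂
  have h₁₂₃ : Integrable (fun v => f₁ v + f₂ v - f₃ v) p.toMeasure := h₁₂.sub h₃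
  have hneg : Integrable (fun v => -(f₁ v + f₂ v - f₃ v - f₄ v)) p.toMeasure := (h₁₂₃.sub h₄).neg
  rw [← integral_add h₁ h₂, ← integral_sub h₁₂ h₃, ← integral_sub h₁₂₃ h₄, ← integral_neg]
  simpa using integral_mono hneg (integrable_const c) h

theorem AlmostSubmodular.neg_mixedDiff_integral_jump_base_le (hg : AlmostSubmodular g m e)
    (hcontr : Controlled g) (hw : h w ≠ 0) :
    -mixedDiff (fun ξ => ∫ v, g (jump ξ w v) ∂p.toMeasure) h a b ≤
      m + e * tripleWeight h a b := by
  have hadd (ζ : FinConfig d) : (h + ζ) w ≠ 0 := by rw [Finsupp.add_apply]; omega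
  refine neg_integral_add_sub_sub_le (hcontr.integrable (hadd a)) (hcontr.integrable (hadd b))
    (hcontr.integrable (by rw [add_assoc]; exact hadd _)) (hcontr.integrable hw) fun v => ?_
  have hle := hg (jump h w v) a b
  rw [tripleWeight, size_jump hw, ← tripleWeight] at hle
  simpa only [mixedDiff, add_assoc, jump_add_left hw] using hle

theorem AlmostSubmodular.neg_integral_jump_left_le (hg : AlmostSubmodular g m e)
    (hcontr : Controlled g) (hw : a w ≠ 0) :
    -(∫ v, g (jump (h + a) w v) ∂p.toMeasure + g (h + b) -
      ∫ v, g (jump (h + a + b) w v) ∂p.toMeasure - g h) ≤ m + e * tripleWeight h a b := by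
  have hadd : (h + a) w ≠ 0 := by rw [Finsupp.add_apply]; omega
  have hadd_add : (h + a + b) w ≠ 0 := by rw [Finsupp.add_apply]; omega
  have hle := neg_integral_add_sub_sub_le (c := m + e * tripleWeight h a b)
    (hcontr.integrable (p := p) hadd) (integrable_const (g (h + b))) (hcontr.integrable hadd_add)
    (integrable_const (g h)) fun v => by
      have hle := hg h (jump a w v) b
      rw [tripleWeight, size_jump hw, ← tripleWeight] at hle
      simpa only [mixedDiff, jump_add_left hadd, jump_add_right hw] using hle
  simpa only [integral_const, probReal_univ, one_smul] using hle

theorem neg_mixedDiff_jumpAt_le (hg : AlmostSubmodular g m e) (hcontr : Controlled g)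
    (hneg : e * tripleWeight h a b ≤ -mixedDiff g h a b) (w : Site d) :
    -mixedDiff (jumpAt p g · w) h a b ≤ (h + a + b) w * m := by
  set J : FinConfig d → ℝ := fun ξ => ∫ v, g (jump ξ w v) ∂p.toMeasure with hJ
  have hbase : (h w : ℝ) * (mixedDiff g h a b - mixedDiff J h a b) ≤ h w * m := by
    by_cases hw : h w = 0
    · rw [hw, Nat.cast_zero, zero_mul, zero_mul]
    gcongr
    linarith [hg.neg_mixedDiff_integral_jump_base_le (p := p) (a := a) (b := b) hcontr hw]
  have hleft : (a w : ℝ) * (g (h + a) - g (h + a + b) - (J (h + a) - J (h + a + b))) ≤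
      a w * m := by
    by_cases hw : a w = 0
    · rw [hw, Nat.cast_zero, zero_mul, zero_mul]
    gcongr
    rw [mixedDiff] at hneg
    linarith [hg.neg_integral_jump_left_le (p := p) (h := h) (b := b) hcontr hw]
  have hright : (b w : ℝ) * (g (h + b) - g (h + a + b) - (J (h + b) - J (h + a + b))) ≤
      b w * m := by
    by_cases hw : b w = 0
    · rw [hw, Nat.cast_zero, zero_mul, zero_mul]
    gcongr
    have hle := hg.neg_integral_jump_left_le (p := p) (h := h) (b := a) hcontr hw
    rw [add_right_comm, tripleWeight_comm] at hle
    rw [mixedDiff] at hneg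
    linarith
  simp only [mixedDiff, jumpAt, Finsupp.add_apply, Nat.cast_add] at *
  linarith

end Jumps

section Generator

variable {p : PMF (Site d)} {γ : ℝ≥0} {g : FinConfig d → ℝ} {m e : ℝ} {h a b : FinConfig d}

theorem mixedDiff_gen (g : FinConfig d → ℝ) (h a b : FinConfig d) :
    mixedDiff (gen p γ g) h a b = ∑ w ∈ (h + a + b).support,
      (mixedDiff (jumpAt p g · w) h a b + γ / 2 * mixedDiff (branchAt g · w) h a b) := by
  have hha : h + a ≤ h + a + b := le_self_add
  have hhb : h + b ≤ h + a + b := by rw [add_right_comm]; exact le_self_add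
  rw [mixedDiff, gen_eq_sum g (Finsupp.support_mono hha), gen_eq_sum g (Finsupp.support_mono hhb),
    gen_eq_sum g (Finset.Subset.refl (h + a + b).support),
    gen_eq_sum g (Finsupp.support_mono (le_self_add.trans hha)), ← Finset.sum_add_distrib,
    ← Finset.sum_sub_distrib, ← Finset.sum_sub_distrib]
  refine Finset.sum_congr rfl fun w _ => ?_
  simp only [mixedDiff]
  ring

theorem sum_apply_eq_size {ξ : FinConfig d} {s : Finset (Site d)} (hs : ξ.support ⊆ s) :
    ∑ w ∈ s, (ξ w : ℝ) = size ξ := by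
  rw [← sum_eq_size]
  refine (Finset.sum_subset hs fun w _ hw => ?_).symm
  rw [Finsupp.notMem_support_iff.1 hw, Nat.cast_zero]

theorem apply_le_size (ξ : FinConfig d) (w : Site d) : (ξ w : ℝ) ≤ size ξ := by
  rw [size, Nat.cast_le]
  exact Finsupp.le_degree w ξ

theorem size_terms_le_tripleWeight (h a b : FinConfig d) :
    2 * size b * size a + 2 * size a * size b +
      2 * (1 + (size h + size a + size b)) * size a * size b ≤ 6 * tripleWeight h a b := by
  have hsize := size_nonneg h
  have hab := mul_nonneg (size_nonneg a) (size_nonneg b)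
  rw [tripleWeight]
  nlinarith [mul_nonneg hsize hab, mul_nonneg (size_nonneg a) hab, mul_nonneg (size_nonneg b) hab,
    size_nonneg a, size_nonneg b]

theorem neg_mixedDiff_gen_le (hg : AlmostSubmodular g m e) (hcontr : Controlled g) (hm : 0 ≤ m)
    (he : 0 ≤ e) (hneg : e * tripleWeight h a b ≤ -mixedDiff g h a b) :
    -mixedDiff (gen p γ g) h a b ≤
      (1 + 3 * γ / 2) * size (h + a + b) * m + e * (3 * γ * tripleWeight h a b) := by
  have hsize_h := size_nonneg h
  have hsize_a := size_nonneg a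
  have hsize_b := size_nonneg b
  have hterm : ∀ w, -(mixedDiff (jumpAt p g · w) h a b +
      γ / 2 * mixedDiff (branchAt g · w) h a b) ≤
      (h + a + b) w * m + (γ / 2 * (3 * m) + γ / 2 * e * (2 * size b * a w +
        (2 * size a * b w + 2 * (1 + (size h + size a + size b)) * size a * b w))) := by
    intro w
    have hjump := neg_mixedDiff_jumpAt_le (p := p) hg hcontr hneg w
    have hbranch := mul_le_mul_of_nonneg_left (neg_mixedDiff_branchAt_le hg hm he hneg w)
      (by positivity : (0 : ℝ) ≤ γ / 2)
    have happly : γ / 2 * e * (2 * (1 + (size h + size a + size b)) * (a w * b w)) ≤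
        γ / 2 * e * (2 * (1 + (size h + size a + size b)) * (size a * b w)) := by
      gcongr
      exact apply_le_size a w
    linarith
  have hcard : ((h + a + b).support.card : ℝ) * (γ / 2 * (3 * m)) ≤
      size (h + a + b) * (γ / 2 * (3 * m)) := by
    gcongr
    exact card_support_le_size _
  have hweight := mul_le_mul_of_nonneg_left (size_terms_le_tripleWeight h a b)
    (by positivity : 0 ≤ γ / 2 * e)
  rw [mixedDiff_gen, ← Finset.sum_neg_distrib]
  refine (Finset.sum_le_sum fun w _ => hterm w).trans ?_
  simp only [Finset.sum_add_distrib, ← Finset.sum_mul, ← Finset.mul_sum, Finset.sum_const,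
    nsmul_eq_mul]
  rw [sum_apply_eq_size subset_rfl, sum_apply_eq_size (Finsupp.support_mono
      (le_add_self.trans le_self_add)), sum_apply_eq_size (Finsupp.support_mono le_add_self)]
  linarith

end Generator

section Submodularity

variable {p : PMF (Site d)} {γ : ℝ≥0}

theorem neg_mixedDiff_prob_le_two (A : Set (FinConfig d)) (t : ℝ) (h a b : FinConfig d) :
    -mixedDiff (prob p γ A t) h a b ≤ 2 := by
  rw [mixedDiff]
  linarith [prob_nonneg (p := p) (γ := γ) A t (h + a), prob_nonneg (p := p) (γ := γ) A t (h + b),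
    prob_le_one (p := p) (γ := γ) A t (h + a + b), prob_le_one (p := p) (γ := γ) A t h]

theorem continuous_mixedDiff_prob (A : Set (FinConfig d)) (h a b : FinConfig d) :
    Continuous fun t => mixedDiff (prob p γ A t) h a b :=
  (((continuous_prob A _).add (continuous_prob A _)).sub (continuous_prob A _)).sub
    (continuous_prob A _)

theorem hasDerivWithinAt_mixedDiff_prob (A : Set (FinConfig d)) (h a b : FinConfig d) {t : ℝ}
    (ht : 0 ≤ t) : HasDerivWithinAt (fun t => mixedDiff (prob p γ A t) h a b)
      (mixedDiff (gen p γ (prob p γ A t)) h a b) (Set.Ici t) t :=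
  (((hasDerivWithinAt_prob A _ ht).add (hasDerivWithinAt_prob A _ ht)).sub
    (hasDerivWithinAt_prob A _ ht)).sub (hasDerivWithinAt_prob A _ ht)

/- Mixed differences of probabilities are at least `-2`, so a violation of submodularity by
`e * tripleWeight` can only involve at most `2 / ε` particles, and the rates in
`neg_mixedDiff_gen_le` are bounded. -/
theorem neg_mixedDiff_gen_prob_le {A : Set (FinConfig d)} {t m e ε : ℝ} (hε : 0 < ε) (he : ε ≤ e)
    (hm : 0 ≤ m) (hprob : AlmostSubmodular (prob p γ A t) m e) {h a b : FinConfig d}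
    (hneg : e * tripleWeight h a b ≤ -mixedDiff (prob p γ A t) h a b) :
    -mixedDiff (gen p γ (prob p γ A t)) h a b ≤
      (1 + 3 * γ / 2) * (2 / ε) * m + e * (3 * γ * tripleWeight h a b) := by
  have hsize : size (h + a + b) ≤ 2 / ε := by
    rw [le_div_iff₀' hε, size_add, size_add]
    calc ε * (size h + size a + size b) ≤ e * tripleWeight h a b :=
          mul_le_mul he (by linarith [one_add_size_le_tripleWeight h a b])
            (by linarith [size_nonneg h, size_nonneg a, size_nonneg b]) (hε.le.trans he)
      _ ≤ 2 := hneg.trans (neg_mixedDiff_prob_le_two _ _ _ _ _)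
  calc -mixedDiff (gen p γ (prob p γ A t)) h a b
      ≤ (1 + 3 * γ / 2) * size (h + a + b) * m + e * (3 * γ * tripleWeight h a b) :=
        neg_mixedDiff_gen_le hprob (controlled_prob A t) hm (hε.le.trans he) hneg
    _ ≤ (1 + 3 * γ / 2) * (2 / ε) * m + e * (3 * γ * tripleWeight h a b) := by gcongr

theorem neg_mixedDiff_prob_le {A : Set (FinConfig d)}
    (hA : ∀ h a b, 0 ≤ mixedDiff (A.indicator 1) h a b) {ε : ℝ} (hε : 0 < ε) {t : ℝ}
    (ht : 0 ≤ t) (h a b : FinConfig d) :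
    -mixedDiff (prob p γ A t) h a b ≤
      ε * Real.exp (3 * γ * t) * tripleWeight h a b := by
  refine sub_nonpos.1 (nonpos_of_rightDeriv_le (I := FinConfig d × FinConfig d × FinConfig d)
    (u := fun s i => -mixedDiff (prob p γ A s) i.1 i.2.1 i.2.2 -
      ε * Real.exp (3 * γ * s) * tripleWeight i.1 i.2.1 i.2.2)
    (u' := fun s i => -mixedDiff (gen p γ (prob p γ A s)) i.1 i.2.1 i.2.2 -
      ε * (Real.exp (3 * γ * s) * (3 * γ)) * tripleWeight i.1 i.2.1 i.2.2)
    (T := t) (K := 2) (L := (1 + 3 * γ / 2) * (2 / ε)) (by positivity) ?_ ?_ ?_ ?_ ?_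
    t ⟨ht, le_rfl⟩ (h, a, b))
  · intro s _ i
    have hpen : 0 ≤ ε * Real.exp (3 * γ * s) * tripleWeight i.1 i.2.1 i.2.2 := by
      have := tripleWeight_pos i.1 i.2.1 i.2.2
      positivity
    linarith [neg_mixedDiff_prob_le_two (p := p) (γ := γ) A s i.1 i.2.1 i.2.2]
  · intro i
    exact ((continuous_mixedDiff_prob A _ _ _).neg.sub
      ((by fun_prop : Continuous fun s : ℝ => ε * Real.exp (3 * γ * s)).mul_const _)).continuousOn
  · intro i s hs
    have hexp : HasDerivAt (fun s : ℝ => Real.exp (3 * γ * s))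
        (Real.exp (3 * γ * s) * (3 * γ)) s := by
      simpa using ((hasDerivAt_id' s).const_mul (3 * (γ : ℝ))).exp
    exact (hasDerivWithinAt_mixedDiff_prob A _ _ _ hs.1).neg.sub
      ((hexp.hasDerivWithinAt.const_mul ε).mul_const _)
  · intro i
    have hprob_zero : prob p γ A 0 = A.indicator 1 := funext (prob_zero A)
    simp only [hprob_zero, mul_zero, Real.exp_zero, mul_one]
    linarith [hA i.1 i.2.1 i.2.2, mul_pos hε (tripleWeight_pos i.1 i.2.1 i.2.2)]
  · intro s hs m hm hle i hpos
    have hexp : 1 ≤ Real.exp (3 * γ * s) := Real.one_le_exp (mul_nonneg (by positivity) hs.1)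
    have hg : AlmostSubmodular (prob p γ A s) m (ε * Real.exp (3 * γ * s)) := fun h a b => by
      linarith [hle (h, a, b)]
    have hgen := neg_mixedDiff_gen_prob_le hε (le_mul_of_one_le_right hε.le hexp) hm hg
      (sub_pos.1 hpos).le
    linarith

theorem mixedDiff_prob_nonneg {A : Set (FinConfig d)}
    (hA : ∀ h a b, 0 ≤ mixedDiff (A.indicator 1) h a b) {t : ℝ} (ht : 0 ≤ t)
    (h a b : FinConfig d) : 0 ≤ mixedDiff (prob p γ A t) h a b := by
  refine le_of_forall_pos_le_add fun δ hδ => ?_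
  have hweight : 0 < Real.exp (3 * γ * t) * tripleWeight h a b :=
    mul_pos (Real.exp_pos _) (tripleWeight_pos h a b)
  have hle := neg_mixedDiff_prob_le (p := p) (γ := γ) hA (div_pos hδ hweight) ht h a b
  rw [mul_assoc, div_mul_cancel₀ _ hweight.ne'] at hle
  linarith

end Submodularity

/-! ### The random walk in continuous time -/

section ContinuousTimeWalk

theorem tsum_nStep (p : PMF (Site d)) (n : ℕ) : ∑' z, nStep p n z = 1 := by
  induction n with
  | zero => simp [nStep]
  | succ n ih =>
    simp only [nStep]
    rw [ENNReal.tsum_comm, ← p.tsum_coe]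
    refine tsum_congr fun y => ?_
    rw [ENNReal.tsum_mul_left, ← (Equiv.addRight y).tsum_eq]
    simp [ih]

theorem nStep_le_one (p : PMF (Site d)) (n : ℕ) (z : Site d) : nStep p n z ≤ 1 :=
  (ENNReal.le_tsum z).trans_eq (tsum_nStep p n)

/-- The transition probabilities of the walk in continuous time with jump rate `1`, started at
the origin. -/
def kern (p : PMF (Site d)) (t : ℝ) (z : Site d) : ℝ :=
  Real.exp (-t) * ∑' n : ℕ, t ^ n / n.factorial * (nStep p n z).toReal

variable {p : PMF (Site d)}

theorem abs_toReal_nStep_le (n : ℕ) (z : Site d) : |(nStep p n z).toReal| ≤ 1 := by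
  rw [abs_of_nonneg ENNReal.toReal_nonneg]
  exact ENNReal.toReal_le_of_le_ofReal zero_le_one (by simpa using nStep_le_one p n z)

theorem summable_pow_div_factorial_mul (t : ℝ) {c : ℕ → ℝ} (hc : ∀ n, |c n| ≤ 1) :
    Summable fun n : ℕ => t ^ n / n.factorial * c n := by
  refine Summable.of_norm_bounded (Real.summable_pow_div_factorial |t|) fun n => ?_
  rw [norm_mul, norm_div, norm_pow, Real.norm_eq_abs, Real.norm_natCast]
  exact mul_le_of_le_one_right (by positivity) (hc n)

theorem hasDerivAt_tsum_pow_div_factorial {c : ℕ → ℝ} (hc : ∀ n, |c n| ≤ 1) (t : ℝ) :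
    HasDerivAt (fun t : ℝ => ∑' n : ℕ, t ^ n / n.factorial * c n)
      (∑' n : ℕ, t ^ n / n.factorial * c (n + 1)) t := by
  have hsplit (s : ℝ) : ∑' n : ℕ, s ^ n / n.factorial * c n =
      c 0 + ∑' n : ℕ, s ^ (n + 1) / (n + 1).factorial * c (n + 1) := by
    rw [(summable_pow_div_factorial_mul s hc).tsum_eq_zero_add, pow_zero, Nat.factorial_zero,
      Nat.cast_one, div_one, one_mul]
  simp only [hsplit]
  have hmem {s : ℝ} (hs : |s| ≤ |t|) : s ∈ Set.Ioo (-(|t| + 1)) (|t| + 1) :=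
    abs_lt.1 (hs.trans_lt (lt_add_one _))
  refine (hasDerivAt_tsum_of_isPreconnected (Real.summable_pow_div_factorial (|t| + 1)) isOpen_Ioo
    isPreconnected_Ioo (g := fun n s => s ^ (n + 1) / (n + 1).factorial * c (n + 1))
    (g' := fun n s => s ^ n / n.factorial * c (n + 1)) (fun n s _ => by
      simpa only [one_mul] using (hasDerivAt_pow_div_factorial 1 s n).mul_const (c (n + 1)))
    (fun n s hs => ?_) (hmem (s := 0) (by rw [abs_zero]; exact abs_nonneg t)) ?_
    (hmem le_rfl)).const_add (c 0)
  · have hs' : |s| ≤ |t| + 1 := (abs_lt.2 hs).le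
    rw [norm_mul, norm_div, norm_pow, Real.norm_natCast, Real.norm_eq_abs, Real.norm_eq_abs]
    refine (mul_le_of_le_one_right (by positivity) (hc _)).trans ?_
    gcongr
  · exact (summable_nat_add_iff 1).2 (summable_pow_div_factorial_mul 0 hc)

theorem integral_toReal_nStep (n : ℕ) (z : Site d) :
    ∫ v, (nStep p n (z - v)).toReal ∂p.toMeasure = (nStep p (n + 1) z).toReal := by
  rw [integral_toReal (measurable_of_countable _).aemeasurable
    (Eventually.of_forall fun v => (nStep_le_one p n _).trans_lt ENNReal.one_lt_top),
    lintegral_countable', nStep]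
  congr 1
  refine tsum_congr fun v => ?_
  rw [PMF.toMeasure_apply_singleton _ _ (measurableSet_singleton v), mul_comm]

theorem integral_kern (t : ℝ) (z : Site d) : ∫ v, kern p t (z - v) ∂p.toMeasure =
    Real.exp (-t) * ∑' n : ℕ, t ^ n / n.factorial * (nStep p (n + 1) z).toReal := by
  simp only [kern]
  rw [integral_const_mul]
  congr 1
  have hint : ∀ n : ℕ, Integrable
      (fun v => t ^ n / n.factorial * (nStep p n (z - v)).toReal) p.toMeasure := fun n =>
    Integrable.of_bound (C := |t ^ n / n.factorial|)
      (measurable_of_countable _).aestronglyMeasurable <| .of_forall fun v => by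
        rw [norm_mul]
        exact mul_le_of_le_one_right (abs_nonneg _) (abs_toReal_nStep_le n _)
  rw [← integral_tsum_of_summable_integral_norm hint]
  · simp_rw [integral_const_mul, integral_toReal_nStep]
  · refine Summable.of_nonneg_of_le (fun n => integral_nonneg fun v => norm_nonneg _) (fun n => ?_)
      (Real.summable_pow_div_factorial |t|)
    have hle (v : Site d) : ‖t ^ n / n.factorial * (nStep p n (z - v)).toReal‖ ≤
        |t| ^ n / n.factorial := by
      rw [norm_mul, norm_div, norm_pow, Real.norm_eq_abs, Real.norm_natCast]
      exact mul_le_of_le_one_right (by positivity) (abs_toReal_nStep_le n _)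
    simpa only [integral_const, probReal_univ, one_smul] using
      integral_mono (μ := p.toMeasure) (hint n).norm (integrable_const _) hle

theorem hasDerivAt_kern (t : ℝ) (z : Site d) : HasDerivAt (fun t => kern p t z)
    (∫ v, kern p t (z - v) ∂p.toMeasure - kern p t z) t := by
  have hexp : HasDerivAt (fun t : ℝ => Real.exp (-t)) (-Real.exp (-t)) t := by
    simpa only [mul_neg, mul_one] using (hasDerivAt_id' t).fun_neg.exp
  refine (hexp.mul (hasDerivAt_tsum_pow_div_factorial
    (c := fun n => (nStep p n z).toReal) (fun n => abs_toReal_nStep_le n z) t)).congr_deriv ?_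
  rw [integral_kern, kern]
  ring

theorem continuous_kern (z : Site d) : Continuous fun t => kern p t z :=
  continuous_iff_continuousAt.2 fun t => (hasDerivAt_kern t z).continuousAt

theorem continuous_kern_sq (z : Site d) : Continuous fun t => kern p t z ^ 2 :=
  (continuous_kern z).pow 2

theorem kern_nonneg {t : ℝ} (ht : 0 ≤ t) (z : Site d) : 0 ≤ kern p t z :=
  mul_nonneg (Real.exp_nonneg _) (tsum_nonneg fun _ => by positivity)

theorem kern_zero (z : Site d) : kern p 0 z = if z = 0 then 1 else 0 := by
  rw [kern, tsum_eq_single 0 fun n hn => by simp [hn]]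
  simp only [nStep]
  split_ifs <;> simp

theorem ofReal_kern {t : ℝ} (ht : 0 ≤ t) (z : Site d) : ENNReal.ofReal (kern p t z) =
    ENNReal.ofReal (Real.exp (-t)) * ∑' n : ℕ, ENNReal.ofReal (t ^ n / n.factorial) *
      nStep p n z := by
  rw [kern, ENNReal.ofReal_mul (Real.exp_nonneg _), ENNReal.ofReal_tsum_of_nonneg
    (fun n => by positivity)
    (summable_pow_div_factorial_mul t fun n => abs_toReal_nStep_le n z)]
  congr 1
  refine tsum_congr fun n => ?_
  rw [ENNReal.ofReal_mul (by positivity),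
    ENNReal.ofReal_toReal ((nStep_le_one p n z).trans_lt ENNReal.one_lt_top).ne]

theorem tsum_ofReal_kern {t : ℝ} (ht : 0 ≤ t) : ∑' z, ENNReal.ofReal (kern p t z) = 1 := by
  simp_rw [ofReal_kern ht]
  rw [ENNReal.tsum_mul_left, ENNReal.tsum_comm]
  simp_rw [ENNReal.tsum_mul_left, tsum_nStep, mul_one]
  rw [← ENNReal.ofReal_tsum_of_nonneg (fun n => by positivity) (Real.summable_pow_div_factorial t),
    ← ENNReal.ofReal_mul (Real.exp_nonneg _)]
  have hexp : ∑' n : ℕ, t ^ n / n.factorial = Real.exp t := by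
    rw [Real.exp_eq_exp_ℝ, NormedSpace.exp_eq_tsum_div]
  rw [hexp, ← Real.exp_add, neg_add_cancel, Real.exp_zero, ENNReal.ofReal_one]

theorem sum_kern_le_one {t : ℝ} (ht : 0 ≤ t) (s : Finset (Site d)) : ∑ z ∈ s, kern p t z ≤ 1 := by
  rw [← ENNReal.ofReal_le_ofReal_iff zero_le_one,
    ENNReal.ofReal_sum_of_nonneg fun z _ => kern_nonneg ht z, ENNReal.ofReal_one,
    ← tsum_ofReal_kern (p := p) ht]
  exact ENNReal.sum_le_tsum s

theorem kern_le_one {t : ℝ} (ht : 0 ≤ t) (z : Site d) : kern p t z ≤ 1 := by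
  simpa using sum_kern_le_one (p := p) ht {z}

theorem kern_pos {t : ℝ} (ht : 0 < t) {z : Site d} {n : ℕ} (hz : nStep p n z ≠ 0) :
    0 < kern p t z := by
  refine mul_pos (Real.exp_pos _) (lt_of_lt_of_le ?_
    ((summable_pow_div_factorial_mul t fun n => abs_toReal_nStep_le (p := p) n z).le_tsum n
      fun m _ => by positivity))
  have hpos : 0 < (nStep p n z).toReal :=
    ENNReal.toReal_pos hz ((nStep_le_one p n z).trans_lt ENNReal.one_lt_top).ne
  positivity

theorem exists_kern_one_le_of_irreducible (hd : 1 ≤ d) (hirr : IsIrreducible (p : Site d → ℝ≥0∞)) :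
    ∃ α < 1, ∀ z, kern p 1 z ≤ α := by
  let z₀ : Site d := fun _ => 1
  have hne : z₀ ≠ 0 := fun h => one_ne_zero (congrFun h ⟨0, hd⟩)
  obtain ⟨n, hn⟩ := hirr z₀
  have hpos_zero : 0 < kern p 1 (0 : Site d) := kern_pos one_pos (n := 0) (by simp [nStep])
  have hpos : 0 < kern p 1 z₀ := kern_pos one_pos hn.ne'
  have hpair {z : Site d} (hz : z ≠ 0) : kern p 1 0 + kern p 1 z ≤ 1 := by
    rw [← Finset.sum_pair hz.symm]
    exact sum_kern_le_one zero_le_one _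
  refine ⟨1 - min (kern p 1 0) (kern p 1 z₀), by linarith [lt_min hpos_zero hpos], fun z => ?_⟩
  obtain rfl | hz := eq_or_ne z 0
  · linarith [hpair hne, min_le_right (kern p 1 0) (kern p 1 z₀)]
  · linarith [hpair hz, min_le_left (kern p 1 0) (kern p 1 z₀)]

end ContinuousTimeWalk

/-! ### Recurrence of the symmetrised walk -/

section DiscreteWalk

/-- The expected number of visits to the origin of the walk started at `x`. -/
def green (q : Site d → ℝ≥0∞) (x : Site d) : ℝ≥0∞ :=
  ∑' n, nStep q n (-x)

theorem green_eq_add_tsum (q : Site d → ℝ≥0∞) (x : Site d) :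
    green q x = (if x = 0 then 1 else 0) + ∑' y, q y * green q (x + y) := by
  simp only [green]
  rw [tsum_eq_zero_add' ENNReal.summable]
  simp only [nStep, neg_eq_zero]
  rw [ENNReal.tsum_comm]
  simp_rw [ENNReal.tsum_mul_left, neg_add, sub_eq_add_neg]

theorem hitWithin_mul_green_zero_le (q : Site d → ℝ≥0∞) (n : ℕ) (x : Site d) :
    hitWithin q n x * green q 0 ≤ green q x := by
  induction n generalizing x with
  | zero =>
    simp only [hitWithin]
    split_ifs with hx
    · rw [hx, one_mul]
    · rw [zero_mul]
      exact zero_le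
  | succ n ih =>
    simp only [hitWithin]
    split_ifs with hx
    · rw [hx, one_mul]
    · rw [green_eq_add_tsum q x, if_neg hx, zero_add, ← ENNReal.tsum_mul_right]
      refine ENNReal.tsum_le_tsum fun y => ?_
      rw [mul_assoc]
      gcongr
      exact ih _

theorem green_zero_eq_top {q : Site d → ℝ≥0∞} (hrec : IsRecurrent q) : green q 0 = ∞ := by
  have hreturn : green q 0 ≤ ∑' y, q y * green q y :=
    calc green q 0 = (∑' y, q y * ⨆ n, hitWithin q n y) * green q 0 := by rw [hrec, one_mul]
      _ = ∑' y, q y * ⨆ n, hitWithin q n y * green q 0 := by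
        rw [← ENNReal.tsum_mul_right]
        exact tsum_congr fun y => by rw [mul_assoc, ENNReal.iSup_mul]
      _ ≤ ∑' y, q y * green q y := ENNReal.tsum_le_tsum fun y => by
        gcongr
        exact iSup_le fun n => hitWithin_mul_green_zero_le q n y
  have hle : green q 0 + 1 ≤ green q 0 := by
    conv_rhs => rw [green_eq_add_tsum q 0, if_pos rfl, add_comm]
    simpa only [zero_add] using add_le_add_left hreturn 1
  by_contra hfin
  exact (ENNReal.lt_add_right hfin one_ne_zero).not_ge hle

theorem tsum_nStep_zero_eq_top {q : Site d → ℝ≥0∞} (hrec : IsRecurrent q) :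
    ∑' n, nStep q n 0 = ∞ := by
  simpa only [green, neg_zero] using green_zero_eq_top hrec

/-- The law of the difference of two independent walks after `n` and `m` steps. -/
def diffStep (q : Site d → ℝ≥0∞) (n m : ℕ) (z : Site d) : ℝ≥0∞ :=
  ∑' v, nStep q n v * nStep q m (v - z)

theorem diffStep_succ_left (q : Site d → ℝ≥0∞) (n m : ℕ) (z : Site d) :
    diffStep q (n + 1) m z = ∑' y, q y * diffStep q n m (z - y) := by
  simp only [diffStep, nStep, ← ENNReal.tsum_mul_right, ← ENNReal.tsum_mul_left]
  rw [ENNReal.tsum_comm]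
  refine tsum_congr fun y => ?_
  rw [← (Equiv.addRight y).tsum_eq]
  refine tsum_congr fun v => ?_
  rw [Equiv.coe_addRight, add_sub_cancel_right, mul_assoc, sub_sub_eq_add_sub]

theorem diffStep_succ_right (q : Site d → ℝ≥0∞) (n m : ℕ) (z : Site d) :
    diffStep q n (m + 1) z = ∑' y, q (-y) * diffStep q n m (z - y) := by
  simp only [diffStep, nStep, ← ENNReal.tsum_mul_left]
  rw [ENNReal.tsum_comm, ← (Equiv.neg (Site d)).tsum_eq]
  refine tsum_congr fun y => tsum_congr fun v => ?_
  rw [Equiv.neg_apply, mul_left_comm, show v - z - -y = v - (z - y) by abel]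

theorem two_pow_succ_mul_nStep_symmetrised (q : Site d → ℝ≥0∞) (N : ℕ) (z : Site d) :
    2 ^ (N + 1) * nStep (symmetrised q) (N + 1) z =
      ∑' y, (q (-y) + q y) * (2 ^ N * nStep (symmetrised q) N (z - y)) := by
  rw [nStep, ← ENNReal.tsum_mul_left]
  refine tsum_congr fun y => ?_
  have htwo : 2 * symmetrised q y = q (-y) + q y := by
    rw [symmetrised, ENNReal.mul_div_cancel two_ne_zero ENNReal.ofNat_ne_top, add_comm]
  rw [← htwo, pow_succ]
  ring

theorem two_pow_mul_nStep_symmetrised (q : Site d → ℝ≥0∞) (N : ℕ) (z : Site d) :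
    2 ^ N * nStep (symmetrised q) N z =
      ∑ ij ∈ Finset.HasAntidiagonal.antidiagonal N,
        (N.choose ij.1 : ℝ≥0∞) * diffStep q ij.1 ij.2 z := by
  induction N generalizing z with
  | zero =>
    simp only [pow_zero, one_mul, Finset.HasAntidiagonal.antidiagonal_zero, Finset.sum_singleton,
      diffStep, nStep, Nat.choose_self, Nat.cast_one]
    rw [tsum_eq_single 0 fun v hv => by rw [if_neg hv, zero_mul]]
    simp only [if_true, zero_sub, neg_eq_zero, one_mul]
  | succ N ih =>
    rw [Finset.sum_antidiagonal_choose_succ_mul (fun i j => diffStep q i j z),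
      two_pow_succ_mul_nStep_symmetrised]
    simp_rw [ih, add_mul, Finset.mul_sum]
    rw [ENNReal.tsum_add, Summable.tsum_finsetSum fun _ _ => ENNReal.summable,
      Summable.tsum_finsetSum fun _ _ => ENNReal.summable]
    congr 1
    · refine Finset.sum_congr rfl fun ij _ => ?_
      rw [diffStep_succ_right, ← ENNReal.tsum_mul_left]
      exact tsum_congr fun y => mul_left_comm _ _ _
    · refine Finset.sum_congr rfl fun ij hij => ?_
      rw [diffStep_succ_left, ← ENNReal.tsum_mul_left,
        Nat.choose_symm_of_eq_add (Finset.HasAntidiagonal.mem_antidiagonal.1 hij).symm]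
      exact tsum_congr fun y => mul_left_comm _ _ _

end DiscreteWalk

section Overlap

variable {p : PMF (Site d)}

theorem tsum_ofReal_kern_mul_ofReal_kern_sub {r : ℝ} (hr : 0 ≤ r) (z : Site d) :
    ∑' v, ENNReal.ofReal (kern p r v) * ENNReal.ofReal (kern p r (v - z)) =
      ENNReal.ofReal (Real.exp (-(2 * r))) * ∑' ij : ℕ × ℕ,
        ENNReal.ofReal (r ^ ij.1 / ij.1.factorial * (r ^ ij.2 / ij.2.factorial)) *
          diffStep p ij.1 ij.2 z := by
  have hterm (v : Site d) : ENNReal.ofReal (kern p r v) * ENNReal.ofReal (kern p r (v - z)) =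
      ENNReal.ofReal (Real.exp (-(2 * r))) * ∑' ij : ℕ × ℕ,
        ENNReal.ofReal (r ^ ij.1 / ij.1.factorial * (r ^ ij.2 / ij.2.factorial)) *
          (nStep p ij.1 v * nStep p ij.2 (v - z)) := by
    rw [ofReal_kern hr, ofReal_kern hr, mul_mul_mul_comm, ← ENNReal.ofReal_mul (Real.exp_nonneg _),
      ← Real.exp_add, ← neg_add, ← two_mul, ENNReal.tsum_prod', ← ENNReal.tsum_mul_right]
    congr 1
    refine tsum_congr fun n => ?_
    rw [← ENNReal.tsum_mul_left]
    refine tsum_congr fun m => ?_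
    rw [ENNReal.ofReal_mul (by positivity), mul_mul_mul_comm]
  simp_rw [hterm]
  rw [ENNReal.tsum_mul_left, ENNReal.tsum_comm]
  simp_rw [diffStep, ENNReal.tsum_mul_left]

theorem pow_div_factorial_mul_pow_div_factorial (r : ℝ) (i j : ℕ) :
    r ^ i / i.factorial * (r ^ j / j.factorial) =
      r ^ (i + j) / (i + j).factorial * (i + j).choose i := by
  have hi : (i.factorial : ℝ) ≠ 0 := by positivity
  have hj : (j.factorial : ℝ) ≠ 0 := by positivity
  rw [Nat.cast_add_choose, pow_add]
  field_simp

theorem sum_antidiagonal_pow_div_factorial_mul_diffStep {r : ℝ} (hr : 0 ≤ r) (N : ℕ) (z : Site d) :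
    ∑ ij ∈ Finset.HasAntidiagonal.antidiagonal N,
      ENNReal.ofReal (r ^ ij.1 / ij.1.factorial * (r ^ ij.2 / ij.2.factorial)) *
        diffStep p ij.1 ij.2 z =
      ENNReal.ofReal ((2 * r) ^ N / N.factorial) * nStep (symmetrised p) N z := by
  rw [mul_pow, mul_comm (2 ^ N), mul_div_right_comm, ENNReal.ofReal_mul (by positivity),
    ENNReal.ofReal_pow zero_le_two, ENNReal.ofReal_ofNat, mul_assoc, two_pow_mul_nStep_symmetrised,
    Finset.mul_sum]
  refine Finset.sum_congr rfl fun ij hij => ?_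
  rw [pow_div_factorial_mul_pow_div_factorial, Finset.HasAntidiagonal.mem_antidiagonal.1 hij,
    ENNReal.ofReal_mul (by positivity), ENNReal.ofReal_natCast, mul_assoc]

theorem tsum_ofReal_kern_sq {r : ℝ} (hr : 0 ≤ r) : ∑' v, ENNReal.ofReal (kern p r v ^ 2) =
    ∑' N : ℕ, ENNReal.ofReal (Real.exp (-(2 * r)) * ((2 * r) ^ N / N.factorial)) *
      nStep (symmetrised p) N 0 := by
  have hprod := tsum_ofReal_kern_mul_ofReal_kern_sub (p := p) hr 0
  rw [← Finset.HasAntidiagonal.sigmaAntidiagonalEquivProd.tsum_eq, ENNReal.tsum_sigma'] at hprod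
  simp only [tsum_fintype, Finset.HasAntidiagonal.sigmaAntidiagonalEquivProd_apply] at hprod
  simp_rw [sub_zero, ← ENNReal.ofReal_mul (kern_nonneg hr _), ← pow_two] at hprod
  rw [hprod, ← ENNReal.tsum_mul_left]
  refine tsum_congr fun N => ?_
  rw [Finset.sum_coe_sort (Finset.HasAntidiagonal.antidiagonal N) fun ij => ENNReal.ofReal
      (r ^ ij.1 / ij.1.factorial * (r ^ ij.2 / ij.2.factorial)) * diffStep p ij.1 ij.2 0,
    sum_antidiagonal_pow_div_factorial_mul_diffStep hr, ENNReal.ofReal_mul (Real.exp_nonneg _),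
    mul_assoc]

theorem integral_exp_mul_pow_div_factorial (N : ℕ) :
    ∫ r in Set.Ioi (0 : ℝ), Real.exp (-(2 * r)) * ((2 * r) ^ N / N.factorial) = 1 / 2 := by
  have hGamma := Real.integral_rpow_mul_exp_neg_mul_Ioi (a := N + 1) (r := 2) (by positivity)
    two_pos
  rw [Real.Gamma_nat_eq_factorial, ← Nat.cast_succ, Real.rpow_natCast] at hGamma
  have hterm (r : ℝ) : Real.exp (-(2 * r)) * ((2 * r) ^ N / N.factorial) =
      2 ^ N / N.factorial * (r ^ ((N.succ : ℝ) - 1) * Real.exp (-(2 * r))) := by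
    rw [Nat.cast_succ, add_sub_cancel_right, Real.rpow_natCast, mul_pow]
    ring
  simp_rw [hterm]
  rw [integral_const_mul, hGamma]
  have hfactorial : (N.factorial : ℝ) ≠ 0 := by positivity
  rw [one_div_pow, pow_succ]
  field_simp

theorem lintegral_exp_mul_pow_div_factorial (N : ℕ) : ∫⁻ r in Set.Ioi (0 : ℝ),
    ENNReal.ofReal (Real.exp (-(2 * r)) * ((2 * r) ^ N / N.factorial)) =
      ENNReal.ofReal (1 / 2) := by
  rw [← integral_exp_mul_pow_div_factorial N, ofReal_integral_eq_lintegral_ofReal]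
  · refine not_imp_comm.1 integral_undef ?_
    rw [integral_exp_mul_pow_div_factorial]
    norm_num
  · filter_upwards [ae_restrict_mem measurableSet_Ioi] with r hr
    have hr : 0 < r := hr
    positivity

theorem lintegral_kern_sq_eq_top (hrec : IsRecurrent (symmetrised (p : Site d → ℝ≥0∞))) :
    ∑' v, ∫⁻ r in Set.Ioi (0 : ℝ), ENNReal.ofReal (kern p r v ^ 2) = ∞ := by
  rw [← lintegral_tsum fun v => (continuous_kern_sq v).measurable.ennreal_ofReal.aemeasurable,
    setLIntegral_congr_fun measurableSet_Ioi fun r (hr : (0 : ℝ) < r) => tsum_ofReal_kern_sq hr.le,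
    lintegral_tsum fun N => Measurable.aemeasurable (by fun_prop)]
  have hterm (N : ℕ) : ∫⁻ r in Set.Ioi (0 : ℝ), ENNReal.ofReal (Real.exp (-(2 * r)) *
      ((2 * r) ^ N / N.factorial)) * nStep (symmetrised p) N 0 =
      ENNReal.ofReal (1 / 2) * nStep (symmetrised p) N 0 := by
    rw [lintegral_mul_const _ (by fun_prop), lintegral_exp_mul_pow_div_factorial]
  simp_rw [hterm]
  rw [ENNReal.tsum_mul_left, tsum_nStep_zero_eq_top hrec,
    ENNReal.mul_top (ENNReal.ofReal_pos.2 one_half_pos).ne']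

theorem lintegral_Ioi_eq_iSup_intervalIntegral {f : ℝ → ℝ} (hf : Continuous f) (hf0 : 0 ≤ f) :
    ∫⁻ r in Set.Ioi (0 : ℝ), ENNReal.ofReal (f r) =
      ⨆ n : ℕ, ENNReal.ofReal (∫ r in (0 : ℝ)..n, f r) := by
  have hmono : Monotone fun n : ℕ => Set.Ioc (0 : ℝ) n := fun m n hmn =>
    Set.Ioc_subset_Ioc_right (Nat.cast_le.2 hmn)
  have hunion : Set.Ioi (0 : ℝ) = ⋃ n : ℕ, Set.Ioc (0 : ℝ) n := by
    ext r
    simp only [Set.mem_Ioi, Set.mem_iUnion, Set.mem_Ioc]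
    exact ⟨fun hr => ⟨⌈r⌉₊, hr, Nat.le_ceil r⟩, fun ⟨_, hr, _⟩ => hr⟩
  rw [hunion, setLIntegral_iUnion_of_directed _ hmono.directed_le]
  refine iSup_congr fun n => ?_
  rw [intervalIntegral.integral_of_le (Nat.cast_nonneg n),
    ofReal_integral_eq_lintegral_ofReal hf.integrableOn_Ioc (Eventually.of_forall hf0)]

theorem exists_lt_sum_integral_kern_sq (hrec : IsRecurrent (symmetrised (p : Site d → ℝ≥0∞)))
    (C : ℝ) : ∃ (D : Finset (Site d)) (T : ℝ), 0 ≤ T ∧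
      C < ∑ v ∈ D, ∫ r in (0 : ℝ)..T, kern p r v ^ 2 := by
  by_contra! hbound
  have hnonneg (v : Site d) (n : ℕ) : 0 ≤ ∫ r in (0 : ℝ)..n, kern p r v ^ 2 :=
    intervalIntegral.integral_nonneg (Nat.cast_nonneg n) fun r _ => sq_nonneg _
  have hmono (v : Site d) :
      Monotone fun n : ℕ => ENNReal.ofReal (∫ r in (0 : ℝ)..n, kern p r v ^ 2) := fun m n hmn =>
    ENNReal.ofReal_le_ofReal (intervalIntegral.integral_mono_interval le_rfl (Nat.cast_nonneg m)
      (Nat.cast_le.2 hmn) (Eventually.of_forall fun r => sq_nonneg _)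
      ((continuous_kern_sq v).intervalIntegrable _ _))
  have hsum (D : Finset (Site d)) :
      ∑ v ∈ D, ∫⁻ r in Set.Ioi (0 : ℝ), ENNReal.ofReal (kern p r v ^ 2) ≤ ENNReal.ofReal C := by
    simp_rw [lintegral_Ioi_eq_iSup_intervalIntegral (continuous_kern_sq (p := p) _)
      fun _ => sq_nonneg _]
    rw [ENNReal.finsetSum_iSup_of_monotone hmono]
    refine iSup_le fun n => ?_
    rw [← ENNReal.ofReal_sum_of_nonneg fun v _ => hnonneg v n]
    exact ENNReal.ofReal_le_ofReal (hbound D n (Nat.cast_nonneg n))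
  have htop := lintegral_kern_sq_eq_top hrec
  rw [ENNReal.tsum_eq_iSup_sum] at htop
  exact ENNReal.ofReal_ne_top (top_le_iff.1 (htop.symm.trans_le (iSup_le hsum)))

end Overlap

/-! ### Solutions of the backward equation with a source -/

section ForcedEquation

variable {p : PMF (Site d)} {γ : ℝ≥0}

/-- `u` solves the backward equation with the source term `σ`. -/
structure Forced (p : PMF (Site d)) (γ : ℝ≥0) (u σ : ℝ → FinConfig d → ℝ) : Prop where
  controlled : ∀ t, 0 ≤ t → Controlled (u t)
  continuous : ∀ ξ, Continuous fun t => u t ξ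
  hasDerivWithinAt : ∀ ξ t, 0 ≤ t →
    HasDerivWithinAt (fun t => u t ξ) (gen p γ (u t) ξ + σ t ξ) (Set.Ici t) t

namespace Forced

variable {u w σ τ : ℝ → FinConfig d → ℝ}

theorem add (hu : Forced p γ u σ) (hw : Forced p γ w τ) :
    Forced p γ (fun t ξ => u t ξ + w t ξ) fun t ξ => σ t ξ + τ t ξ where
  controlled t ht := (hu.controlled t ht).add (hw.controlled t ht)
  continuous ξ := (hu.continuous ξ).add (hw.continuous ξ)
  hasDerivWithinAt ξ t ht := by
    rw [gen_add (hu.controlled t ht) (hw.controlled t ht)]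
    exact ((hu.hasDerivWithinAt ξ t ht).add (hw.hasDerivWithinAt ξ t ht)).congr_deriv (by ring)

theorem mul_fun (hu : Forced p γ u σ) {c c' : ℝ → ℝ} (hc : Continuous c)
    (hc' : ∀ t, 0 ≤ t → HasDerivWithinAt c (c' t) (Set.Ici t) t) :
    Forced p γ (fun t ξ => c t * u t ξ) fun t ξ => c' t * u t ξ + c t * σ t ξ where
  controlled t ht := (hu.controlled t ht).const_mul (c t)
  continuous ξ := hc.mul (hu.continuous ξ)
  hasDerivWithinAt ξ t ht := by
    rw [gen_const_mul]
    exact ((hc' t ht).mul (hu.hasDerivWithinAt ξ t ht)).congr_deriv (by ring)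

theorem const_mul (hu : Forced p γ u σ) (c : ℝ) :
    Forced p γ (fun t ξ => c * u t ξ) fun t ξ => c * σ t ξ := by
  simpa using hu.mul_fun (c := fun _ => c) (c' := fun _ => 0) continuous_const
    fun t _ => hasDerivWithinAt_const t _ c

theorem sub (hu : Forced p γ u σ) (hw : Forced p γ w τ) :
    Forced p γ (fun t ξ => u t ξ - w t ξ) fun t ξ => σ t ξ - τ t ξ := by
  simpa [sub_eq_add_neg] using hu.add (hw.const_mul (-1))

theorem const (c : ℝ) : Forced p γ (fun _ _ => c) fun _ _ => 0 where
  controlled _ _ := Controlled.const c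
  continuous _ := continuous_const
  hasDerivWithinAt ξ t _ := by
    rw [gen_const, add_zero]
    exact hasDerivWithinAt_const t _ c

theorem sum {ι : Type*} {s : Finset ι} {u σ : ι → ℝ → FinConfig d → ℝ}
    (hu : ∀ i ∈ s, Forced p γ (u i) (σ i)) :
    Forced p γ (fun t ξ => ∑ i ∈ s, u i t ξ) fun t ξ => ∑ i ∈ s, σ i t ξ := by
  classical
  induction s using Finset.induction_on with
  | empty => simpa using const (p := p) (γ := γ) 0
  | insert i s hi ih =>
    simp_rw [Finset.sum_insert hi]
    exact (hu i (Finset.mem_insert_self _ _)).add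
      (ih fun j hj => hu j (Finset.mem_insert_of_mem hj))

theorem prob (A : Set (FinConfig d)) : Forced p γ (prob p γ A) fun _ _ => 0 where
  controlled t _ := controlled_prob A t
  continuous ξ := continuous_prob A ξ
  hasDerivWithinAt ξ t ht := by
    rw [add_zero]
    exact hasDerivWithinAt_prob A ξ ht

theorem size : Forced p γ (fun _ => size) fun _ _ => 0 where
  controlled _ _ := Controlled.size
  continuous _ := continuous_const
  hasDerivWithinAt ξ t _ := by
    rw [gen_size, add_zero]
    exact hasDerivWithinAt_const t _ _

theorem shift (hu : Forced p γ u σ) {h : ℝ} (hh : 0 ≤ h) :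
    Forced p γ (fun t => u (h + t)) fun t => σ (h + t) where
  controlled t ht := hu.controlled _ (add_nonneg hh ht)
  continuous ξ := (hu.continuous ξ).comp (continuous_const_add h)
  hasDerivWithinAt ξ t ht := by
    have hadd : HasDerivWithinAt (fun t => h + t) 1 (Set.Ici t) t :=
      ((hasDerivAt_id' t).const_add h).hasDerivWithinAt
    have hcomp := (hu.hasDerivWithinAt ξ (h + t) (add_nonneg hh ht)).scomp_of_eq t hadd
      (fun s hs => by simpa using hs) rfl
    rwa [one_smul] at hcomp

theorem nonpos (hu : Forced p γ u σ) {T C : ℝ} (hC : ∀ t ∈ Set.Icc 0 T, ∀ ξ, u t ξ ≤ C)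
    (h0 : ∀ ξ, u 0 ξ ≤ 0) (hσ : ∀ t, 0 ≤ t → ∀ ξ, σ t ξ ≤ 0) (hT : 0 ≤ T) (ξ : FinConfig d) :
    u T ξ ≤ 0 :=
  nonpos_of_le_gen (p := p) (γ := γ) hC (fun t ht => hu.controlled t ht.1)
    (fun ξ => (hu.continuous ξ).continuousOn) (fun ξ t ht => hu.hasDerivWithinAt ξ t ht.1) h0
    (fun ξ t ht => by linarith [hσ t ht.1 ξ]) T ⟨hT, le_rfl⟩ ξ

end Forced

end ForcedEquation

/-! ### Linear functions of the configuration -/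

section LinearFunctions

variable {p : PMF (Site d)} {γ : ℝ≥0}

/-- The sum of `f` over all particles of `ξ`. -/
def lin (f : Site d → ℝ) (ξ : FinConfig d) : ℝ := ξ.sum fun z n => n * f z

@[simp] theorem lin_zero (f : Site d → ℝ) : lin f 0 = 0 := Finsupp.sum_zero_index

theorem lin_add (f : Site d → ℝ) (ξ ζ : FinConfig d) : lin f (ξ + ζ) = lin f ξ + lin f ζ :=
  Finsupp.sum_add_index' (by simp) (by intros; push_cast; ring)

@[simp] theorem lin_single (f : Site d → ℝ) (z : Site d) : lin f (Finsupp.single z 1) = f z := by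
  rw [lin, Finsupp.sum_single_index] <;> simp

theorem lin_eq_sum (f : Site d → ℝ) (ξ : FinConfig d) : lin f ξ = ∑ z ∈ ξ.support, ξ z * f z := rfl

theorem lin_nonneg {f : Site d → ℝ} (hf : ∀ z, 0 ≤ f z) (ξ : FinConfig d) : 0 ≤ lin f ξ :=
  Finset.sum_nonneg fun z _ => mul_nonneg (Nat.cast_nonneg _) (hf z)

theorem lin_mono {f g : Site d → ℝ} (h : ∀ z, f z ≤ g z) (ξ : FinConfig d) : lin f ξ ≤ lin g ξ :=
  Finset.sum_le_sum fun z _ => mul_le_mul_of_nonneg_left (h z) (Nat.cast_nonneg _)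

theorem lin_const (c : ℝ) (ξ : FinConfig d) : lin (fun _ => c) ξ = size ξ * c := by
  rw [lin_eq_sum, ← Finset.sum_mul, sum_eq_size]

theorem lin_finsetSum {ι : Type*} (s : Finset ι) (f : ι → Site d → ℝ) (ξ : FinConfig d) :
    ∑ i ∈ s, lin (f i) ξ = lin (fun z => ∑ i ∈ s, f i z) ξ := by
  simp_rw [lin_eq_sum, Finset.mul_sum]
  exact Finset.sum_comm

theorem induction_add_single {α : Type*} {P : (α →₀ ℕ) → Prop} (zero : P 0)
    (add_single : ∀ ξ z, P ξ → P (ξ + Finsupp.single z 1)) (ξ : α →₀ ℕ) : P ξ := by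
  induction hn : Finsupp.degree ξ generalizing ξ with
  | zero => rwa [(Finsupp.degree_eq_zero_iff ξ).1 hn]
  | succ n ih =>
    have hξ : ξ ≠ 0 := fun h => by simp [h] at hn
    obtain ⟨z, hz⟩ := Finsupp.ne_iff.1 hξ
    have hdeg := degree_sub_single hz
    rw [← sub_single_add_single hz]
    exact add_single _ _ (ih _ (by omega))

theorem jump_add_single (ζ : FinConfig d) (w v : Site d) :
    jump (ζ + Finsupp.single w 1) w v = ζ + Finsupp.single (w + v) 1 := by
  rw [jump, add_tsub_cancel_right]

theorem jumpAt_of_affine {g c : FinConfig d → ℝ} {f : Site d → ℝ}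
    (hg : ∀ ζ y, g (ζ + Finsupp.single y 1) = g ζ + f y * c ζ) {ξ : FinConfig d} {w : Site d}
    (hw : ξ w ≠ 0) (hf : Integrable (fun v => f (w + v)) p.toMeasure) :
    jumpAt p g ξ w =
      ξ w * (c (ξ - Finsupp.single w 1) * (∫ v, f (w + v) ∂p.toMeasure - f w)) := by
  obtain ⟨ζ, rfl⟩ := exists_eq_add_single hw
  simp_rw [jumpAt, jump_add_single, hg, add_tsub_cancel_right]
  rw [integral_add (integrable_const _) (hf.mul_const _), integral_mul_const, integral_const,
    probReal_univ, one_smul]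
  ring

theorem integrable_kern {t : ℝ} (ht : 0 ≤ t) (x : Site d) (w : Site d) :
    Integrable (fun v => kern p t (x - (w + v))) p.toMeasure :=
  Integrable.of_bound (C := 1) (measurable_of_countable _).aestronglyMeasurable
    (Eventually.of_forall fun v => by
      rw [Real.norm_eq_abs, abs_of_nonneg (kern_nonneg ht _)]
      exact kern_le_one ht _)

theorem hasDerivAt_kern_sub (t : ℝ) (x w : Site d) : HasDerivAt (fun t => kern p t (x - w))
    (∫ v, kern p t (x - (w + v)) ∂p.toMeasure - kern p t (x - w)) t := by
  simpa [sub_sub] using hasDerivAt_kern (p := p) t (x - w)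

/-- The expected number of particles at `x` at time `t`. -/
def mean (p : PMF (Site d)) (x : Site d) (t : ℝ) (ξ : FinConfig d) : ℝ :=
  lin (fun z => kern p t (x - z)) ξ

theorem mean_nonneg (x : Site d) {t : ℝ} (ht : 0 ≤ t) (ξ : FinConfig d) : 0 ≤ mean p x t ξ :=
  lin_nonneg (fun _ => kern_nonneg ht _) ξ

theorem mean_le_size (x : Site d) {t : ℝ} (ht : 0 ≤ t) (ξ : FinConfig d) :
    mean p x t ξ ≤ size ξ := by
  simpa [mean, lin_const] using lin_mono (fun z => kern_le_one (p := p) ht (x - z)) ξ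

theorem mean_zero (x : Site d) (ξ : FinConfig d) : mean p x 0 ξ = ξ x := by
  rw [mean, lin_eq_sum, Finset.sum_eq_single x]
  · simp [kern_zero]
  · intro z _ hz
    rw [kern_zero, if_neg (by rwa [sub_eq_zero, eq_comm]), mul_zero]
  · intro hx
    simp [Finsupp.notMem_support_iff.1 hx]

theorem Forced.mean (x : Site d) : Forced p γ (mean p x) fun _ _ => 0 where
  controlled t ht := ⟨fun n => n, fun ξ => by
    rw [abs_of_nonneg (mean_nonneg x ht ξ)]
    exact mean_le_size x ht ξ⟩
  continuous ξ := continuous_finsetSum _ fun z _ => continuous_const.mul (continuous_kern _)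
  hasDerivWithinAt ξ t ht := by
    have hderiv : HasDerivAt (fun t => LonelyBRW.mean p x t ξ) (∑ z ∈ ξ.support, (ξ z : ℝ) *
        (∫ v, kern p t (x - (z + v)) ∂p.toMeasure - kern p t (x - z))) t :=
      HasDerivAt.fun_sum fun z _ => (hasDerivAt_kern_sub t x z).const_mul _
    refine hderiv.hasDerivWithinAt.congr_deriv ?_
    rw [add_zero, gen_eq_sum _ subset_rfl]
    have hg : ∀ ζ y, LonelyBRW.mean p x t (ζ + Finsupp.single y 1) =
        LonelyBRW.mean p x t ζ + kern p t (x - y) * 1 := fun ζ y => by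
      rw [LonelyBRW.mean, LonelyBRW.mean, lin_add, lin_single, mul_one]
    refine Finset.sum_congr rfl fun w hw => ?_
    rw [Finsupp.mem_support_iff] at hw
    rw [jumpAt_of_affine (c := fun _ => 1) hg hw (integrable_kern ht x w)]
    obtain ⟨ζ, rfl⟩ := exists_eq_add_single hw
    rw [branchAt_of_eq_add_single rfl, secondDiff, hg, hg]
    split_ifs <;> ring

end LinearFunctions

/-! ### Occupation probabilities -/

section Occupation

variable {p : PMF (Site d)} {γ : ℝ≥0}

/-- The probability that the site `x` is occupied at time `t`. -/
def occ (p : PMF (Site d)) (γ : ℝ≥0) (x : Site d) (t : ℝ) (ξ : FinConfig d) : ℝ :=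
  prob p γ {ξ | ξ x ≠ 0} t ξ

theorem occ_nonneg (x : Site d) (t : ℝ) (ξ : FinConfig d) : 0 ≤ occ p γ x t ξ := prob_nonneg _ _ _

theorem occ_le_one (x : Site d) (t : ℝ) (ξ : FinConfig d) : occ p γ x t ξ ≤ 1 := prob_le_one _ _ _

theorem Forced.occ (x : Site d) : Forced p γ (occ p γ x) fun _ _ => 0 := Forced.prob _

theorem prob_zero_config (A : Set (FinConfig d)) {t : ℝ} (ht : 0 ≤ t) :
    prob p γ A t 0 = A.indicator 1 0 := by
  have hrate : totalRate γ (0 : FinConfig d) = 0 := by simp [totalRate]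
  have hsum (g : FinConfig d → ℝ) : rateSumReal p γ g 0 = 0 := by simp [rateSumReal]
  rw [prob_eq A ht, hrate]
  simp [hsum]

theorem occ_add_le (x : Site d) {t : ℝ} (ht : 0 ≤ t) (ξ ζ : FinConfig d) :
    occ p γ x t (ξ + ζ) ≤ occ p γ x t ξ + occ p γ x t ζ := by
  have hsub := mixedDiff_prob_nonneg (p := p) (γ := γ) (A := {ξ : FinConfig d | ξ x ≠ 0})
    (fun h a b => by
      classical
      simp only [mixedDiff, Set.indicator_apply, Set.mem_ofPred_eq, Finsupp.add_apply, Pi.one_apply]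
      by_cases hh : h x = 0 <;> by_cases ha : a x = 0 <;> by_cases hb : b x = 0 <;>
        simp [hh, ha, hb]) ht 0 ξ ζ
  have hzero := occ_nonneg (p := p) (γ := γ) x t 0
  simp only [mixedDiff, zero_add] at hsub
  simp only [occ] at hzero ⊢
  linarith

theorem occ_le_lin (x : Site d) {t : ℝ} (ht : 0 ≤ t) (ξ : FinConfig d) :
    occ p γ x t ξ ≤ lin (fun z => occ p γ x t (Finsupp.single z 1)) ξ := by
  induction ξ using induction_add_single with
  | zero => simp [occ, prob_zero_config _ ht]
  | add_single ξ z ih =>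
    rw [lin_add, lin_single]
    exact (occ_add_le x ht _ _).trans (by gcongr)

theorem occ_zero_le_apply (x : Site d) (ξ : FinConfig d) : occ p γ x 0 ξ ≤ ξ x := by
  rw [occ, prob_zero]
  by_cases hx : ξ x = 0
  · simp [hx]
  · simpa [hx] using Nat.one_le_iff_ne_zero.2 hx

theorem occ_le_mean (x : Site d) {t : ℝ} (ht : 0 ≤ t) (ξ : FinConfig d) :
    occ p γ x t ξ ≤ mean p x t ξ := by
  have hdiff := ((Forced.occ (p := p) (γ := γ) x).sub (Forced.mean x)).nonpos (C := 1) (T := t)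
    (fun s hs ζ => by linarith [mean_nonneg (p := p) x hs.1 ζ, occ_le_one (p := p) (γ := γ) x s ζ])
    (fun ζ => by linarith [mean_zero (p := p) x ζ, occ_zero_le_apply (p := p) (γ := γ) x ζ])
    (fun _ _ _ => by simp) ht ξ
  exact sub_nonpos.1 hdiff

/-- The configuration `ξ` moved by `z`. -/
def translate (z : Site d) (ξ : FinConfig d) : FinConfig d := ξ.mapDomain (· + z)

theorem translate_add (z : Site d) (ξ ζ : FinConfig d) :
    translate z (ξ + ζ) = translate z ξ + translate z ζ := Finsupp.mapDomain_add

theorem translate_single (z w : Site d) :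
    translate z (Finsupp.single w 1) = Finsupp.single (w + z) 1 := Finsupp.mapDomain_single

theorem translate_apply_add (z w : Site d) (ξ : FinConfig d) : translate z ξ (w + z) = ξ w :=
  Finsupp.mapDomain_apply (add_left_injective z) ξ w

theorem support_translate (z : Site d) (ξ : FinConfig d) :
    (translate z ξ).support = ξ.support.map (addRightEmbedding z) := by
  classical
  rw [translate, Finsupp.mapDomain_support_of_injective (add_left_injective z),
    Finset.map_eq_image]
  rfl

theorem gen_translate (g : FinConfig d → ℝ) (z : Site d) (ξ : FinConfig d) :
    gen p γ (fun ζ => g (translate z ζ)) ξ = gen p γ g (translate z ξ) := by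
  rw [gen, gen, support_translate, Finset.sum_map]
  refine Finset.sum_congr rfl fun w hw => ?_
  obtain ⟨ζ, rfl⟩ := exists_eq_add_single (Finsupp.mem_support_iff.1 hw)
  simp only [jumpAt, branchAt, addRightEmbedding_apply, translate_apply_add, jump_add_single,
    add_tsub_cancel_right]
  simp only [translate_add, translate_single, jump_add_single, add_tsub_cancel_right,
    add_right_comm w z]

theorem prob_translate_le (A : Set (FinConfig d)) (z : Site d) {t : ℝ} (ht : 0 ≤ t)
    (ξ : FinConfig d) : prob p γ A t (translate z ξ) ≤ prob p γ (translate z ⁻¹' A) t ξ :=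
  le_prob_of_le_gen (u := fun t ξ => prob p γ A t (translate z ξ))
    (u' := fun t ξ => gen p γ (prob p γ A t) (translate z ξ)) (C := 1)
    (fun _ _ _ => prob_le_one _ _ _)
    (fun _ _ => Controlled.of_bounded 1 fun _ => abs_prob_le_one _ _ _)
    (fun _ => continuous_prob A _) (fun _ _ ht => hasDerivWithinAt_prob A _ ht)
    (fun _ => (prob_zero _ _).le) (fun ξ _ _ => (gen_translate _ z ξ).ge) ht ξ

theorem occ_single_le (x z : Site d) {t : ℝ} (ht : 0 ≤ t) :
    occ p γ x t (Finsupp.single z 1) ≤ occ p γ (x - z) t (Finsupp.single 0 1) := by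
  have hpre : translate z ⁻¹' {ξ | ξ x ≠ 0} = {ξ | ξ (x - z) ≠ 0} := by
    ext ξ
    rw [Set.mem_preimage, Set.mem_ofPred_eq, Set.mem_ofPred_eq, ← translate_apply_add z (x - z) ξ,
      sub_add_cancel]
  have hle := prob_translate_le (p := p) (γ := γ) {ξ | ξ x ≠ 0} z ht (Finsupp.single 0 1)
  rwa [translate_single, zero_add, hpre] at hle

/-- The expected number of occupied sites for the system started from one particle. -/
def occSum (p : PMF (Site d)) (γ : ℝ≥0) (t : ℝ) : ℝ≥0∞ :=
  ∑' x, ENNReal.ofReal (occ p γ x t (Finsupp.single 0 1))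

theorem occSum_le_one {t : ℝ} (ht : 0 ≤ t) : occSum p γ t ≤ 1 := by
  rw [← tsum_ofReal_kern (p := p) ht]
  refine ENNReal.tsum_le_tsum fun x => ENNReal.ofReal_le_ofReal ?_
  simpa [mean] using occ_le_mean (p := p) (γ := γ) x ht (Finsupp.single 0 1)

theorem occSum_ne_top {t : ℝ} (ht : 0 ≤ t) : occSum p γ t ≠ ∞ :=
  ((occSum_le_one ht).trans_lt ENNReal.one_lt_top).ne

theorem sum_occ_le {t : ℝ} (ht : 0 ≤ t) (X : Finset (Site d)) (ξ : FinConfig d) :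
    ∑ x ∈ X, occ p γ x t ξ ≤ size ξ * (occSum p γ t).toReal := by
  refine (Finset.sum_le_sum fun x _ => occ_le_lin x ht ξ).trans ?_
  rw [lin_finsetSum, ← lin_const]
  refine lin_mono (fun z => ?_) ξ
  refine (Finset.sum_le_sum fun x _ => occ_single_le x z ht).trans ?_
  rw [← ENNReal.ofReal_le_iff_le_toReal (occSum_ne_top ht),
    ENNReal.ofReal_sum_of_nonneg fun _ _ => occ_nonneg _ _ _, occSum,
    ← (Equiv.subRight z).tsum_eq]
  exact ENNReal.sum_le_tsum X (f := fun x => ENNReal.ofReal (occ p γ (x - z) t _))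

theorem sum_occ_add_le {h t : ℝ} (hh : 0 ≤ h) (ht : 0 ≤ t) (X : Finset (Site d))
    (ξ : FinConfig d) :
    ∑ x ∈ X, occ p γ x (h + t) ξ ≤ (occSum p γ h).toReal * size ξ := by
  have hdiff := ((Forced.sum (s := X) fun x _ => (Forced.occ (p := p) (γ := γ) x).shift hh).sub
    (Forced.size.const_mul (occSum p γ h).toReal)).nonpos (C := X.card) (T := t)
    (fun s _ ζ => by
      have hcard := Finset.sum_le_card_nsmul X (fun x => occ p γ x (h + s) ζ) 1
        fun _ _ => occ_le_one _ _ _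
      have hsize : 0 ≤ (occSum p γ h).toReal * size ζ :=
        mul_nonneg ENNReal.toReal_nonneg (size_nonneg ζ)
      rw [nsmul_eq_mul, mul_one] at hcard
      linarith)
    (fun ζ => by
      rw [sub_nonpos, mul_comm]
      simpa only [add_zero] using sum_occ_le hh X ζ) (fun _ _ _ => by simp) ht ξ
  exact sub_nonpos.1 hdiff

theorem occSum_add_le {h t : ℝ} (hh : 0 ≤ h) (ht : 0 ≤ t) :
    occSum p γ (h + t) ≤ occSum p γ h := by
  rw [← ENNReal.ofReal_toReal (occSum_ne_top hh), occSum, ENNReal.tsum_eq_iSup_sum]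
  refine iSup_le fun X => ?_
  rw [← ENNReal.ofReal_sum_of_nonneg fun _ _ => occ_nonneg _ _ _]
  refine ENNReal.ofReal_le_ofReal ?_
  simpa using sum_occ_add_le (p := p) (γ := γ) hh ht X (Finsupp.single 0 1)

end Occupation

/-! ### Thinned configurations -/

section RemoveSum

/-- The sum of `c (ξ - δ_w) * f w` over all particles of `ξ`, where `w` is the site of the
particle. -/
def removeSum (f : Site d → ℝ) (c : FinConfig d → ℝ) (ξ : FinConfig d) : ℝ :=
  ξ.sum fun w n => n * (c (ξ - Finsupp.single w 1) * f w)

theorem removeSum_eq (f : Site d → ℝ) (c : FinConfig d → ℝ) (ξ : FinConfig d) :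
    removeSum f c ξ = ∑ w ∈ ξ.support, (ξ w : ℝ) * (c (ξ - Finsupp.single w 1) * f w) := rfl

@[simp] theorem removeSum_zero (f : Site d → ℝ) (c : FinConfig d → ℝ) : removeSum f c 0 = 0 :=
  Finsupp.sum_zero_index

theorem removeSum_add_single (f : Site d → ℝ) (c : FinConfig d → ℝ) (ζ : FinConfig d)
    (y : Site d) : removeSum f c (ζ + Finsupp.single y 1) =
      removeSum f (fun ξ => c (ξ + Finsupp.single y 1)) ζ + c ζ * f y := by
  rw [removeSum, Finsupp.sum_add_index' (by simp) (by intros; push_cast; ring),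
    Finsupp.sum_single_index (by simp), add_tsub_cancel_right, Nat.cast_one, one_mul]
  congr 1
  refine Finsupp.sum_congr fun w hw => ?_
  have hle : Finsupp.single w 1 ≤ ζ :=
    Finsupp.single_le_iff.2 (Nat.one_le_iff_ne_zero.2 (Finsupp.mem_support_iff.1 hw))
  simp only [tsub_add_eq_add_tsub hle]

theorem removeSum_linear (f : Site d → ℝ) (c c' : FinConfig d → ℝ) (r s : ℝ) (ξ : FinConfig d) :
    removeSum f (fun ξ => r * c ξ + s * c' ξ) ξ = r * removeSum f c ξ + s * removeSum f c' ξ := by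
  rw [removeSum_eq, removeSum_eq, removeSum_eq, Finset.mul_sum, Finset.mul_sum,
    ← Finset.sum_add_distrib]
  exact Finset.sum_congr rfl fun w _ => by ring

end RemoveSum

section Thinning

/-- The probability that no particle of `ξ` is selected when each particle is selected
independently, with probability `a y` for a particle at `y`. -/
def thin (a : Site d → ℝ) (ξ : FinConfig d) : ℝ := ξ.prod fun y n => (1 - a y) ^ n

/-- The probability that exactly one particle of `ξ` is selected. -/
def thinOne (a : Site d → ℝ) (ξ : FinConfig d) : ℝ := removeSum a (thin a) ξ

variable {a : Site d → ℝ}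

@[simp] theorem thin_zero : thin a (0 : FinConfig d) = 1 := Finsupp.prod_zero_index

@[simp] theorem thinOne_zero : thinOne a (0 : FinConfig d) = 0 := removeSum_zero _ _

theorem thin_add_single (ζ : FinConfig d) (y : Site d) :
    thin a (ζ + Finsupp.single y 1) = thin a ζ + a y * -thin a ζ := by
  rw [thin, Finsupp.prod_add_index' (by simp) (fun _ _ _ => pow_add _ _ _),
    Finsupp.prod_single_index (by simp), ← thin]
  ring

theorem thinOne_add_single (ζ : FinConfig d) (y : Site d) :
    thinOne a (ζ + Finsupp.single y 1) = thinOne a ζ + a y * (thin a ζ - thinOne a ζ) := by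
  have hthin : (fun ξ => thin a (ξ + Finsupp.single y 1)) =
      fun ξ => (1 - a y) * thin a ξ + 0 * thin a ξ := by
    ext ξ
    rw [thin_add_single]
    ring
  rw [thinOne, removeSum_add_single, hthin, removeSum_linear, ← thinOne]
  ring

theorem thin_nonneg (ha : ∀ y, a y ≤ 1) (ξ : FinConfig d) : 0 ≤ thin a ξ :=
  Finset.prod_nonneg fun y _ => pow_nonneg (sub_nonneg.2 (ha y)) _

theorem thinOne_nonneg (ha0 : ∀ y, 0 ≤ a y) (ha : ∀ y, a y ≤ 1) (ξ : FinConfig d) :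
    0 ≤ thinOne a ξ :=
  Finset.sum_nonneg fun y _ =>
    mul_nonneg (Nat.cast_nonneg _) (mul_nonneg (thin_nonneg ha _) (ha0 y))

theorem thinOne_add_thin_le_one (ha0 : ∀ y, 0 ≤ a y) (ha : ∀ y, a y ≤ 1) (ξ : FinConfig d) :
    thinOne a ξ + thin a ξ ≤ 1 := by
  induction ξ using induction_add_single with
  | zero => simp
  | add_single ζ y ih =>
    have hmul := mul_nonneg (ha0 y) (thinOne_nonneg ha0 ha ζ)
    rw [thinOne_add_single, thin_add_single]
    linarith

theorem thinOne_le_one (ha0 : ∀ y, 0 ≤ a y) (ha : ∀ y, a y ≤ 1) (ξ : FinConfig d) :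
    thinOne a ξ ≤ 1 := by
  linarith [thinOne_add_thin_le_one ha0 ha ξ, thin_nonneg ha ξ]

theorem thin_le_one (ha0 : ∀ y, 0 ≤ a y) (ha : ∀ y, a y ≤ 1) (ξ : FinConfig d) : thin a ξ ≤ 1 := by
  linarith [thinOne_add_thin_le_one ha0 ha ξ, thinOne_nonneg ha0 ha ξ]

theorem thin_le_thin_sub_single (ha0 : ∀ y, 0 ≤ a y) (ha : ∀ y, a y ≤ 1) {ξ : FinConfig d}
    {w : Site d} (hw : ξ w ≠ 0) : thin a ξ ≤ thin a (ξ - Finsupp.single w 1) := by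
  obtain ⟨ζ, rfl⟩ := exists_eq_add_single hw
  rw [add_tsub_cancel_right, thin_add_single]
  linarith [mul_nonneg (ha0 w) (thin_nonneg ha ζ)]

theorem lin_mul_thin_le_thinOne (ha0 : ∀ y, 0 ≤ a y) (ha : ∀ y, a y ≤ 1) (ξ : FinConfig d) :
    lin a ξ * thin a ξ ≤ thinOne a ξ := by
  rw [lin_eq_sum, thinOne, removeSum_eq, Finset.sum_mul]
  refine Finset.sum_le_sum fun w hw => ?_
  rw [mul_assoc, mul_comm (a w)]
  have hthin := thin_le_thin_sub_single ha0 ha (Finsupp.mem_support_iff.1 hw)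
  exact mul_le_mul_of_nonneg_left (mul_le_mul_of_nonneg_right hthin (ha0 w)) (Nat.cast_nonneg _)

theorem exp_neg_mul_lin_le_thin {C : ℝ} (h : ∀ y, Real.exp (-(C * a y)) ≤ 1 - a y)
    (ξ : FinConfig d) : Real.exp (-(C * lin a ξ)) ≤ thin a ξ := by
  induction ξ using induction_add_single with
  | zero => simp
  | add_single ζ y ih =>
    calc Real.exp (-(C * lin a (ζ + Finsupp.single y 1)))
        = Real.exp (-(C * lin a ζ)) * Real.exp (-(C * a y)) := by
          rw [lin_add, lin_single, ← Real.exp_add, mul_add, neg_add]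
      _ ≤ thin a ζ * (1 - a y) :=
          mul_le_mul ih (h y) (Real.exp_nonneg _) ((Real.exp_nonneg _).trans ih)
      _ = thin a (ζ + Finsupp.single y 1) := by rw [thin_add_single]; ring

theorem exp_neg_mul_le_one_sub {α r : ℝ} (hα : α < 1) (hr0 : 0 ≤ r) (hr : r ≤ α) :
    Real.exp (-(1 / (1 - α) * r)) ≤ 1 - r := by
  have : 0 < 1 - α := sub_pos.2 hα
  have hr' : 0 < 1 - r := sub_pos.2 (hr.trans_lt hα)
  rw [Real.exp_neg, inv_le_comm₀ (Real.exp_pos _) hr']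
  calc (1 - r)⁻¹ = 1 / (1 - r) * r + 1 := by field_simp; ring
    _ ≤ 1 / (1 - α) * r + 1 := by gcongr
    _ ≤ Real.exp (1 / (1 - α) * r) := Real.add_one_le_exp _

theorem branchAt_thinOne (ξ : FinConfig d) (w : Site d) : branchAt (thinOne a) ξ w =
    if ξ w = 1 then a w ^ 2 * (thinOne a (ξ - Finsupp.single w 1) -
      2 * thin a (ξ - Finsupp.single w 1)) else 0 := by
  by_cases hw : ξ w = 1
  · obtain ⟨ζ, rfl⟩ := exists_eq_add_single (ξ := ξ) (w := w) (by omega)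
    rw [branchAt, if_pos hw, if_pos hw, add_tsub_cancel_right]
    simp only [thin_add_single, thinOne_add_single]
    ring
  · rw [branchAt_of_apply_ne_one hw, if_neg hw]

theorem branchAt_thin (ξ : FinConfig d) (w : Site d) : branchAt (thin a) ξ w =
    if ξ w = 1 then a w ^ 2 * thin a (ξ - Finsupp.single w 1) else 0 := by
  by_cases hw : ξ w = 1
  · obtain ⟨ζ, rfl⟩ := exists_eq_add_single (ξ := ξ) (w := w) (by omega)
    rw [branchAt, if_pos hw, if_pos hw, add_tsub_cancel_right]
    simp only [thin_add_single]
    ring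
  · rw [branchAt_of_apply_ne_one hw, if_neg hw]

theorem hasDerivAt_thin {a : ℝ → Site d → ℝ} {a' : Site d → ℝ} {t : ℝ}
    (h : ∀ y, HasDerivAt (fun t => a t y) (a' y) t) (ξ : FinConfig d) :
    HasDerivAt (fun t => thin (a t) ξ) (removeSum a' (fun ζ => -thin (a t) ζ) ξ) t := by
  induction ξ using induction_add_single with
  | zero => simpa using hasDerivAt_const t (1 : ℝ)
  | add_single ζ y ih =>
    have hthin : (fun ξ => -thin (a t) (ξ + Finsupp.single y 1)) =
        fun ξ => (1 - a t y) * -thin (a t) ξ + 0 * thin (a t) ξ := by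
      ext ξ
      rw [thin_add_single]
      ring
    simp_rw [thin_add_single]
    refine (ih.add ((h y).mul ih.neg)).congr_deriv ?_
    rw [removeSum_add_single, hthin, removeSum_linear, Pi.neg_apply]
    ring

theorem hasDerivAt_thinOne {a : ℝ → Site d → ℝ} {a' : Site d → ℝ} {t : ℝ}
    (h : ∀ y, HasDerivAt (fun t => a t y) (a' y) t) (ξ : FinConfig d) :
    HasDerivAt (fun t => thinOne (a t) ξ)
      (removeSum a' (fun ζ => thin (a t) ζ - thinOne (a t) ζ) ξ) t := by
  induction ξ using induction_add_single with
  | zero => simpa using hasDerivAt_const t (0 : ℝ)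
  | add_single ζ y ih =>
    have hdiff : (fun ξ => thin (a t) (ξ + Finsupp.single y 1) -
        thinOne (a t) (ξ + Finsupp.single y 1)) =
        fun ξ => (1 - a t y) * (thin (a t) ξ - thinOne (a t) ξ) + a t y * -thin (a t) ξ := by
      ext ξ
      rw [thin_add_single, thinOne_add_single]
      ring
    simp_rw [thinOne_add_single]
    refine (ih.add ((h y).mul ((hasDerivAt_thin h ζ).sub ih))).congr_deriv ?_
    rw [removeSum_add_single, hdiff, removeSum_linear, Pi.sub_apply]
    ring

end Thinning

section ThinnedWalks

variable {p : PMF (Site d)} {γ : ℝ≥0}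

/-- The probability that a walk from `y` is at `x` at time `t` and is then selected with
probability `θ`. -/
def hit (p : PMF (Site d)) (θ : ℝ) (x : Site d) (t : ℝ) (y : Site d) : ℝ := θ * kern p t (x - y)

theorem hit_nonneg {θ : ℝ} (hθ : 0 ≤ θ) (x : Site d) {t : ℝ} (ht : 0 ≤ t) (y : Site d) :
    0 ≤ hit p θ x t y := mul_nonneg hθ (kern_nonneg ht _)

theorem hit_le {θ : ℝ} (hθ : 0 ≤ θ) (x : Site d) {t : ℝ} (ht : 0 ≤ t) (y : Site d) :
    hit p θ x t y ≤ θ := mul_le_of_le_one_right hθ (kern_le_one ht _)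

theorem hit_le_one {θ : ℝ} (hθ0 : 0 ≤ θ) (hθ : θ ≤ 1) (x : Site d) {t : ℝ} (ht : 0 ≤ t)
    (y : Site d) : hit p θ x t y ≤ 1 := (hit_le hθ0 x ht y).trans hθ

theorem hit_zero (x y : Site d) (θ : ℝ) : hit p θ x 0 y = if y = x then θ else 0 := by
  rw [hit, kern_zero]
  simp [sub_eq_zero, eq_comm]

theorem lin_hit (θ : ℝ) (x : Site d) (t : ℝ) (ξ : FinConfig d) :
    lin (hit p θ x t) ξ = θ * mean p x t ξ := by
  rw [mean, lin_eq_sum, lin_eq_sum, Finset.mul_sum]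
  exact Finset.sum_congr rfl fun z _ => by rw [hit]; ring

theorem hasDerivAt_hit (θ : ℝ) (x : Site d) (t : ℝ) (y : Site d) :
    HasDerivAt (fun t => hit p θ x t y)
      (θ * (∫ v, kern p t (x - (y + v)) ∂p.toMeasure - kern p t (x - y))) t :=
  (hasDerivAt_kern_sub t x y).const_mul θ

theorem Forced.of_affine {θ : ℝ} {x : Site d} {g c : ℝ → FinConfig d → ℝ}
    (hg : ∀ t ζ y, g t (ζ + Finsupp.single y 1) = g t ζ + hit p θ x t y * c t ζ)
    (hcontr : ∀ t, 0 ≤ t → Controlled (g t))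
    (hder : ∀ t ξ, HasDerivAt (fun t => g t ξ) (removeSum (fun y =>
      θ * (∫ v, kern p t (x - (y + v)) ∂p.toMeasure - kern p t (x - y))) (c t) ξ) t) :
    Forced p γ g fun t ξ => -(γ / 2 * ∑ w ∈ ξ.support, branchAt (g t) ξ w) where
  controlled := hcontr
  continuous ξ := continuous_iff_continuousAt.2 fun t => (hder t ξ).continuousAt
  hasDerivWithinAt ξ t ht := by
    refine (hder t ξ).hasDerivWithinAt.congr_deriv ?_
    rw [gen_eq_sum _ subset_rfl, Finset.sum_add_distrib, Finset.mul_sum, add_neg_cancel_right,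
      removeSum_eq]
    refine Finset.sum_congr rfl fun w hw => ?_
    rw [jumpAt_of_affine (hg t) (Finsupp.mem_support_iff.1 hw)
      ((integrable_kern ht x w).const_mul θ)]
    simp only [hit]
    rw [integral_const_mul, mul_sub]

theorem Forced.thin {θ : ℝ} (hθ0 : 0 ≤ θ) (hθ : θ ≤ 1) (x : Site d) :
    Forced p γ (fun t => thin (hit p θ x t))
      fun t ξ => -(γ / 2 * ∑ w ∈ ξ.support, branchAt (thin (hit p θ x t)) ξ w) :=
  Forced.of_affine (θ := θ) (x := x) (fun _ => thin_add_single)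
    (fun t ht => Controlled.of_bounded 1 fun ξ => by
      have hle := hit_le_one (p := p) hθ0 hθ x ht
      rw [abs_of_nonneg (thin_nonneg hle ξ)]
      exact thin_le_one (hit_nonneg hθ0 x ht) hle ξ)
    fun t => hasDerivAt_thin (hasDerivAt_hit θ x t)

theorem Forced.thinOne {θ : ℝ} (hθ0 : 0 ≤ θ) (hθ : θ ≤ 1) (x : Site d) :
    Forced p γ (fun t => thinOne (hit p θ x t))
      fun t ξ => -(γ / 2 * ∑ w ∈ ξ.support, branchAt (thinOne (hit p θ x t)) ξ w) :=
  Forced.of_affine (θ := θ) (x := x) (fun _ => thinOne_add_single)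
    (fun t ht => Controlled.of_bounded 1 fun ξ => by
      have hnonneg := hit_nonneg (p := p) hθ0 x ht
      have hle := hit_le_one (p := p) hθ0 hθ x ht
      rw [abs_of_nonneg (thinOne_nonneg hnonneg hle ξ)]
      exact thinOne_le_one hnonneg hle ξ)
    fun t => hasDerivAt_thinOne (hasDerivAt_hit θ x t)

end ThinnedWalks

section Lone

variable {p : PMF (Site d)} {γ : ℝ≥0}

/-- The probability that there is exactly one particle at `x` at time `t`. -/
def lone (p : PMF (Site d)) (γ : ℝ≥0) (x : Site d) (t : ℝ) (ξ : FinConfig d) : ℝ :=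
  prob p γ {ξ | ξ x = 1} t ξ

theorem lone_nonneg (x : Site d) (t : ℝ) (ξ : FinConfig d) : 0 ≤ lone p γ x t ξ := prob_nonneg _ _ _

theorem Forced.lone (x : Site d) : Forced p γ (lone p γ x) fun _ _ => 0 := Forced.prob _

theorem thinOne_hit_one_zero_of_ne {x : Site d} {ζ : FinConfig d} (h : ζ x ≠ 1) :
    thinOne (hit p 1 x 0) ζ = 0 := by
  rw [thinOne, removeSum_eq]
  refine Finset.sum_eq_zero fun w hw => ?_
  rw [hit_zero]
  split_ifs with hwx
  · subst hwx
    have hw0 := Finsupp.mem_support_iff.1 hw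
    have hrest : (ζ - Finsupp.single w 1 : FinConfig d) w ≠ 0 := by
      rw [Finsupp.tsub_apply, Finsupp.single_eq_same]
      omega
    obtain ⟨ζ', hζ'⟩ := exists_eq_add_single hrest
    rw [hζ', thin_add_single, hit_zero]
    simp
  · simp

theorem thinOne_hit_one_zero_le_lone (x : Site d) (ζ : FinConfig d) :
    thinOne (hit p 1 x 0) ζ ≤ lone p γ x 0 ζ := by
  rw [lone, prob_zero]
  by_cases h : ζ x = 1
  · simpa [h] using thinOne_le_one (hit_nonneg (p := p) zero_le_one x le_rfl)
      (hit_le zero_le_one x le_rfl) ζ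
  · simp [h, thinOne_hit_one_zero_of_ne h]

theorem neg_two_mul_thinOne_le_sum_branchAt {a : Site d → ℝ} (ha0 : ∀ y, 0 ≤ a y)
    (ha : ∀ y, a y ≤ 1) (ζ : FinConfig d) :
    -(2 * thinOne a ζ) ≤ ∑ w ∈ ζ.support, branchAt (thinOne a) ζ w := by
  rw [thinOne, removeSum_eq, Finset.mul_sum, ← Finset.sum_neg_distrib]
  refine Finset.sum_le_sum fun w _ => ?_
  have hthin := thin_nonneg ha (ζ - Finsupp.single w 1)
  rw [branchAt_thinOne]
  split_ifs with hw
  · have hsq : a w ^ 2 * thin a (ζ - Finsupp.single w 1) ≤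
        a w * thin a (ζ - Finsupp.single w 1) :=
      mul_le_mul_of_nonneg_right (pow_le_of_le_one (ha0 w) (ha w) two_ne_zero) hthin
    have hone := mul_nonneg (sq_nonneg (a w)) (thinOne_nonneg ha0 ha (ζ - Finsupp.single w 1))
    rw [hw, Nat.cast_one]
    linarith
  · have hterm := mul_nonneg (Nat.cast_nonneg (α := ℝ) (ζ w)) (mul_nonneg hthin (ha0 w))
    linarith

/- At rate at most `γ` a lone selected particle branches, so following the selected particle costs
at most a factor `exp (-γ t)`. -/
theorem thinOne_le_lone (x : Site d) {t : ℝ} (ht : 0 ≤ t) (ξ : FinConfig d) :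
    Real.exp (-(γ * t)) * thinOne (hit p 1 x t) ξ ≤ lone p γ x t ξ := by
  have hexp (s : ℝ) : HasDerivAt (fun s : ℝ => Real.exp (-(γ * s)))
      (-γ * Real.exp (-(γ * s))) s :=
    ((hasDerivAt_id' s).const_mul (γ : ℝ)).fun_neg.exp.congr_deriv (by ring)
  have hforced := ((Forced.thinOne (p := p) (γ := γ) zero_le_one le_rfl x).mul_fun
    (c := fun s => Real.exp (-(γ * s))) (by fun_prop)
    fun s _ => (hexp s).hasDerivWithinAt).sub (Forced.lone x)
  refine sub_nonpos.1 (hforced.nonpos (C := 1) (T := t) ?_ ?_ ?_ ht ξ)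
  · intro s hs ζ
    have hle : Real.exp (-(γ * s)) ≤ 1 :=
      Real.exp_le_one_iff.2 (neg_nonpos.2 (mul_nonneg γ.coe_nonneg hs.1))
    have hmul := mul_le_one₀ hle
      (thinOne_nonneg (hit_nonneg (p := p) zero_le_one x hs.1) (hit_le zero_le_one x hs.1) ζ)
      (thinOne_le_one (hit_nonneg zero_le_one x hs.1) (hit_le zero_le_one x hs.1) ζ)
    linarith [lone_nonneg (p := p) (γ := γ) x s ζ]
  · intro ζ
    simpa using thinOne_hit_one_zero_le_lone x ζ
  · intro s hs ζ
    have hbranch := neg_two_mul_thinOne_le_sum_branchAt (hit_nonneg (p := p) zero_le_one x hs)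
      (hit_le zero_le_one x hs) ζ
    have hfactor : 0 ≤ (γ : ℝ) / 2 * Real.exp (-(γ * s)) := by positivity
    linarith [mul_le_mul_of_nonneg_left hbranch hfactor]

theorem exp_mul_mean_le_lone {α : ℝ} (hα : α < 1) (hk : ∀ z, kern p 1 z ≤ α) {K : ℝ}
    {x : Site d} {ζ : FinConfig d} (hK : mean p x 1 ζ ≤ K) :
    Real.exp (-γ) * Real.exp (-(1 / (1 - α) * K)) * mean p x 1 ζ ≤ lone p γ x 1 ζ := by
  have hnonneg := hit_nonneg (p := p) zero_le_one x zero_le_one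
  have hle := hit_le (p := p) zero_le_one x zero_le_one
  have hmean := mean_nonneg (p := p) x zero_le_one ζ
  have hthin : Real.exp (-(1 / (1 - α) * mean p x 1 ζ)) ≤ thin (hit p 1 x 1) ζ := by
    simpa [lin_hit] using exp_neg_mul_lin_le_thin (a := hit p 1 x 1) (C := 1 / (1 - α)) (fun y =>
      exp_neg_mul_le_one_sub hα (hnonneg y) (by simpa [hit] using hk (x - y))) ζ
  have : 0 < 1 - α := sub_pos.2 hα
  calc Real.exp (-γ) * Real.exp (-(1 / (1 - α) * K)) * mean p x 1 ζ
      ≤ Real.exp (-γ) * Real.exp (-(1 / (1 - α) * mean p x 1 ζ)) * mean p x 1 ζ := by gcongr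
    _ ≤ Real.exp (-γ) * thin (hit p 1 x 1) ζ * mean p x 1 ζ := by gcongr
    _ = Real.exp (-γ) * (lin (hit p 1 x 1) ζ * thin (hit p 1 x 1) ζ) := by rw [lin_hit]; ring
    _ ≤ Real.exp (-γ) * thinOne (hit p 1 x 1) ζ := by
        gcongr
        exact lin_mul_thin_le_thinOne hnonneg hle ζ
    _ ≤ lone p γ x 1 ζ := by simpa using thinOne_le_lone (p := p) (γ := γ) x zero_le_one ζ

theorem mul_occ_sub_mean_le_lone_one {α : ℝ} (hα : α < 1) (hk : ∀ z, kern p 1 z ≤ α) {K : ℝ}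
    (hK : 0 < K) (x : Site d) (ζ : FinConfig d) :
    Real.exp (-γ) * Real.exp (-(1 / (1 - α) * K)) * (occ p γ x 1 ζ - K⁻¹ * mean p x 1 ζ) ≤
      lone p γ x 1 ζ := by
  have hmean := mean_nonneg (p := p) x zero_le_one ζ
  rcases le_total K (mean p x 1 ζ) with hlarge | hsmall
  · have hone : 1 ≤ K⁻¹ * mean p x 1 ζ := (one_le_inv_mul₀ hK).2 hlarge
    have hocc := occ_le_one (p := p) (γ := γ) x 1 ζ
    exact (mul_nonpos_of_nonneg_of_nonpos (by positivity) (by linarith)).trans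
      (lone_nonneg x 1 ζ)
  · have hocc := occ_le_mean (p := p) (γ := γ) x zero_le_one ζ
    have hdiv : 0 ≤ K⁻¹ * mean p x 1 ζ := by positivity
    exact (mul_le_mul_of_nonneg_left (by linarith) (by positivity)).trans
      (exp_mul_mean_le_lone hα hk hsmall)

/- The case `t = 1` propagates to later times since both sides solve the backward equation. -/
theorem exists_occ_sub_mean_le_lone {α : ℝ} (hα : α < 1) (hk : ∀ z, kern p 1 z ≤ α) {K : ℝ}
    (hK : 0 < K) : ∃ c > 0, ∀ (x : Site d) (t : ℝ), 1 ≤ t → ∀ ξ,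
      c * (occ p γ x t ξ - mean p x t ξ / K) ≤ lone p γ x t ξ := by
  refine ⟨Real.exp (-γ) * Real.exp (-(1 / (1 - α) * K)), by positivity, fun x t ht ξ => ?_⟩
  set c := Real.exp (-γ) * Real.exp (-(1 / (1 - α) * K))
  have : 0 < c := by positivity
  have hforced := ((((Forced.occ (p := p) (γ := γ) x).sub
    ((Forced.mean x).const_mul K⁻¹)).const_mul c).sub (Forced.lone x)).shift zero_le_one
  have hnonpos := hforced.nonpos (C := c) (T := t - 1) ?_ ?_ (fun _ _ _ => by simp)
    (sub_nonneg.2 ht) ξ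
  · simpa only [add_sub_cancel, sub_nonpos, inv_mul_eq_div] using hnonpos
  · intro s hs ζ
    have hs' : 0 ≤ 1 + s := add_nonneg zero_le_one hs.1
    have hmean : 0 ≤ K⁻¹ * mean p x (1 + s) ζ :=
      mul_nonneg (inv_nonneg.2 hK.le) (mean_nonneg x hs' ζ)
    have hle : c * (occ p γ x (1 + s) ζ - K⁻¹ * mean p x (1 + s) ζ) ≤ c * 1 := by
      gcongr
      linarith [occ_le_one (p := p) (γ := γ) x (1 + s) ζ]
    linarith [lone_nonneg (p := p) (γ := γ) x (1 + s) ζ]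
  · intro ζ
    rw [add_zero]
    exact sub_nonpos.2 (mul_occ_sub_mean_le_lone_one hα hk hK x ζ)

end Lone

/-! ### The cost of lonely particles -/

section Integral

variable {p : PMF (Site d)} {γ : ℝ≥0} {μ : Measure ℝ} {G : ℝ → FinConfig d → ℝ} {b : ℝ → ℝ}

theorem integrable_branchAt (hG : ∀ ζ, Integrable (fun r => G r ζ) μ) (ξ : FinConfig d)
    (w : Site d) : Integrable (fun r => branchAt (G r) ξ w) μ := by
  simp only [branchAt]
  split_ifs
  · exact ((hG _).add (hG _)).sub ((hG ξ).const_mul 2)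
  · exact integrable_zero _ _ _

theorem branchAt_integral (hG : ∀ ζ, Integrable (fun r => G r ζ) μ) (ξ : FinConfig d)
    (w : Site d) : branchAt (fun ζ => ∫ r, G r ζ ∂μ) ξ w = ∫ r, branchAt (G r) ξ w ∂μ := by
  simp only [branchAt]
  split_ifs
  · have hadd : Integrable
        (fun r => G r (ξ + Finsupp.single w 1) + G r (ξ - Finsupp.single w 1)) μ :=
      (hG _).add (hG _)
    rw [integral_sub hadd ((hG ξ).const_mul 2), integral_add (hG _) (hG _), integral_const_mul]
  · rw [integral_zero]

theorem integrable_apply (hG : ∀ ζ, Measurable fun r => G r ζ) (hb : ∀ r ζ, |G r ζ| ≤ b r)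
    (hbi : Integrable b μ) (ζ : FinConfig d) : Integrable (fun r => G r ζ) μ :=
  hbi.mono' (hG ζ).aestronglyMeasurable (Eventually.of_forall fun r => hb r ζ)

theorem integrable_uncurry_jump (hG : ∀ ζ, Measurable fun r => G r ζ)
    (hb : ∀ r ζ, |G r ζ| ≤ b r) (hbi : Integrable b μ) (ξ : FinConfig d) (w : Site d) :
    Integrable (Function.uncurry fun r v => G r (jump ξ w v)) (μ.prod p.toMeasure) :=
  (hbi.comp_fst p.toMeasure).mono' (measurable_from_prod_countable_left
    fun v => hG (jump ξ w v)).aestronglyMeasurable (Eventually.of_forall fun _ => hb _ _)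

theorem integrable_jumpAt (hG : ∀ ζ, Measurable fun r => G r ζ)
    (hb : ∀ r ζ, |G r ζ| ≤ b r) (hbi : Integrable b μ) (ξ : FinConfig d) (w : Site d) :
    Integrable (fun r => jumpAt p (G r) ξ w) μ :=
  ((integrable_uncurry_jump hG hb hbi ξ w).integral_prod_left.sub
    (integrable_apply hG hb hbi ξ)).const_mul _

variable [SFinite μ]

theorem jumpAt_integral (hG : ∀ ζ, Measurable fun r => G r ζ)
    (hb : ∀ r ζ, |G r ζ| ≤ b r) (hbi : Integrable b μ) (ξ : FinConfig d) (w : Site d) :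
    jumpAt p (fun ζ => ∫ r, G r ζ ∂μ) ξ w = ∫ r, jumpAt p (G r) ξ w ∂μ := by
  have hjump := integrable_uncurry_jump (p := p) hG hb hbi ξ w
  have hinner : Integrable (fun r => ∫ v, G r (jump ξ w v) ∂p.toMeasure) μ :=
    hjump.integral_prod_left
  simp only [jumpAt]
  rw [← integral_integral_swap hjump, integral_const_mul,
    integral_sub hinner (integrable_apply hG hb hbi ξ)]

theorem gen_integral (hG : ∀ ζ, Measurable fun r => G r ζ) (hb : ∀ r ζ, |G r ζ| ≤ b r)
    (hbi : Integrable b μ) (ξ : FinConfig d) :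
    gen p γ (fun ζ => ∫ r, G r ζ ∂μ) ξ = ∫ r, gen p γ (G r) ξ ∂μ := by
  have hjump := integrable_jumpAt (p := p) hG hb hbi ξ
  have hbranch (w : Site d) : Integrable (fun r => γ / 2 * branchAt (G r) ξ w) μ :=
    (integrable_branchAt (integrable_apply hG hb hbi) ξ w).const_mul _
  have hterm (w : Site d) :
      Integrable (fun r => jumpAt p (G r) ξ w + γ / 2 * branchAt (G r) ξ w) μ :=
    (hjump w).add (hbranch w)
  simp only [gen]
  rw [integral_finsetSum _ fun w _ => hterm w]
  refine Finset.sum_congr rfl fun w _ => ?_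
  rw [integral_add (hjump w) (hbranch w), integral_const_mul, jumpAt_integral hG hb hbi,
    branchAt_integral (integrable_apply hG hb hbi)]

end Integral

section Convolution

variable {p : PMF (Site d)} {γ : ℝ≥0}

theorem prob_eq_add_integral (A : Set (FinConfig d)) (ξ : FinConfig d) {s : ℝ} (hs : 0 ≤ s) :
    prob p γ A s ξ = prob p γ A 0 ξ + ∫ τ in (0 : ℝ)..s, gen p γ (prob p γ A τ) ξ := by
  rw [intervalIntegral.integral_eq_sub_of_hasDeriv_right_of_le hs
    (continuous_prob A ξ).continuousOn
    (fun r hr => (hasDerivWithinAt_prob A ξ hr.1.le).mono Set.Ioi_subset_Ici_self)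
    ((continuous_gen_prob A ξ).intervalIntegrable _ _)]
  ring

theorem abs_mul_prob_le (c : ℝ) (A : Set (FinConfig d)) (t : ℝ) (ξ : FinConfig d) :
    |c * prob p γ A t ξ| ≤ |c| := by
  rw [abs_mul]
  exact mul_le_of_le_one_right (abs_nonneg _) (abs_prob_le_one _ _ _)

theorem abs_integral_mul_prob_le {a : ℝ → ℝ} (ha : Continuous a) (A : Set (FinConfig d)) {t : ℝ}
    (ht : 0 ≤ t) (ξ : FinConfig d) :
    |∫ r in (0 : ℝ)..t, a r * prob p γ A (t - r) ξ| ≤ ∫ r in (0 : ℝ)..t, |a r| := by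
  rw [← Real.norm_eq_abs]
  exact intervalIntegral.norm_integral_le_of_norm_le (μ := volume) ht
    (Eventually.of_forall fun _ _ => abs_mul_prob_le _ _ _ _) (ha.abs.intervalIntegrable _ _)

theorem Forced.convolution {a : ℝ → ℝ} (ha : Continuous a) (A : Set (FinConfig d)) :
    Forced p γ (fun t ξ => ∫ r in (0 : ℝ)..t, a r * LonelyBRW.prob p γ A (t - r) ξ)
      fun t ξ => a t * A.indicator 1 ξ where
  controlled t ht := Controlled.of_bounded _ fun ξ => abs_integral_mul_prob_le ha A ht ξ
  continuous ξ :=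
    intervalIntegral.continuous_parametric_intervalIntegral_of_continuous
      (f := fun t r => a r * LonelyBRW.prob p γ A (t - r) ξ)
      ((ha.comp continuous_snd).mul
        ((continuous_prob A ξ).comp (continuous_fst.sub continuous_snd))) continuous_id
  hasDerivWithinAt ξ t ht := by
    refine (hasDerivWithinAt_convolution ha (continuous_gen_prob A ξ)
      (fun s hs => prob_eq_add_integral A ξ hs) ht).congr_deriv ?_
    rw [prob_zero, add_comm]
    congr 1
    simp only [intervalIntegral.integral_of_le ht]
    rw [gen_integral (G := fun r ζ => a r * LonelyBRW.prob p γ A (t - r) ζ) (b := fun r => |a r|)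
      (fun ζ => ha.measurable.mul
        ((continuous_prob A ζ).measurable.comp (measurable_const.sub measurable_id)))
      (fun r ζ => abs_mul_prob_le _ _ _ _) ha.abs.integrableOn_Ioc]
    simp_rw [gen_const_mul]

end Convolution

section Overlap

variable {p : PMF (Site d)}

/-- The time that two independent walks started from the same site spend together in `D` up to
time `t`, in expectation. -/
def overlap (p : PMF (Site d)) (D : Finset (Site d)) (t : ℝ) : ℝ :=
  ∑ v ∈ D, ∫ r in (0 : ℝ)..t, kern p r v ^ 2

theorem hasDerivAt_overlap (D : Finset (Site d)) (t : ℝ) :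
    HasDerivAt (overlap p D) (∑ v ∈ D, kern p t v ^ 2) t :=
  HasDerivAt.fun_sum fun v _ =>
    intervalIntegral.integral_hasDerivAt_right ((continuous_kern_sq v).intervalIntegrable _ _)
      (continuous_kern_sq v).aestronglyMeasurable.stronglyMeasurableAtFilter
      (continuous_kern_sq v).continuousAt

theorem continuous_overlap (D : Finset (Site d)) : Continuous (overlap p D) :=
  continuous_iff_continuousAt.2 fun t => (hasDerivAt_overlap D t).continuousAt

theorem overlap_nonneg (D : Finset (Site d)) {t : ℝ} (ht : 0 ≤ t) : 0 ≤ overlap p D t :=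
  Finset.sum_nonneg fun _ _ => intervalIntegral.integral_nonneg ht fun _ _ => sq_nonneg _

theorem overlap_zero (D : Finset (Site d)) : overlap p D 0 = 0 := by simp [overlap]

theorem sum_kern_sq_le_one {t : ℝ} (ht : 0 ≤ t) (D : Finset (Site d)) :
    ∑ v ∈ D, kern p t v ^ 2 ≤ 1 :=
  (Finset.sum_le_sum fun v _ => pow_le_of_le_one (kern_nonneg ht v) (kern_le_one ht v)
    two_ne_zero).trans (sum_kern_le_one ht D)

theorem overlap_add_one_le (D : Finset (Site d)) {t : ℝ} (ht : 0 ≤ t) :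
    overlap p D (t + 1) ≤ overlap p D t + 1 := by
  have hcont : Continuous fun r => ∑ v ∈ D, kern p r v ^ 2 :=
    continuous_finsetSum _ fun v _ => continuous_kern_sq v
  calc overlap p D (t + 1)
      = overlap p D t + ∫ r in t..(t + 1), ∑ v ∈ D, kern p r v ^ 2 := by
        rw [intervalIntegral.integral_eq_sub_of_hasDerivAt (fun r _ => hasDerivAt_overlap D r)
          (hcont.intervalIntegrable _ _), add_sub_cancel]
    _ ≤ overlap p D t + ∫ _ in t..(t + 1), (1 : ℝ) := by
        gcongr
        exact intervalIntegral.integral_mono_on (by linarith) (hcont.intervalIntegrable _ _)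
          intervalIntegrable_const fun r hr => sum_kern_sq_le_one (ht.trans hr.1) D
    _ = overlap p D t + 1 := by simp

end Overlap

section Cost

variable {p : PMF (Site d)} {γ : ℝ≥0}

theorem sum_mul_indicator_le {f : Site d → ℝ} (hf : ∀ v, 0 ≤ f v) (x : Site d)
    (D : Finset (Site d)) (ξ : FinConfig d) :
    ∑ v ∈ D, f v * {ξ : FinConfig d | ξ (x - v) = 1}.indicator 1 ξ ≤
      ∑ w ∈ ξ.support, if ξ w = 1 then f (x - w) else 0 := by
  classical
  set F : Site d → ℝ := fun w => if ξ w = 1 then f (x - w) else 0 with hF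
  have hF0 (w) : 0 ≤ F w := by
    simp only [hF]
    split_ifs
    exacts [hf _, le_rfl]
  calc ∑ v ∈ D, f v * {ξ : FinConfig d | ξ (x - v) = 1}.indicator 1 ξ
      = ∑ v ∈ D, F (x - v) :=
        Finset.sum_congr rfl fun v _ => by simp [hF, Set.indicator_apply]
    _ = ∑ w ∈ D.image (x - ·), F w :=
        (Finset.sum_image fun _ _ _ _ h => sub_right_injective h).symm
    _ ≤ ∑ w ∈ D.image (x - ·) ∪ ξ.support, F w :=
        Finset.sum_le_sum_of_subset_of_nonneg Finset.subset_union_left fun w _ _ => hF0 w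
    _ = ∑ w ∈ ξ.support, F w := (Finset.sum_subset Finset.subset_union_right fun w _ hw => by
        simp [hF, Finsupp.notMem_support_iff.1 hw]).symm

theorem branchAt_thin_nonneg {a : Site d → ℝ} (ha : ∀ y, a y ≤ 1) (ξ : FinConfig d) (w : Site d) :
    0 ≤ branchAt (thin a) ξ w := by
  have hthin := thin_nonneg ha (ξ - Finsupp.single w 1)
  rw [branchAt_thin]
  split_ifs <;> positivity

theorem exp_neg_le_thin_hit_half {K : ℝ} {x : Site d} {t : ℝ} (ht : 0 ≤ t) {ξ : FinConfig d}
    (hK : mean p x t ξ ≤ K) : Real.exp (-K) ≤ thin (hit p (1 / 2) x t) ξ := by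
  refine le_trans ?_ (exp_neg_mul_lin_le_thin (C := 1 / (1 - 1 / 2)) (fun y =>
    exp_neg_mul_le_one_sub (by norm_num) (hit_nonneg (by norm_num) x ht y)
      (hit_le (by norm_num) x ht y)) ξ)
  rw [lin_hit]
  gcongr
  linarith

theorem exp_neg_mul_sum_le_sum_branchAt_thin {K : ℝ} {x : Site d} {t : ℝ} (ht : 0 ≤ t)
    {ξ : FinConfig d} (hK : mean p x t ξ ≤ K) :
    1 / 4 * Real.exp (-K) * ∑ w ∈ ξ.support, (if ξ w = 1 then kern p t (x - w) ^ 2 else 0) ≤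
      ∑ w ∈ ξ.support, branchAt (thin (hit p (1 / 2) x t)) ξ w := by
  rw [Finset.mul_sum]
  refine Finset.sum_le_sum fun w hw => ?_
  rw [branchAt_thin, mul_ite, mul_zero]
  split_ifs
  · have hthin := thin_le_thin_sub_single (hit_nonneg (p := p) (θ := 1 / 2) (by norm_num) x ht)
      (hit_le_one (by norm_num) (by norm_num) x ht) (Finsupp.mem_support_iff.1 hw)
    calc 1 / 4 * Real.exp (-K) * kern p t (x - w) ^ 2
        = hit p (1 / 2) x t w ^ 2 * Real.exp (-K) := by rw [hit]; ring
      _ ≤ hit p (1 / 2) x t w ^ 2 * thin (hit p (1 / 2) x t) (ξ - Finsupp.single w 1) := by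
          gcongr
          exact (exp_neg_le_thin_hit_half ht hK).trans hthin
  · exact le_rfl

theorem overlap_source_le {K : ℝ} (hK : 0 < K) (x : Site d) (D : Finset (Site d)) {t : ℝ}
    (ht : 0 ≤ t) (ξ : FinConfig d) :
    γ / 8 * Real.exp (-K) *
      (∑ v ∈ D, kern p t v ^ 2 * {ξ : FinConfig d | ξ (x - v) = 1}.indicator 1 ξ -
        (∑ v ∈ D, kern p t v ^ 2) * (K⁻¹ * mean p x t ξ)) ≤
      γ / 2 * ∑ w ∈ ξ.support, branchAt (thin (hit p (1 / 2) x t)) ξ w := by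
  have hsum : 0 ≤ ∑ v ∈ D, kern p t v ^ 2 := Finset.sum_nonneg fun _ _ => sq_nonneg _
  rcases le_total K (mean p x t ξ) with hlarge | hsmall
  · have hone : 1 ≤ K⁻¹ * mean p x t ξ := (one_le_inv_mul₀ hK).2 hlarge
    have hind : ∑ v ∈ D, kern p t v ^ 2 * {ξ : FinConfig d | ξ (x - v) = 1}.indicator 1 ξ ≤
        ∑ v ∈ D, kern p t v ^ 2 := Finset.sum_le_sum fun v _ =>
      mul_le_of_le_one_right (sq_nonneg _) (Set.indicator_le_self' (fun _ _ => zero_le_one) ξ)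
    have hmul := le_mul_of_one_le_right hsum hone
    refine (mul_nonpos_of_nonneg_of_nonpos (by positivity) (by linarith)).trans
      (mul_nonneg (by positivity) (Finset.sum_nonneg fun w _ => ?_))
    exact branchAt_thin_nonneg (hit_le_one (by norm_num) (by norm_num) x ht) ξ w
  · have hmean : 0 ≤ (∑ v ∈ D, kern p t v ^ 2) * (K⁻¹ * mean p x t ξ) :=
      mul_nonneg hsum (mul_nonneg (inv_nonneg.2 hK.le) (mean_nonneg x ht ξ))
    have hind := sum_mul_indicator_le (fun v => sq_nonneg (kern p t v)) x D ξ
    calc γ / 8 * Real.exp (-K) *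
          (∑ v ∈ D, kern p t v ^ 2 * {ξ : FinConfig d | ξ (x - v) = 1}.indicator 1 ξ -
            (∑ v ∈ D, kern p t v ^ 2) * (K⁻¹ * mean p x t ξ))
        ≤ γ / 8 * Real.exp (-K) *
          ∑ w ∈ ξ.support, (if ξ w = 1 then kern p t (x - w) ^ 2 else 0) := by
          gcongr
          linarith
      _ = γ / 2 * (1 / 4 * Real.exp (-K) *
          ∑ w ∈ ξ.support, (if ξ w = 1 then kern p t (x - w) ^ 2 else 0)) := by ring
      _ ≤ γ / 2 * ∑ w ∈ ξ.support, branchAt (thin (hit p (1 / 2) x t)) ξ w := by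
          gcongr
          exact exp_neg_mul_sum_le_sum_branchAt_thin ht hsmall

theorem half_occ_zero_le_one_sub_thin (x : Site d) (ζ : FinConfig d) :
    1 / 2 * occ p γ x 0 ζ ≤ 1 - thin (hit p (1 / 2) x 0) ζ := by
  have hthin := thin_le_one (hit_nonneg (p := p) (θ := 1 / 2) (by norm_num) x le_rfl)
    (hit_le_one (by norm_num) (by norm_num) x le_rfl)
  by_cases h : ζ x = 0
  · simpa [occ, prob_zero, h] using hthin ζ
  · obtain ⟨ζ', rfl⟩ := exists_eq_add_single h
    rw [thin_add_single, hit_zero, if_pos rfl]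
    linarith [hthin ζ', occ_le_one (p := p) (γ := γ) x 0 (ζ' + Finsupp.single x 1)]

theorem sum_convolution_lone_le_integral (x : Site d) (D : Finset (Site d)) {s t : ℝ}
    (hs : s ∈ Set.Icc 0 t) (ζ : FinConfig d) :
    ∑ v ∈ D, ∫ r in (0 : ℝ)..s, kern p r v ^ 2 * lone p γ (x - v) (s - r) ζ ≤
      ∑ v ∈ D, ∫ r in (0 : ℝ)..t, |kern p r v ^ 2| :=
  Finset.sum_le_sum fun v _ => (le_abs_self _).trans
    ((abs_integral_mul_prob_le (continuous_kern_sq v) _ hs.1 ζ).trans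
      (intervalIntegral.integral_mono_interval le_rfl hs.1 hs.2
        (Eventually.of_forall fun _ => abs_nonneg _)
        ((continuous_kern_sq v).abs.intervalIntegrable _ _)))

/- For independent walks without branching `1 - thin (hit p (1 / 2) x t)` is the expectation of
`1 - 2 ^ (-n)`, where `n` is the number of particles at `x`. This function is concave, so each
branching of a lonely particle decreases the expectation, and it is at least half the indicator of
`n ≠ 0`. -/
theorem occ_add_convolution_le {K : ℝ} (hK : 0 < K) (x : Site d) (D : Finset (Site d)) {t : ℝ}
    (ht : 0 ≤ t) (ξ : FinConfig d) :
    1 / 2 * occ p γ x t ξ + γ / 8 * Real.exp (-K) *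
      ((∑ v ∈ D, ∫ r in (0 : ℝ)..t, kern p r v ^ 2 * lone p γ (x - v) (t - r) ξ) -
        overlap p D t * (K⁻¹ * mean p x t ξ)) ≤ 1 - thin (hit p (1 / 2) x t) ξ := by
  set c := γ / 8 * Real.exp (-K) with hc
  have hforced := (((Forced.occ (p := p) (γ := γ) x).const_mul (1 / 2)).add
    (((Forced.sum (s := D) fun v _ => Forced.convolution (continuous_kern_sq (p := p) v)
      {ξ : FinConfig d | ξ (x - v) = 1}).sub
      (((Forced.mean x).const_mul K⁻¹).mul_fun (continuous_overlap (p := p) D)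
        fun t _ => (hasDerivAt_overlap (p := p) D t).hasDerivWithinAt)).const_mul c)).sub
    ((Forced.const 1).sub (Forced.thin (θ := 1 / 2) (by norm_num) (by norm_num) x))
  refine sub_nonpos.1 (hforced.nonpos
    (C := 1 + c * ∑ v ∈ D, ∫ r in (0 : ℝ)..t, |kern p r v ^ 2|) (T := t) ?_ ?_ ?_ ht ξ)
  · intro s hs ζ
    have hthin := thin_le_one (hit_nonneg (p := p) (θ := 1 / 2) (by norm_num) x hs.1)
      (hit_le_one (by norm_num) (by norm_num) x hs.1) ζ
    have hmean := mul_nonneg (overlap_nonneg (p := p) D hs.1)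
      (mul_nonneg (inv_nonneg.2 hK.le) (mean_nonneg (p := p) x hs.1 ζ))
    have hcost := mul_le_mul_of_nonneg_left
      (sub_le_sub (sum_convolution_lone_le_integral (p := p) (γ := γ) x D hs ζ) hmean)
      (by positivity : 0 ≤ c)
    simp only [lone, sub_zero] at hcost
    linarith [occ_le_one (p := p) (γ := γ) x s ζ]
  · intro ζ
    simpa only [overlap_zero, intervalIntegral.integral_same, Finset.sum_const_zero, zero_mul,
      sub_zero, mul_zero, add_zero, sub_nonpos] using half_occ_zero_le_one_sub_thin x ζ
  · intro s hs ζ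
    have hsource := overlap_source_le (p := p) (γ := γ) hK x D hs ζ
    rw [← hc] at hsource
    simp only [mul_zero, add_zero]
    linarith

theorem convolution_lone_single_le (hγ : 0 < γ) {K : ℝ} (hK : 0 < K) (D : Finset (Site d))
    {t : ℝ} (ht : 0 ≤ t) (x : Site d) :
    ∑ v ∈ D, ∫ r in (0 : ℝ)..t, kern p r v ^ 2 *
      lone p γ (x - v) (t - r) (Finsupp.single 0 1) ≤
      (4 / γ * Real.exp K + overlap p D t / K) * kern p t x := by
  set S := ∑ v ∈ D, ∫ r in (0 : ℝ)..t, kern p r v ^ 2 *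
    lone p γ (x - v) (t - r) (Finsupp.single 0 1)
  have hγ' : (γ : ℝ) ≠ 0 := NNReal.coe_ne_zero.2 hγ.ne'
  have hthin : thin (hit p (1 / 2) x t) (Finsupp.single 0 1) = 1 - 1 / 2 * kern p t x := by
    have hadd := thin_add_single (a := hit p (1 / 2) x t) 0 0
    rw [zero_add, thin_zero, hit, sub_zero] at hadd
    rw [hadd]
    ring
  have hocc := occ_nonneg (p := p) (γ := γ) x t (Finsupp.single 0 1)
  have hcost := occ_add_convolution_le (p := p) (γ := γ) hK x D ht (Finsupp.single 0 1)
  rw [hthin, mean, lin_single, sub_zero] at hcost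
  have hhalf : γ / 8 * Real.exp (-K) * (S - overlap p D t * (K⁻¹ * kern p t x)) ≤
      1 / 2 * kern p t x := by linarith
  calc S = 4 / γ * Real.exp K *
        (2 * (γ / 8 * Real.exp (-K) * (S - overlap p D t * (K⁻¹ * kern p t x)))) +
          overlap p D t * (K⁻¹ * kern p t x) := by
        rw [Real.exp_neg]
        field_simp
        ring
    _ ≤ 4 / γ * Real.exp K * (2 * (1 / 2 * kern p t x)) +
          overlap p D t * (K⁻¹ * kern p t x) := by gcongr
    _ = (4 / γ * Real.exp K + overlap p D t / K) * kern p t x := by ring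

theorem sum_convolution_lone_le (hγ : 0 < γ) {K : ℝ} (hK : 0 < K) (D X : Finset (Site d)) {t : ℝ}
    (ht : 0 ≤ t) :
    ∑ x ∈ X, ∑ v ∈ D, ∫ r in (0 : ℝ)..t, kern p r v ^ 2 *
      lone p γ (x - v) (t - r) (Finsupp.single 0 1) ≤
      4 / γ * Real.exp K + overlap p D t / K := by
  have hoverlap := overlap_nonneg (p := p) D ht
  refine (Finset.sum_le_sum fun x _ => convolution_lone_single_le hγ hK D ht x).trans ?_
  rw [← Finset.mul_sum]
  exact mul_le_of_le_one_right (by positivity) (sum_kern_le_one ht X)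

end Cost

/-! ### Decay of the expected number of occupied sites -/

section Decay

variable {p : PMF (Site d)} {γ : ℝ≥0}

/-- The expected number of lonely particles at time `t` for the system started from one
particle. -/
def loneSum (p : PMF (Site d)) (γ : ℝ≥0) (t : ℝ) : ℝ≥0∞ :=
  ∑' x, ENNReal.ofReal (lone p γ x t (Finsupp.single 0 1))

theorem occSum_le_inv_mul_loneSum_add {c K t : ℝ} (hc : 0 < c) (hK : 0 < K) (ht : 0 ≤ t)
    (hlone : ∀ x, c * (occ p γ x t (Finsupp.single 0 1) - kern p t x / K) ≤
      lone p γ x t (Finsupp.single 0 1)) :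
    occSum p γ t ≤ ENNReal.ofReal c⁻¹ * loneSum p γ t + ENNReal.ofReal K⁻¹ := by
  have hocc (x : Site d) : ENNReal.ofReal (occ p γ x t (Finsupp.single 0 1)) ≤
      ENNReal.ofReal c⁻¹ * ENNReal.ofReal (lone p γ x t (Finsupp.single 0 1)) +
        ENNReal.ofReal K⁻¹ * ENNReal.ofReal (kern p t x) := by
    rw [← ENNReal.ofReal_mul (inv_nonneg.2 hc.le), ← ENNReal.ofReal_mul (inv_nonneg.2 hK.le),
      ← ENNReal.ofReal_add (mul_nonneg (inv_nonneg.2 hc.le) (lone_nonneg _ _ _))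
        (mul_nonneg (inv_nonneg.2 hK.le) (kern_nonneg ht x)), inv_mul_eq_div K]
    exact ENNReal.ofReal_le_ofReal (sub_le_iff_le_add.1 ((le_inv_mul_iff₀ hc).2 (hlone x)))
  calc occSum p γ t
      ≤ ∑' x, (ENNReal.ofReal c⁻¹ * ENNReal.ofReal (lone p γ x t (Finsupp.single 0 1)) +
        ENNReal.ofReal K⁻¹ * ENNReal.ofReal (kern p t x)) := ENNReal.tsum_le_tsum hocc
    _ = ENNReal.ofReal c⁻¹ * loneSum p γ t + ENNReal.ofReal K⁻¹ := by
        rw [ENNReal.tsum_add, ENNReal.tsum_mul_left, ENNReal.tsum_mul_left, tsum_ofReal_kern ht,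
          mul_one, loneSum]

theorem ofReal_le_loneSum {c κ t : ℝ} (hc : 0 < c) (hκ : 0 < κ) (ht : 0 ≤ t)
    (hlone : ∀ x, c * (occ p γ x t (Finsupp.single 0 1) - kern p t x / (2 / κ)) ≤
      lone p γ x t (Finsupp.single 0 1))
    (hocc : ENNReal.ofReal κ ≤ occSum p γ t) : ENNReal.ofReal (c * κ / 2) ≤ loneSum p γ t := by
  rcases eq_or_ne (loneSum p γ t) ∞ with htop | hfin
  · simp [htop]
  · have hle := hocc.trans (occSum_le_inv_mul_loneSum_add hc (by positivity) ht hlone)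
    rw [← ENNReal.ofReal_toReal hfin, ← ENNReal.ofReal_mul (by positivity),
      ← ENNReal.ofReal_add (by positivity) (by positivity),
      ENNReal.ofReal_le_ofReal_iff (by positivity), inv_div] at hle
    refine ENNReal.ofReal_le_of_le_toReal ?_
    calc c * κ / 2 = c * (κ / 2) := by ring
      _ ≤ c * (c⁻¹ * (loneSum p γ t).toReal) := by
          gcongr
          linarith
      _ = (loneSum p γ t).toReal := mul_inv_cancel_left₀ hc.ne' _

theorem continuous_kern_sq_mul_lone (v y : Site d) (T : ℝ) (ξ : FinConfig d) :
    Continuous fun r => kern p r v ^ 2 * lone p γ y (T - r) ξ :=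
  (continuous_kern_sq v).mul
    ((continuous_prob _ ξ).comp (continuous_const.sub continuous_id))

theorem kern_sq_mul_lone_nonneg (v y : Site d) (r t : ℝ) (ξ : FinConfig d) :
    0 ≤ kern p r v ^ 2 * lone p γ y t ξ :=
  mul_nonneg (sq_nonneg _) (lone_nonneg _ _ _)

theorem tsum_ofReal_convolution_lone (v : Site d) {T : ℝ} (hT : 0 ≤ T) :
    ∑' x, ENNReal.ofReal (∫ r in (0 : ℝ)..T,
      kern p r v ^ 2 * lone p γ (x - v) (T - r) (Finsupp.single 0 1)) =
      ∫⁻ r in Set.Ioc 0 T, ENNReal.ofReal (kern p r v ^ 2) * loneSum p γ (T - r) := by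
  have hcont (x : Site d) := continuous_kern_sq_mul_lone (p := p) (γ := γ) v (x - v) T
    (Finsupp.single 0 1)
  have htranslate (r : ℝ) : ∑' x, ENNReal.ofReal (kern p r v ^ 2 *
      lone p γ (x - v) (T - r) (Finsupp.single 0 1)) =
      ENNReal.ofReal (kern p r v ^ 2) * loneSum p γ (T - r) := by
    simp_rw [ENNReal.ofReal_mul (sq_nonneg (kern p r v))]
    rw [ENNReal.tsum_mul_left]
    exact congrArg _ ((Equiv.subRight v).tsum_eq
      fun x => ENNReal.ofReal (lone p γ x (T - r) (Finsupp.single 0 1)))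
  calc ∑' x, ENNReal.ofReal (∫ r in (0 : ℝ)..T,
        kern p r v ^ 2 * lone p γ (x - v) (T - r) (Finsupp.single 0 1))
      = ∑' x, ∫⁻ r in Set.Ioc 0 T, ENNReal.ofReal (kern p r v ^ 2 *
          lone p γ (x - v) (T - r) (Finsupp.single 0 1)) := tsum_congr fun x => by
        rw [intervalIntegral.integral_of_le hT, ofReal_integral_eq_lintegral_ofReal
          (hcont x).integrableOn_Ioc
          (Eventually.of_forall fun r => kern_sq_mul_lone_nonneg _ _ _ _ _)]
    _ = ∫⁻ r in Set.Ioc 0 T, ENNReal.ofReal (kern p r v ^ 2) * loneSum p γ (T - r) := by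
        rw [← lintegral_tsum fun x => (hcont x).measurable.ennreal_ofReal.aemeasurable]
        simp_rw [htranslate]

theorem sum_lintegral_kern_sq_mul_loneSum_le (hγ : 0 < γ) {K : ℝ} (hK : 0 < K)
    (D : Finset (Site d)) {T : ℝ} (hT : 0 ≤ T) :
    ∑ v ∈ D, ∫⁻ r in Set.Ioc 0 T, ENNReal.ofReal (kern p r v ^ 2) * loneSum p γ (T - r) ≤
      ENNReal.ofReal (4 / γ * Real.exp K + overlap p D T / K) := by
  have hnonneg (v x : Site d) : 0 ≤ ∫ r in (0 : ℝ)..T,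
      kern p r v ^ 2 * lone p γ (x - v) (T - r) (Finsupp.single 0 1) :=
    intervalIntegral.integral_nonneg hT fun r _ => kern_sq_mul_lone_nonneg _ _ _ _ _
  simp_rw [← tsum_ofReal_convolution_lone _ hT]
  rw [← Summable.tsum_finsetSum fun _ _ => ENNReal.summable, ENNReal.tsum_eq_iSup_sum]
  refine iSup_le fun X => ?_
  simp_rw [← ENNReal.ofReal_sum_of_nonneg fun v _ => hnonneg v _]
  rw [← ENNReal.ofReal_sum_of_nonneg fun x _ => Finset.sum_nonneg fun v _ => hnonneg v x]
  exact ENNReal.ofReal_le_ofReal (sum_convolution_lone_le hγ hK D X hT)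

theorem ofReal_mul_overlap_le {c : ℝ} (hc : 0 ≤ c)
    (hlone : ∀ t : ℝ, 1 ≤ t → ENNReal.ofReal c ≤ loneSum p γ t) (D : Finset (Site d)) {T : ℝ}
    (hT : 0 ≤ T) :
    ENNReal.ofReal (c * overlap p D T) ≤ ∑ v ∈ D, ∫⁻ r in Set.Ioc 0 (T + 1),
      ENNReal.ofReal (kern p r v ^ 2) * loneSum p γ (T + 1 - r) := by
  rw [overlap, Finset.mul_sum, ENNReal.ofReal_sum_of_nonneg fun v _ => mul_nonneg hc
    (intervalIntegral.integral_nonneg hT fun _ _ => sq_nonneg _)]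
  refine Finset.sum_le_sum fun v _ => ?_
  calc ENNReal.ofReal (c * ∫ r in (0 : ℝ)..T, kern p r v ^ 2)
      = ∫⁻ r in Set.Ioc 0 T, ENNReal.ofReal (kern p r v ^ 2) * ENNReal.ofReal c := by
        rw [mul_comm, ENNReal.ofReal_mul' hc, intervalIntegral.integral_of_le hT,
          ofReal_integral_eq_lintegral_ofReal (continuous_kern_sq v).integrableOn_Ioc
            (Eventually.of_forall fun r => sq_nonneg _),
          lintegral_mul_const _ (continuous_kern_sq v).measurable.ennreal_ofReal]
    _ ≤ ∫⁻ r in Set.Ioc 0 T, ENNReal.ofReal (kern p r v ^ 2) * loneSum p γ (T + 1 - r) :=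
        setLIntegral_mono' measurableSet_Ioc fun r hr => by
          gcongr
          exact hlone _ (by linarith [hr.2])
    _ ≤ ∫⁻ r in Set.Ioc 0 (T + 1),
          ENNReal.ofReal (kern p r v ^ 2) * loneSum p γ (T + 1 - r) :=
        lintegral_mono_set (Set.Ioc_subset_Ioc_right (by linarith))

theorem mul_overlap_le (hγ : 0 < γ) {c K : ℝ} (hc : 0 ≤ c) (hK : 0 < K)
    (hlone : ∀ t : ℝ, 1 ≤ t → ENNReal.ofReal c ≤ loneSum p γ t) (D : Finset (Site d)) {T : ℝ}
    (hT : 0 ≤ T) : c * overlap p D T ≤ 4 / γ * Real.exp K + overlap p D (T + 1) / K := by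
  have hT' : 0 ≤ T + 1 := by linarith
  have hoverlap := overlap_nonneg (p := p) D hT'
  rw [← ENNReal.ofReal_le_ofReal_iff (by positivity)]
  exact (ofReal_mul_overlap_le hc hlone D hT).trans
    (sum_lintegral_kern_sq_mul_loneSum_le hγ hK D hT')

theorem overlap_le (hγ : 0 < γ) {c : ℝ} (hc : 0 < c)
    (hlone : ∀ t : ℝ, 1 ≤ t → ENNReal.ofReal c ≤ loneSum p γ t) (D : Finset (Site d)) {T : ℝ}
    (hT : 0 ≤ T) : overlap p D T ≤ (8 / γ * Real.exp (2 / c) + c) / c := by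
  have hmul := mul_overlap_le hγ hc.le (by positivity : 0 < 2 / c) hlone D hT
  have hstep : overlap p D (T + 1) / (2 / c) ≤ (overlap p D T + 1) * c / 2 := by
    rw [div_div_eq_mul_div]
    gcongr
    exact overlap_add_one_le D hT
  rw [le_div_iff₀ hc]
  linarith [show 8 / (γ : ℝ) * Real.exp (2 / c) = 2 * (4 / γ * Real.exp (2 / c)) by ring]

/- If the expected number of occupied sites stayed above `ε`, so would, up to a constant, the
expected number of lonely particles, and the overlap of two independent walks would be bounded. -/
theorem exists_occSum_lt (hd : 1 ≤ d) (hirr : IsIrreducible (p : Site d → ℝ≥0∞))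
    (hrec : IsRecurrent (symmetrised (p : Site d → ℝ≥0∞))) (hγ : 0 < γ) {ε : ℝ} (hε : 0 < ε) :
    ∃ t, 0 ≤ t ∧ occSum p γ t < ENNReal.ofReal ε := by
  by_contra! hocc
  obtain ⟨α, hα, hkern⟩ := exists_kern_one_le_of_irreducible hd hirr
  obtain ⟨c, hc, hlone⟩ := exists_occ_sub_mean_le_lone (γ := γ) hα hkern (K := 2 / ε)
    (by positivity)
  have hloneSum (t : ℝ) (ht : 1 ≤ t) : ENNReal.ofReal (c * ε / 2) ≤ loneSum p γ t := by
    have ht0 : 0 ≤ t := zero_le_one.trans ht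
    refine ofReal_le_loneSum hc hε ht0 (fun x => ?_) (hocc t ht0)
    simpa only [mean, lin_single, sub_zero] using hlone x t ht (Finsupp.single 0 1)
  obtain ⟨D, T, hT, hlt⟩ := exists_lt_sum_integral_kern_sq hrec
    ((8 / γ * Real.exp (2 / (c * ε / 2)) + c * ε / 2) / (c * ε / 2))
  exact hlt.not_ge (overlap_le hγ (by positivity) hloneSum D hT)

theorem tendsto_occSum (hd : 1 ≤ d) (hirr : IsIrreducible (p : Site d → ℝ≥0∞))
    (hrec : IsRecurrent (symmetrised (p : Site d → ℝ≥0∞))) (hγ : 0 < γ) :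
    Tendsto (occSum p γ) atTop (𝓝 0) := by
  rw [ENNReal.tendsto_nhds_zero]
  intro ε hε
  obtain ⟨δ, -, hδ_pos, hδ_lt⟩ := ENNReal.lt_iff_exists_real_btwn.1 hε
  obtain ⟨t, ht, hlt⟩ := exists_occSum_lt hd hirr hrec hγ (ENNReal.ofReal_pos.1 hδ_pos)
  filter_upwards [eventually_ge_atTop t] with s hs
  calc occSum p γ s = occSum p γ (t + (s - t)) := by rw [add_sub_cancel]
    _ ≤ occSum p γ t := occSum_add_le ht (sub_nonneg.2 hs)
    _ ≤ ε := hlt.le.trans hδ_lt.le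

end Decay

/-! ### General systems -/

section General

variable {p : PMF (Site d)} {γ : ℝ≥0}

theorem truncate_apply_le (n : ℕ) (η : Config d) (z : Site d) : truncate n η z ≤ η z := by
  simp only [truncate, Finsupp.onFinset_apply]
  split_ifs <;> simp

/-- An upper bound for the probability that `x` is occupied at time `t` in the system started from
`η`: the sum over the particles of `η` of this probability for each of them alone. -/
def occBound (p : PMF (Site d)) (γ : ℝ≥0) (x : Site d) (t : ℝ) (η : Config d) : ℝ≥0∞ :=
  ∑' z, (η z : ℝ≥0∞) * ENNReal.ofReal (occ p γ (x - z) t (Finsupp.single 0 1))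

theorem ofReal_occ_le_occBound {ξ : FinConfig d} {η : Config d} (h : ∀ z, ξ z ≤ η z) (x : Site d)
    {t : ℝ} (ht : 0 ≤ t) : ENNReal.ofReal (occ p γ x t ξ) ≤ occBound p γ x t η :=
  calc ENNReal.ofReal (occ p γ x t ξ)
      ≤ ENNReal.ofReal (∑ z ∈ ξ.support, ξ z * occ p γ x t (Finsupp.single z 1)) := by
        rw [← lin_eq_sum]
        exact ENNReal.ofReal_le_ofReal (occ_le_lin x ht ξ)
    _ = ∑ z ∈ ξ.support, (ξ z : ℝ≥0∞) * ENNReal.ofReal (occ p γ x t (Finsupp.single z 1)) := by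
        rw [ENNReal.ofReal_sum_of_nonneg fun z _ =>
          mul_nonneg (Nat.cast_nonneg _) (occ_nonneg _ _ _)]
        simp_rw [ENNReal.ofReal_mul (Nat.cast_nonneg _), ENNReal.ofReal_natCast]
    _ ≤ ∑ z ∈ ξ.support, (η z : ℝ≥0∞) *
          ENNReal.ofReal (occ p γ (x - z) t (Finsupp.single 0 1)) := by
        gcongr with z
        exacts [h z, occ_single_le x z ht]
    _ ≤ occBound p γ x t η := ENNReal.sum_le_tsum ξ.support

theorem one_le_prob_add_occ (x : Site d) {t : ℝ} (ht : 0 ≤ t) (ξ : FinConfig d) :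
    1 ≤ ENNReal.ofReal (prob p γ {ξ | ξ x = 0} t ξ) + ENNReal.ofReal (occ p γ x t ξ) := by
  have hcompl := one_sub_prob_le_prob_compl (p := p) (γ := γ) {ξ : FinConfig d | ξ x = 0} ht ξ
  rw [← ENNReal.ofReal_add (prob_nonneg _ _ _) (occ_nonneg _ _ _), ENNReal.one_le_ofReal]
  exact sub_le_iff_le_add'.1 hcompl

section System

variable {Ω : Type*} [MeasurableSpace Ω] {μ : Measure Ω} {η : ℝ≥0 → Ω → Config d}

theorem IsLonelyBRW.measurable_apply (hη : IsLonelyBRW p γ μ η) (t : ℝ≥0) (x : Site d) :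
    Measurable fun ω => η t ω x :=
  (measurable_pi_apply x).comp (hη.measurable t)

theorem IsLonelyBRW.lintegral_occBound_le (hη : IsLonelyBRW p γ μ η) (x : Site d) (t : ℝ) :
    ∫⁻ ω, occBound p γ x t (η 0 ω) ∂μ ≤
      (⨆ y, ∫⁻ ω, (η 0 ω y : ℝ≥0∞) ∂μ) * occSum p γ t := by
  have hmeas (z : Site d) : Measurable fun ω => (η 0 ω z : ℝ≥0∞) :=
    (measurable_of_countable fun n : ℕ => (n : ℝ≥0∞)).comp (hη.measurable_apply 0 z)
  simp_rw [occBound]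
  rw [lintegral_tsum fun z => ((hmeas z).mul_const _).aemeasurable, occSum,
    ← (Equiv.subLeft x).tsum_eq, ← ENNReal.tsum_mul_left]
  refine ENNReal.tsum_le_tsum fun z => ?_
  rw [lintegral_mul_const _ (hmeas _), Equiv.subLeft_apply, sub_sub_cancel]
  gcongr
  exact le_iSup (fun y => ∫⁻ ω, (η 0 ω y : ℝ≥0∞) ∂μ) (x - z)

theorem IsLonelyBRW.ae_one_le_condExp_add (hη : IsLonelyBRW p γ μ η) (x : Site d) (t : ℝ≥0) :
    ∀ᵐ ω ∂μ, 1 ≤ ENNReal.ofReal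
      (μ[Set.indicator {ω | η t ω x = 0} (fun _ => (1 : ℝ)) | past η 0] ω) +
        occBound p γ x t (η 0 ω) := by
  have hmarkov := hη.markov 0 t {x} 0
  simp only [zero_add, Finset.mem_singleton, forall_eq, Pi.zero_apply, toReal_transProb] at hmarkov
  filter_upwards [hmarkov] with ω hω
  refine ge_of_tendsto' ((ENNReal.tendsto_ofReal hω).add tendsto_const_nhds) fun n => ?_
  refine (one_le_prob_add_occ (p := p) (γ := γ) x t.coe_nonneg (truncate n (η 0 ω))).trans ?_
  gcongr
  exact ofReal_occ_le_occBound (truncate_apply_le n _) x t.coe_nonneg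

theorem IsLonelyBRW.lintegral_ofReal_condExp [IsFiniteMeasure μ] (hη : IsLonelyBRW p γ μ η)
    {A : Set Ω} (hA : MeasurableSet A) (s : ℝ≥0) :
    ∫⁻ ω, ENNReal.ofReal (μ[A.indicator (fun _ => (1 : ℝ)) | past η s] ω) ∂μ = μ A := by
  have hpast : past η s ≤ (inferInstance : MeasurableSpace Ω) :=
    iSup₂_le fun r _ => (hη.measurable r).comap_le
  rw [← ofReal_integral_eq_lintegral_ofReal integrable_condExp
    (condExp_nonneg (Eventually.of_forall fun ω =>
      Set.indicator_nonneg (fun _ _ => zero_le_one) ω)), integral_condExp hpast,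
    integral_indicator hA]
  simp

theorem IsLonelyBRW.one_le_measure_add [IsProbabilityMeasure μ] (hη : IsLonelyBRW p γ μ η)
    (x : Site d) (t : ℝ≥0) :
    1 ≤ μ {ω | η t ω x = 0} + (⨆ y, ∫⁻ ω, (η 0 ω y : ℝ≥0∞) ∂μ) * occSum p γ t := by
  have hempty : MeasurableSet {ω | η t ω x = 0} :=
    hη.measurable_apply t x (measurableSet_singleton 0)
  set f := fun ω => ENNReal.ofReal
    (μ[Set.indicator {ω | η t ω x = 0} (fun _ => (1 : ℝ)) | past η 0] ω)
  have hf : AEMeasurable f μ :=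
    integrable_condExp.aestronglyMeasurable.aemeasurable.ennreal_ofReal
  calc (1 : ℝ≥0∞) = ∫⁻ _, 1 ∂μ := by simp
    _ ≤ ∫⁻ ω, f ω + occBound p γ x t (η 0 ω) ∂μ :=
        lintegral_mono_ae (hη.ae_one_le_condExp_add x t)
    _ = ∫⁻ ω, f ω ∂μ + ∫⁻ ω, occBound p γ x t (η 0 ω) ∂μ := lintegral_add_left' hf _
    _ ≤ μ {ω | η t ω x = 0} + (⨆ y, ∫⁻ ω, (η 0 ω y : ℝ≥0∞) ∂μ) * occSum p γ t :=
        add_le_add (hη.lintegral_ofReal_condExp hempty 0).le (hη.lintegral_occBound_le x t)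

end System

end General

end LonelyBRW

end

theorem theorem1p2 {d : ℕ} (hd : 1 ≤ d) (p : PMF (LonelyBRW.Site d))
    (hirr : LonelyBRW.IsIrreducible p)
    (hrec : LonelyBRW.IsRecurrent (LonelyBRW.symmetrised p))
    (γ : ℝ≥0) (hγ : 0 < γ)
    {Ω : Type*} [MeasurableSpace Ω] (μ : Measure Ω) [IsProbabilityMeasure μ]
    (η : ℝ≥0 → Ω → LonelyBRW.Config d) (hη : LonelyBRW.IsLonelyBRW p γ μ η)
    (hbdd : (⨆ y, ∫⁻ ω, (η 0 ω y : ℝ≥0∞) ∂μ) < ∞) (x : LonelyBRW.Site d) :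
    Tendsto (fun t : ℝ≥0 => μ {ω | η t ω x = 0}) atTop (𝓝 1) := by
  set S := ⨆ y, ∫⁻ ω, (η 0 ω y : ℝ≥0∞) ∂μ
  have hoccSum : Tendsto (fun t : ℝ≥0 => LonelyBRW.occSum p γ t) atTop (𝓝 0) :=
    (LonelyBRW.tendsto_occSum hd hirr hrec hγ).comp (NNReal.tendsto_coe_atTop.2 tendsto_id)
  have hbound : Tendsto (fun t : ℝ≥0 => 1 - S * LonelyBRW.occSum p γ t) atTop (𝓝 1) := by
    simpa only [mul_zero, tsub_zero] using ENNReal.Tendsto.sub tendsto_const_nhds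
      (ENNReal.Tendsto.const_mul hoccSum (Or.inr hbdd.ne)) (Or.inl ENNReal.one_ne_top)
  exact tendsto_of_tendsto_of_tendsto_of_le_of_le hbound tendsto_const_nhds
    (fun t => tsub_le_iff_right.2 (hη.one_le_measure_add x t)) fun t => prob_le_one
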